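/- Let $\mathcal H_1,\dots,\mathcal H_M$ be reproducing kernel Hilbert spaces of measurable real functions on a measurable space $\mathcal X$, with kernels $k_1,\dots,k_M$ ($M$ fixed), and let $\mathcal H=\mathcal H_1\oplus\dots\oplus\mathcal H_M$ with norm $\|f\|_{\mathcal H}=(\sum_m\|f_m\|_{\mathcal H_m}^2)^{1/2}$. For $f\in\mathcal H$ write $f(x)=\sum_m f_m(x)$. Let $(x_i,y_i)_{i\ge 1}$ be i.i.d. copies of $(X,Y)\in\mathcal X\times\mathbb R$. For $\lambda_1=\lambda_1(n)$, $\lambda_2=\lambda_2(n)$ let $$\hat f=\operatorname*{arg\,min}_{f\in\mathcal H}\ \frac1n\sum_{i=1}^n\big(y_i-f(x_i)\big)^2+\lambda_1\sum_{m=1}^M\|f_m\|_{\mathcal H_m}+\lambda_2\sum_{m=1}^M\|f_m\|_{\mathcal H_m}^2 .$$ Let $\Sigma_{l,m}:\mathcal H_m\to\mathcal H_l$ be the bounded operator with $\langle f,\Sigma_{l,m}g\rangle_{\mathcal H_l}=\mathbb E[f(X)g(X)]$, and for index sets $I,J$ let $\Sigma_{I,J}=(\Sigma_{l,m})_{l\in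 I,m\in J}:\bigoplus_{m\in J}\mathcal H_m\to\bigoplus_{l\in I}\mathcal H_l$. Let $V_{l,m}:\mathcal H_m\to\mathcal H_l$ be the bounded cross-correlation operators, $\Sigma_{l,l}^{1/2}V_{l,m}\Sigma_{m,m}^{1/2}=\Sigma_{l,m}$, where $V_{m,m}=\mathrm{Id}$ and, for $l\ne m$, $V_{l,m}$ vanishes on $\ker\Sigma_{m,m}$ and has range in $(\ker\Sigma_{l,l})^\perp$; let $V=(V_{l,m})_{l,m}:\mathcal H\to\mathcal H$. Assume: - (A1) there is $f^*=(f_1^*,\dots,f_M^*)\in\mathcal H$ with $\mathbb E[Y\mid X]=f^*(X)$, and the noise $\epsilon=Y-f^*(X)$ satisfies $\mathbb E[\epsilon^2\mid X]>\sigma^2$ for some $\sigma>0$ and $|\epsilon|\le L$ for some $L$, almost surely; - (A2) every $\mathcal H_m$ is separable and $\sup_{x\in\mathcal X}|k_m(x,x)|<1$; - (A3) for every $m$ there is $g_m^*\in\mathcal H_m$ with $f_m^*=\Sigma_{m,m}^{1/2}g_m^*$; - (A10) all $V_{l,m}$ with $l\ne m$ are compact and $V$ is invertible. Let $I_0=\{m:\|f_m^*\|_{\mathcal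 H_m}>0\}$, $\hat I=\{m:\|\hat f_m\|_{\mathcal H_m}>0\}$, $f^*_{I_0}=(f^*_m)_{m\in I_0}$ and $D=\operatorname{Diag}\big((\|f_m^*\|_{\mathcal H_m}^{-1})_{m\in I_0}\big)$. Suppose that $\lambda_2>0$, $\lambda_1\to0$, $\lambda_2\to0$, $\lambda_1\sqrt n\to\infty$ as $n\to\infty$, and that $$\limsup_{n\to\infty}\Big\|\Sigma_{m,I_0}\big(\Sigma_{I_0,I_0}+\lambda_2\big)^{-1}\Big(D+2\frac{\lambda_2}{\lambda_1}\Big)f^*_{I_0}\Big\|_{\mathcal H_m}<1\qquad\text{for all } m\notin I_0 .$$ Then $\|\hat f-f^*\|_{\mathcal H}\to0$ in probability, and $\hat I\to I_0$ in probability, i.e. $\Pr(\hat I\ne I_0)\to0$. -/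

import Mathlib

open MeasureTheory ProbabilityTheory Filter Topology RKHS
open scoped RealInnerProductSpace ENNReal

noncomputable section

namespace MKL

/-! ### Block operators between finite Hilbert direct sums -/

section Block

/-- The operator `⊕ₘ E m → ⊕ₗ F l` with blocks `T l m : E m → F l`,
that is `(T h)ₗ = ∑ₘ T l m (h m)`. -/
def blockOp {κ κ' : Type*} [Fintype κ] [Fintype κ'] {E : κ → Type*} {F : κ' → Type*}
    [∀ m, NormedAddCommGroup (E m)] [∀ m, InnerProductSpace ℝ (E m)]
    [∀ l, NormedAddCommGroup (F l)] [∀ l, InnerProductSpace ℝ (F l)]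
    (T : ∀ (l : κ') (m : κ), E m →L[ℝ] F l) : PiLp 2 E →L[ℝ] PiLp 2 F :=
  (PiLp.continuousLinearEquiv 2 ℝ F).symm.toContinuousLinearMap ∘L
    ContinuousLinearMap.pi fun l => ∑ m, T l m ∘L PiLp.proj 2 E m

/-- The block-diagonal operator `(h m)ₘ ↦ (c m • h m)ₘ`. -/
def diagOp {κ : Type*} [Fintype κ] {E : κ → Type*}
    [∀ m, NormedAddCommGroup (E m)] [∀ m, InnerProductSpace ℝ (E m)]
    (c : κ → ℝ) : PiLp 2 E →L[ℝ] PiLp 2 E :=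
  (PiLp.continuousLinearEquiv 2 ℝ E).symm.toContinuousLinearMap ∘L
    ContinuousLinearMap.pi fun m => c m • PiLp.proj 2 E m

theorem blockOp_apply {κ κ' : Type*} [Fintype κ] [Fintype κ'] {E : κ → Type*} {F : κ' → Type*}
    [∀ m, NormedAddCommGroup (E m)] [∀ m, InnerProductSpace ℝ (E m)]
    [∀ l, NormedAddCommGroup (F l)] [∀ l, InnerProductSpace ℝ (F l)]
    (T : ∀ (l : κ') (m : κ), E m →L[ℝ] F l) (h : PiLp 2 E) (l : κ') :
    blockOp T h l = ∑ m, T l m (h m) := by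
  simp [blockOp]

theorem diagOp_apply {κ : Type*} [Fintype κ] {E : κ → Type*}
    [∀ m, NormedAddCommGroup (E m)] [∀ m, InnerProductSpace ℝ (E m)]
    (c : κ → ℝ) (h : PiLp 2 E) (m : κ) : diagOp c h m = c m • h m := by
  simp [diagOp]

/-- `R` is the (unique) positive square root of the bounded operator `T`. -/
def IsPosSqrt {E : Type*} [NormedAddCommGroup E] [InnerProductSpace ℝ E]
    (T R : E →L[ℝ] E) : Prop :=
  R.IsPositive ∧ R ∘L R = T

end Block

section Setting

variable {𝒳 : Type*} [MeasurableSpace 𝒳] {ι : Type*} [Fintype ι] {H : ι → Type*}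
  [∀ m, NormedAddCommGroup (H m)] [∀ m, InnerProductSpace ℝ (H m)]
  [∀ m, RKHS ℝ (H m) 𝒳 ℝ]

/-- The function `f(x) = ∑ₘ fₘ(x)` represented by `f = (fₘ)ₘ ∈ ⊕ₘ H m`. -/
def evalSum (f : PiLp 2 H) (x : 𝒳) : ℝ := ∑ m, f m x

/-- The active indices `{m | ‖fₘ‖ > 0}` of `f ∈ ⊕ₘ H m`. -/
def activeSet {ι : Type*} [Fintype ι] {H : ι → Type*} [∀ m, NormedAddCommGroup (H m)]
    (f : PiLp 2 H) : Finset ι :=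
  Finset.univ.filter fun m => 0 < ‖f m‖

/-- The restriction `f_I = (fₘ)_{m ∈ I}`. -/
def restrict {ι : Type*} {H : ι → Type*} (I : Finset ι) (f : PiLp 2 H) :
    PiLp 2 (fun m : I => H m) :=
  WithLp.toLp 2 fun m => f m

/-- The elastic-net multiple kernel learning objective for the sample
`(x 0, y 0), …, (x (n - 1), y (n - 1))`. -/
def objective (n : ℕ) (lam₁ lam₂ : ℝ) (x : ℕ → 𝒳) (y : ℕ → ℝ) (f : PiLp 2 H) : ℝ :=
  (1 / (n : ℝ)) * ∑ i ∈ Finset.range n, (y i - evalSum f (x i)) ^ 2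
    + lam₁ * ∑ m, ‖f m‖ + lam₂ * ∑ m, ‖f m‖ ^ 2

/-- The (non-centered) cross covariance operator `Σ_{l,m} : H m → H l`: the unique bounded operator
with `⟪f, Σ_{l,m} g⟫ = 𝔼[f(X) g(X)]`. It exists for measurable bounded kernels,
see `inner_crossCov`. -/
def crossCov (ν : Measure 𝒳) (l m : ι) : H m →L[ℝ] H l :=
  open Classical in
  if h : ∃ S : H m →L[ℝ] H l, ∀ (f : H l) (g : H m), ⟪f, S g⟫ = ∫ x, f x * g x ∂ν
  then h.choose else 0

/-- The joint operator `Σ_{I,I}` on `⊕_{m ∈ I} H m`. -/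
def covOn (ν : Measure 𝒳) (I : Finset ι) :
    PiLp 2 (fun m : I => H m) →L[ℝ] PiLp 2 (fun m : I => H m) :=
  blockOp fun l m : I => crossCov (H := H) ν l m

/-- The row operator `Σ_{m,I} : ⊕_{l ∈ I} H l → H m`. -/
def covRow (ν : Measure 𝒳) (m : ι) (I : Finset ι) :
    PiLp 2 (fun l : I => H l) →L[ℝ] H m :=
  ∑ l : I, crossCov (H := H) ν m l ∘L PiLp.proj 2 (fun l : I => H l) l

/-- The operator `D = Diag(‖fₘ‖⁻¹)` on `⊕_{m ∈ I} H m` with `I` the active set of `f`. -/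
def invNormDiag (f : PiLp 2 H) :
    PiLp 2 (fun m : activeSet f => H m) →L[ℝ] PiLp 2 (fun m : activeSet f => H m) :=
  diagOp fun m => ‖f m‖⁻¹

/-- The element `Σ_{m,I} (Σ_{I,I} + lam₂)⁻¹ (D + 2 lam₂ / lam₁) f_I` of `H m`,
where `I` is the active set of `f`. -/
def irrepVec (ν : Measure 𝒳) (f : PiLp 2 H) (lam₁ lam₂ : ℝ) (m : ι) : H m :=
  covRow ν m (activeSet f)
    (Ring.inverse (covOn (H := H) ν (activeSet f) + lam₂ • 1)
      ((invNormDiag f + (2 * (lam₂ / lam₁)) • 1) (restrict (activeSet f) f)))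

/-- (A1) The regression function `𝔼[Y|X]` is `∑ₘ f*ₘ(X)`, and the noise `ε = Y - f*(X)` has
conditional variance bounded below and is bounded. Here `P` is the law of `(X, Y)`. -/
def RegressionModel (P : Measure (𝒳 × ℝ)) (fstar : PiLp 2 H) : Prop :=
  P[fun z => z.2 | MeasurableSpace.comap Prod.fst inferInstance]
      =ᵐ[P] (fun z => evalSum fstar z.1) ∧
  (∃ σ : ℝ, 0 < σ ∧ ∀ᵐ z ∂P, σ ^ 2 <
      (P[fun z => (z.2 - evalSum fstar z.1) ^ 2 |
        MeasurableSpace.comap Prod.fst inferInstance]) z) ∧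
  ∃ L : ℝ, ∀ᵐ z ∂P, |z.2 - evalSum fstar z.1| ≤ L

/-- (A3) `f*ₘ = Σ_{m,m}^{1/2} g*ₘ` for some `g*ₘ ∈ H m`. -/
def SourceCondition (ν : Measure 𝒳) (fstar : PiLp 2 H) : Prop :=
  ∀ m, ∃ R : H m →L[ℝ] H m, IsPosSqrt (crossCov ν m m) R ∧ ∃ g : H m, fstar m = R g

/-- `V` is the family of cross-correlation operators: `Σ_{l,l}^{1/2} V_{l,m} Σ_{m,m}^{1/2} = Σ_{l,m}`,
with `V_{m,m} = I`, and for `l ≠ m` normalised as usual to vanish on `ker Σ_{m,m}` and to take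
values in `(ker Σ_{l,l})ᗮ`, which makes `V` unique. (The normalisation is void when the
`Σ_{m,m}` are injective.) -/
structure IsCrossCorrelation (ν : Measure 𝒳) (V : ∀ l m : ι, H m →L[ℝ] H l) : Prop where
  diag : ∀ m, V m m = 1
  factor : ∀ l m, ∃ (Rl : H l →L[ℝ] H l) (Rm : H m →L[ℝ] H m),
    IsPosSqrt (crossCov ν l l) Rl ∧ IsPosSqrt (crossCov ν m m) Rm ∧
      Rl ∘L V l m ∘L Rm = crossCov ν l m
  ker_right : ∀ l m, l ≠ m → ∀ g : H m, crossCov ν m m g = 0 → V l m g = 0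
  ker_left : ∀ l m, l ≠ m → ∀ (f : H l) (g : H m), crossCov ν l l f = 0 → ⟪f, V l m g⟫ = 0

/-- (A10) The cross-correlation operators `V_{l,m}`, `l ≠ m`, are compact and the joint correlation
operator `V` on `⊕ₘ H m` is invertible. -/
def CorrelationCondition (ν : Measure 𝒳) (H : ι → Type*)
    [∀ m, NormedAddCommGroup (H m)] [∀ m, InnerProductSpace ℝ (H m)]
    [∀ m, RKHS ℝ (H m) 𝒳 ℝ] : Prop :=
  ∃ V : ∀ l m : ι, H m →L[ℝ] H l, IsCrossCorrelation ν V ∧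
    (∀ l m, l ≠ m → IsCompactOperator (V l m)) ∧ IsUnit (blockOp V)

/-- (A2) Each `H m` is separable and `sup_x |kₘ(x,x)| < 1`. -/
def SeparableBoundedKernels (H : ι → Type*)
    [∀ m, NormedAddCommGroup (H m)] [∀ m, InnerProductSpace ℝ (H m)] [∀ m, CompleteSpace (H m)]
    [∀ m, RKHS ℝ (H m) 𝒳 ℝ] : Prop :=
  ∀ m, TopologicalSpace.SeparableSpace (H m) ∧
    ∃ c : ℝ, c < 1 ∧ ∀ x : 𝒳, |RKHS.kernel (H m) x x 1| ≤ c

theorem abs_apply_le_norm [∀ m, CompleteSpace (H m)] (hB : SeparableBoundedKernels (𝒳 := 𝒳) H)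
    (m : ι) (f : H m) (x : 𝒳) : |f x| ≤ ‖f‖ := by
  obtain ⟨-, c, hc, h⟩ := hB m
  have h1 := RKHS.norm_apply_le f x
  have h2 : ‖RKHS.kernel (H m) x x‖ ≤ 1 := by
    refine ContinuousLinearMap.opNorm_le_bound _ zero_le_one fun v => ?_
    have : RKHS.kernel (H m) x x v = v * RKHS.kernel (H m) x x 1 := by
      rw [← smul_eq_mul, ← map_smul, smul_eq_mul, mul_one]
    rw [this, norm_mul, one_mul]
    exact mul_le_of_le_one_right (norm_nonneg _) ((h x).trans hc.le)
  rw [← Real.norm_eq_abs]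
  refine h1.trans (mul_le_of_le_one_right (norm_nonneg _) ?_)
  exact Real.sqrt_le_one.mpr h2

/-- The defining property of the cross covariance operator. -/
theorem inner_crossCov [∀ m, CompleteSpace (H m)] (ν : Measure 𝒳) [IsProbabilityMeasure ν]
    (hM : ∀ (m : ι) (f : H m), Measurable fun x => f x)
    (hB : SeparableBoundedKernels (𝒳 := 𝒳) H) (l m : ι) (f : H l) (g : H m) :
    ⟪f, crossCov ν l m g⟫ = ∫ x, f x * g x ∂ν := by
  have hint : ∀ (f : H l) (g : H m), Integrable (fun x => f x * g x) ν := fun f g =>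
    Integrable.of_bound ((hM l f).mul (hM m g)).aestronglyMeasurable (‖f‖ * ‖g‖)
      (.of_forall fun x => by
        rw [norm_mul]
        exact mul_le_mul (abs_apply_le_norm hB l f x) (abs_apply_le_norm hB m g x)
          (norm_nonneg _) (norm_nonneg _))
  let B : H m →L[ℝ] H l →L[ℝ] ℝ := LinearMap.mkContinuous₂
    (LinearMap.mk₂ ℝ (fun (g : H m) (f : H l) => ∫ x, f x * g x ∂ν)
      (fun g g' f => by
        rw [← integral_add (hint f g) (hint f g')]
        simp [mul_add])
      (fun c g f => by
        rw [smul_eq_mul, ← integral_const_mul]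
        congr 1; ext x; simp; ring)
      (fun g f f' => by
        rw [← integral_add (hint f g) (hint f' g)]
        simp [add_mul])
      (fun c g f => by
        rw [smul_eq_mul, ← integral_const_mul]
        congr 1; ext x; simp; ring)) 1 (fun g f => by
        rw [LinearMap.mk₂_apply, one_mul]
        refine (norm_integral_le_of_norm_le_const (C := ‖g‖ * ‖f‖) (.of_forall fun x => ?_)).trans
          (by simp)
        rw [norm_mul, mul_comm]
        exact mul_le_mul (abs_apply_le_norm hB m g x) (abs_apply_le_norm hB l f x)
          (norm_nonneg _) (norm_nonneg _))
  have hex : ∃ S : H m →L[ℝ] H l, ∀ (f : H l) (g : H m), ⟪f, S g⟫ = ∫ x, f x * g x ∂ν := by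
    refine ⟨(InnerProductSpace.toDual ℝ (H l)).symm.toContinuousLinearEquiv.toContinuousLinearMap
      ∘L B, fun f g => ?_⟩
    rw [real_inner_comm]
    simp [B]
  rw [crossCov, dif_pos hex]
  exact hex.choose_spec f g

end Setting

end MKL

end

/-!
Everything takes place in the Hilbert space `⊕ₘ H m`. By the reproducing property the objective is,
up to a constant, the quadratic problem `hilbertObjective` with the empirical covariance operator
`empCov` and the noise vector `noiseVec`. Both are within `O(1 / √n)`, hence within `o(lam₁)`, in
probability of the population covariance `jointCov` and of zero. Convergence in probability is
convergence along the filter `probFilter` on `ℕ × Ω`, so the analysis of minimizers is deterministic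
and is done along an arbitrary filter (`VanishingRegularization`).

*Source condition.* Since the joint correlation operator is invertible it is coercive, and
`f*ₘ = Σ_{m,m}^{1/2} g*ₘ` gives `|⟪f*ₘ, hₘ⟫| ≤ K √⟪h, Σ h⟫` for all `h` (`exists_source_bound`).

*Norm consistency.* The basic inequality bounds the minimizer and makes `⟪f̂ - f*, Σ (f̂ - f*)⟫`
vanish. By the source bound `⟪f*ₘ, f̂ₘ - f*ₘ⟫ → 0`, which bounds `‖f̂ₘ‖` from below; the penalty
bounds it from above, so `f̂ → f*` in norm (`VanishingRegularization.tendsto_minimizer`).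

*Support recovery.* Norm consistency gives `I₀ ⊆ Î`. For the converse let `f` be the part of the
minimizer outside `I₀`, and `u` its empirical ridge projection onto the blocks in `I₀` with weights
`eₘ = lam₁ / (2 ‖f̂ₘ‖) + lam₂`. The optimality conditions give
`(lam₁ / 2) ∑ ‖fₘ‖ ≤ ∑ eₘ ⟪uₘ, f*ₘ⟫ + ⟪w, f - u⟫`, where `w` is the noise vector. Up to `o(lam₁) ‖f‖`
the first sum is `lam₁ / 2` times the pairing of `f` with the vector in the irrepresentable
condition, so it is at most `κ (lam₁ / 2) ∑ ‖fₘ‖` with `κ < 1`. If also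
`|⟪w, f - u⟫| = o(lam₁) ‖f‖`, then `f = 0` (`VanishingRegularization.eventually_activeSet_eq`).

*The noise term.* The weights `eₘ` and the direction `f` depend on the noise, so the last estimate
has to be uniform in both, and the plain bound `‖w‖ ‖f - u‖` loses a factor `lam₂^{-1/2}`, as `u` is
only bounded by `‖f‖ / √lam₂`. The values `r` of `f - u` at the sample points solve
`(1 + ∑ eₘ⁻¹ Kₘ) r = a`, with `Kₘ` the Gram matrices and `a` the values of `f`. As
`eₘ` is close to the deterministic weight with `‖f*ₘ‖` for `‖f̂ₘ‖`, the matrix is a small relative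
perturbation of one depending on the covariates only. Expanding `n⁻¹ ∑ εᵢ rᵢ` in a Neumann series
bounds it by `n^{-1/2} ‖f‖` times a quadratic form in `ε`, whose matrix depends on the covariates
only and has bounded trace, plus an exponentially small remainder (`abs_inner_noiseVec_le`). The
expectation of such a form is bounded because the noise terms are centred and uncorrelated given
the covariates (`lintegral_noise_form_le`).
-/

namespace MKL

/-! ### Positive operators on real Hilbert spaces -/

section Positive

variable {E : Type*} [NormedAddCommGroup E] [InnerProductSpace ℝ E]

theorem sq_le_mul_of_quadratic_nonneg {a b c : ℝ} (h : ∀ s : ℝ, 0 ≤ a + 2 * s * b + s ^ 2 * c) :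
    b ^ 2 ≤ a * c := by
  have := discrim_le_zero (a := c) (b := 2 * b) (c := a) fun s => by linarith [h s]
  rw [discrim] at this
  linarith

/-- The Cauchy–Schwarz inequality for the semi-inner product of a positive operator. -/
theorem inner_sq_le_of_isPositive {T : E →L[ℝ] E} (hT : T.IsPositive) (u v : E) :
    ⟪u, T v⟫ ^ 2 ≤ ⟪u, T u⟫ * ⟪v, T v⟫ := by
  refine sq_le_mul_of_quadratic_nonneg fun s => ?_
  have h := hT.inner_nonneg_right (u + s • v)
  have hs : ⟪v, T u⟫ = ⟪u, T v⟫ := by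
    rw [← hT.inner_left_eq_inner_right, real_inner_comm]
  simp only [map_add, map_smul, inner_add_left, inner_add_right, inner_smul_left, inner_smul_right,
    hs, conj_trivial] at h
  linarith

theorem abs_inner_le_sqrt_mul_sqrt {T : E →L[ℝ] E} (hT : T.IsPositive) (u v : E) :
    |⟪u, T v⟫| ≤ √⟪u, T u⟫ * √⟪v, T v⟫ := by
  rw [← Real.sqrt_mul (hT.inner_nonneg_right u)]
  exact Real.abs_le_sqrt (inner_sq_le_of_isPositive hT u v)

theorem norm_sq_apply_le_of_isPositive {T : E →L[ℝ] E} (hT : T.IsPositive) (v : E) :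
    ‖T v‖ ^ 2 ≤ ‖T‖ * ⟪v, T v⟫ := by
  have h := inner_sq_le_of_isPositive hT (T v) v
  have h1 : ⟪T v, T (T v)⟫ ≤ ‖T‖ * ‖T v‖ ^ 2 :=
    (real_inner_le_norm _ _).trans (by nlinarith [T.le_opNorm (T v), norm_nonneg (T v)])
  rw [real_inner_self_eq_norm_sq] at h
  have h0 := hT.inner_nonneg_right v
  rcases eq_or_ne (‖T v‖) 0 with h2 | h2
  · rw [h2]
    have := mul_nonneg (norm_nonneg T) h0
    simpa using this
  · have h3 : 0 < ‖T v‖ ^ 2 := by positivity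
    nlinarith [mul_le_mul_of_nonneg_right h1 h0]

theorem inner_apply_self_le (T : E →L[ℝ] E) (v : E) : ⟪v, T v⟫ ≤ ‖T‖ * ‖v‖ ^ 2 :=
  (real_inner_le_norm _ _).trans (by nlinarith [T.le_opNorm v, norm_nonneg v])

/-- Positive square roots are unique. With `D = A - B` and a small `t > 0`, the relation
`(1 + t A) D = D (1 - t B)` shows that `(1 + t A)ᵏ D x` stays bounded, although its squared norm
grows at least by `k t² ‖A D x‖²`. Hence `A D = 0`, and `D² = 0` follows by symmetry. -/
theorem eq_of_isPositive_of_comp_self_eq {A B : E →L[ℝ] E} (hA : A.IsPositive)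
    (hB : B.IsPositive) (h : A ∘L A = B ∘L B) : A = B := by
  have hAB : ∀ x, A (A x) = B (B x) := fun x => by
    simpa using congrArg (fun T : E →L[ℝ] E => T x) h
  have key : ∀ {A B : E →L[ℝ] E}, A.IsPositive → B.IsPositive →
      (∀ x, A (A x) = B (B x)) → ∀ x, A (A x - B x) = 0 := by
    intro A B hA hB hAB x
    set t : ℝ := (‖B‖ + 1)⁻¹ with ht
    have htpos : 0 < t := by positivity
    have htB : t * ‖B‖ ≤ 1 := by
      rw [ht, inv_mul_le_iff₀ (by positivity)]; linarith
    -- `U` expands by the growth rate of `A`, `W` is a contraction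
    let U : E → E := fun y => y + t • A y
    let W : E → E := fun y => y - t • B y
    have hUW : ∀ k x, U^[k] (A x - B x) = A (W^[k] x) - B (W^[k] x) := by
      intro k
      induction k with
      | zero => intro x; rfl
      | succ k ih =>
        intro x
        rw [Function.iterate_succ_apply, Function.iterate_succ_apply, ← ih (W x)]
        congr 1
        simp only [U, W, map_sub, map_smul, hAB x]
        module
    have hW : ∀ y, ‖W y‖ ≤ ‖y‖ := by
      intro y
      refine le_of_sq_le_sq ?_ (norm_nonneg _)
      simp only [W]
      rw [norm_sub_sq_real, inner_smul_right, norm_smul, mul_pow, Real.norm_eq_abs, sq_abs]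
      have h1 := norm_sq_apply_le_of_isPositive hB y
      have h2 := hB.inner_nonneg_right y
      nlinarith [mul_le_mul_of_nonneg_left h1 (sq_nonneg t),
        mul_nonneg htpos.le (mul_nonneg (sub_nonneg.2 htB) h2), mul_nonneg htpos.le h2]
    have hWk : ∀ k, ‖W^[k] x‖ ≤ ‖x‖ := by
      intro k
      induction k with
      | zero => rfl
      | succ k ih => rw [Function.iterate_succ_apply']; exact (hW _).trans ih
    have hUsq : ∀ y, ‖y‖ ^ 2 + t ^ 2 * ‖A y‖ ^ 2 ≤ ‖U y‖ ^ 2 := by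
      intro y
      simp only [U]
      rw [norm_add_sq_real, inner_smul_right, norm_smul, mul_pow, Real.norm_eq_abs, sq_abs]
      have := mul_nonneg htpos.le (hA.inner_nonneg_right y)
      linarith
    have hUA : ∀ y, A (U y) = U (A y) := fun y => by simp [U]
    have hU1 : ∀ y, ‖y‖ ≤ ‖U y‖ := fun y =>
      le_of_sq_le_sq ((le_add_of_nonneg_right (by positivity)).trans (hUsq y)) (norm_nonneg _)
    have hAk : ∀ k y, ‖A y‖ ≤ ‖A (U^[k] y)‖ := by
      intro k
      induction k with
      | zero => intro y; rfl
      | succ k ih =>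
        intro y
        rw [Function.iterate_succ_apply]
        exact ((hU1 _).trans_eq (by rw [hUA])).trans (ih (U y))
    have hgrow : ∀ (k : ℕ) y, (k : ℝ) * (t ^ 2 * ‖A y‖ ^ 2) ≤ ‖U^[k] y‖ ^ 2 := by
      intro k y
      induction k with
      | zero => simp
      | succ k ih =>
        rw [Function.iterate_succ_apply']
        refine le_trans ?_ (hUsq _)
        have := pow_le_pow_left₀ (norm_nonneg _) (hAk k y) 2
        push_cast
        nlinarith [mul_le_mul_of_nonneg_left this (sq_nonneg t)]
    have hbd : ∀ k, ‖U^[k] (A x - B x)‖ ≤ (‖A‖ + ‖B‖) * ‖x‖ := by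
      intro k
      rw [hUW]
      refine (norm_sub_le _ _).trans ?_
      nlinarith [A.le_opNorm (W^[k] x), B.le_opNorm (W^[k] x), hWk k, norm_nonneg A, norm_nonneg B]
    by_contra hne
    have hpos : 0 < t ^ 2 * ‖A (A x - B x)‖ ^ 2 := by positivity
    obtain ⟨k, hk⟩ := exists_nat_gt (((‖A‖ + ‖B‖) * ‖x‖) ^ 2 / (t ^ 2 * ‖A (A x - B x)‖ ^ 2))
    rw [div_lt_iff₀ hpos] at hk
    have := (hgrow k (A x - B x)).trans (pow_le_pow_left₀ (norm_nonneg _) (hbd k) 2)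
    linarith
  ext x
  have h1 := key hA hB hAB x
  have h2 := key hB hA (fun x => (hAB x).symm) x
  have h3 : ⟪A x - B x, A x - B x⟫ = 0 := by
    have h4 : A (A x - B x) - B (A x - B x) = 0 := by
      rw [h1, ← neg_sub (B x) (A x), map_neg, h2]; simp
    rw [inner_sub_left, hA.inner_left_eq_inner_right, hB.inner_left_eq_inner_right,
      ← inner_sub_right, h4, inner_zero_right]
  exact sub_eq_zero.1 (inner_self_eq_zero.1 h3)

/-- An invertible positive operator is coercive. -/
theorem exists_coercive_of_isUnit {V : E →L[ℝ] E} (hV : V.IsPositive) (hu : IsUnit V) :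
    ∃ c : ℝ, 0 < c ∧ ∀ h, c * ‖h‖ ^ 2 ≤ ⟪h, V h⟫ := by
  obtain ⟨u, rfl⟩ := hu
  set N := ‖(↑u⁻¹ : E →L[ℝ] E)‖ ^ 2 * ‖(u : E →L[ℝ] E)‖ + 1 with hN
  have hNpos : 0 < N := by positivity
  refine ⟨N⁻¹, by positivity, fun h => ?_⟩
  rw [inv_mul_le_iff₀ hNpos]
  have h1 : ‖h‖ ≤ ‖(↑u⁻¹ : E →L[ℝ] E)‖ * ‖(u : E →L[ℝ] E) h‖ := by
    have : (↑u⁻¹ : E →L[ℝ] E) ((u : E →L[ℝ] E) h) = h := by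
      rw [← mul_apply_eq_comp, Units.inv_mul]; rfl
    conv_lhs => rw [← this]
    exact ContinuousLinearMap.le_opNorm _ _
  have h2 := norm_sq_apply_le_of_isPositive hV h
  have h3 := hV.inner_nonneg_right h
  calc ‖h‖ ^ 2 ≤ (‖(↑u⁻¹ : E →L[ℝ] E)‖ * ‖(u : E →L[ℝ] E) h‖) ^ 2 :=
        pow_le_pow_left₀ (norm_nonneg _) h1 2
    _ = ‖(↑u⁻¹ : E →L[ℝ] E)‖ ^ 2 * ‖(u : E →L[ℝ] E) h‖ ^ 2 := by ring
    _ ≤ ‖(↑u⁻¹ : E →L[ℝ] E)‖ ^ 2 * (‖(u : E →L[ℝ] E)‖ * ⟪h, (u : E →L[ℝ] E) h⟫) := by gcongr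
    _ ≤ N * ⟪h, (u : E →L[ℝ] E) h⟫ := by rw [hN]; nlinarith

/-- A functional `⟪p, ·⟫` that is bounded for the seminorm `h ↦ √⟪h, C h⟫` is approximated in that
seminorm by functionals of the form `⟪v, C ·⟫`. A near-minimiser `v` of `⟪v, C v⟫ - 2 ⟪p, v⟫`
does. -/
theorem exists_approx_of_bounded {C : E →L[ℝ] E} (hC : C.IsPositive) {p : E} {K : ℝ}
    (hp : ∀ h, |⟪p, h⟫| ≤ K * √⟪h, C h⟫) {η : ℝ} (hη : 0 < η) :
    ∃ v, ∀ h, |⟪p, h⟫ - ⟪v, C h⟫| ≤ η * √⟪h, C h⟫ := by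
  let F : E → ℝ := fun v => ⟪v, C v⟫ - 2 * ⟪p, v⟫
  have hF : BddBelow (Set.range F) := by
    refine ⟨-K ^ 2, ?_⟩
    rintro _ ⟨v, rfl⟩
    have h1 := (abs_le.1 (hp v)).2
    have h2 := Real.sq_sqrt (hC.inner_nonneg_right v)
    simp only [F]
    nlinarith [sq_nonneg (√⟪v, C v⟫ - K)]
  obtain ⟨v, hv⟩ := exists_lt_of_ciInf_lt
    (show (⨅ v, F v) < (⨅ v, F v) + η ^ 2 from lt_add_of_pos_right _ (by positivity))
  refine ⟨v, fun h => ?_⟩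
  rw [show η * √⟪h, C h⟫ = √(η ^ 2 * ⟪h, C h⟫) by
    rw [Real.sqrt_mul (sq_nonneg η), Real.sqrt_sq hη.le]]
  refine Real.abs_le_sqrt (sq_le_mul_of_quadratic_nonneg fun s => ?_)
  have h1 := ciInf_le hF (v - s • h)
  have hs : ⟪h, C v⟫ = ⟪v, C h⟫ := by rw [← hC.inner_left_eq_inner_right, real_inner_comm]
  have h2 : F (v - s • h) = F v + 2 * s * (⟪p, h⟫ - ⟪v, C h⟫) + s ^ 2 * ⟪h, C h⟫ := by
    simp only [F, map_sub, map_smul, inner_sub_left, inner_sub_right, inner_smul_left,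
      inner_smul_right, hs, conj_trivial]
    ring
  linarith

theorem isUnit_of_coercive [CompleteSpace E] {T : E →L[ℝ] E} {c : ℝ} (hc : 0 < c)
    (hT : ∀ h, c * ‖h‖ ^ 2 ≤ ⟪h, T h⟫) : IsUnit T :=
  ContinuousLinearMap.isUnit_of_forall_le_norm_inner_map T (c := ⟨c, hc.le⟩) hc fun h => by
    rw [real_inner_comm, mul_comm]
    exact (hT h).trans (Real.le_norm_self _)

theorem exists_apply_eq_of_coercive [CompleteSpace E] {T : E →L[ℝ] E} {c : ℝ} (hc : 0 < c)
    (hT : ∀ h, c * ‖h‖ ^ 2 ≤ ⟪h, T h⟫) (p : E) : ∃ u, T u = p := by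
  obtain ⟨U, rfl⟩ := isUnit_of_coercive hc hT
  refine ⟨(↑U⁻¹ : E →L[ℝ] E) p, ?_⟩
  rw [← mul_apply_eq_comp, Units.mul_inv]; rfl

end Positive

end MKL

namespace MKL

/-! ### Norm consistency of the penalized minimizer -/

section Consistency

theorem norm_sq_eq_sum {ι : Type*} [Fintype ι] {H : ι → Type*} [∀ m, NormedAddCommGroup (H m)]
    (f : PiLp 2 H) : ‖f‖ ^ 2 = ∑ m, ‖f m‖ ^ 2 :=
  PiLp.norm_sq_eq_of_L2 H f

theorem norm_apply_le_norm {ι : Type*} [Fintype ι] {H : ι → Type*} [∀ m, NormedAddCommGroup (H m)]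
    (f : PiLp 2 H) (m : ι) : ‖f m‖ ≤ ‖f‖ :=
  PiLp.norm_apply_le f m

theorem norm_le_sum_norm {ι : Type*} [Fintype ι] {H : ι → Type*} [∀ m, NormedAddCommGroup (H m)]
    (f : PiLp 2 H) : ‖f‖ ≤ ∑ m, ‖f m‖ := by
  refine le_of_sq_le_sq ?_ (Finset.sum_nonneg fun _ _ => norm_nonneg _)
  rw [norm_sq_eq_sum]
  exact Finset.sum_sq_le_sq_sum_of_nonneg fun _ _ => norm_nonneg _

variable {ι : Type*} [Fintype ι] {H : ι → Type*}
  [∀ m, NormedAddCommGroup (H m)] [∀ m, InnerProductSpace ℝ (H m)]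

/-- The elastic-net objective in Hilbert space form, up to an additive constant: the squared loss
enters through the empirical covariance operator `Chat` and the noise vector `w`. -/
noncomputable def hilbertObjective (Chat : PiLp 2 H →L[ℝ] PiLp 2 H) (w fstar : PiLp 2 H) (lam₁ lam₂ : ℝ)
    (f : PiLp 2 H) : ℝ :=
  ⟪f - fstar, Chat (f - fstar)⟫ - 2 * ⟪w, f - fstar⟫
    + lam₁ * ∑ m, ‖f m‖ + lam₂ * ∑ m, ‖f m‖ ^ 2

/-- Minimizers of the elastic-net objective along a filter `l`, in the regime where the
regularization vanishes, but more slowly than the noise and the covariance error. Convergence in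
probability is convergence along a suitable filter, so this covers the statistical setting. -/
structure VanishingRegularization {α : Type*} (l : Filter α) (C : PiLp 2 H →L[ℝ] PiLp 2 H)
    (fstar : PiLp 2 H) (lam₁ lam₂ : α → ℝ) (Chat : α → PiLp 2 H →L[ℝ] PiLp 2 H)
    (w fhat : α → PiLp 2 H) : Prop where
  isPositive : C.IsPositive
  isPositive_emp : ∀ a, (Chat a).IsPositive
  pos₁ : ∀ᶠ a in l, 0 < lam₁ a
  pos₂ : ∀ᶠ a in l, 0 < lam₂ a
  tendsto₁ : Tendsto lam₁ l (𝓝 0)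
  tendsto₂ : Tendsto lam₂ l (𝓝 0)
  noise : Tendsto (fun a => ‖w a‖ / lam₁ a) l (𝓝 0)
  cov : Tendsto (fun a => ‖Chat a - C‖ / lam₁ a) l (𝓝 0)
  /-- The source condition: every component of `fstar` is bounded for the seminorm of `C`. -/
  source : ∃ K : ℝ, 0 ≤ K ∧ ∀ m h, |⟪fstar m, h m⟫| ≤ K * √⟪h, C h⟫
  isMin : ∀ᶠ a in l, ∀ g, hilbertObjective (Chat a) (w a) fstar (lam₁ a) (lam₂ a) (fhat a)
    ≤ hilbertObjective (Chat a) (w a) fstar (lam₁ a) (lam₂ a) g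

variable {C Chat : PiLp 2 H →L[ℝ] PiLp 2 H} {w fstar fhat : PiLp 2 H} {lam₁ lam₂ K : ℝ}

/-- Comparison of a minimizer with the target. -/
theorem basic_inequality
    (hmin : hilbertObjective Chat w fstar lam₁ lam₂ fhat
      ≤ hilbertObjective Chat w fstar lam₁ lam₂ fstar) :
    ⟪fhat - fstar, Chat (fhat - fstar)⟫ + lam₁ * ∑ m, (‖fhat m‖ - ‖fstar m‖)
      + lam₂ * ∑ m, (‖fhat m‖ ^ 2 - ‖fstar m‖ ^ 2) ≤ 2 * (‖w‖ * ‖fhat - fstar‖) := by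
  simp only [hilbertObjective, sub_self, map_zero, inner_zero_right, mul_zero] at hmin
  have := real_inner_le_norm w (fhat - fstar)
  simp only [Finset.sum_sub_distrib, mul_sub]
  linarith

/-- The minimizer is bounded: either the norm or the squared norm part of its penalty is
controlled by that of the target. -/
theorem norm_minimizer_le (hChat : Chat.IsPositive) (h₁ : 0 < lam₁) (h₂ : 0 < lam₂)
    (hw : ‖w‖ / lam₁ ≤ 1 / 4)
    (hmin : hilbertObjective Chat w fstar lam₁ lam₂ fhat
      ≤ hilbertObjective Chat w fstar lam₁ lam₂ fstar) :
    ‖fhat‖ ≤ 3 * ∑ m, ‖fstar m‖ := by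
  have hb := basic_inequality hmin
  have h0 := hChat.inner_nonneg_right (fhat - fstar)
  rw [div_le_iff₀ h₁] at hw
  have h3 := norm_sub_le fhat fstar
  have h4 := norm_le_sum_norm fhat
  have h5 := norm_le_sum_norm fstar
  simp only [Finset.sum_sub_distrib, mul_sub, ← norm_sq_eq_sum] at hb
  by_contra! hlt
  have h6 : ‖fstar‖ ^ 2 ≤ ‖fhat‖ ^ 2 := by
    have : 0 ≤ ∑ m, ‖fstar m‖ := Finset.sum_nonneg fun _ _ => norm_nonneg _
    exact pow_le_pow_left₀ (norm_nonneg _) (by linarith) 2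
  have h7 : ‖w‖ * ‖fhat - fstar‖ ≤ lam₁ * ((∑ m, ‖fhat m‖ + ∑ m, ‖fstar m‖) / 4) := by
    calc ‖w‖ * ‖fhat - fstar‖ ≤ (1 / 4 * lam₁) * (∑ m, ‖fhat m‖ + ∑ m, ‖fstar m‖) := by
          gcongr
          linarith
      _ = _ := by ring
  nlinarith

set_option maxHeartbeats 1000000 in
/-- An explicit bound for the error of the minimizer, all of whose ingredients vanish
asymptotically. The bound `θ` on `⟪fstar m, fstar m - fhat m⟫` prevents `‖fhat m‖` from falling
much below `‖fstar m‖`, and the basic inequality then prevents it from exceeding `‖fstar m‖` by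
more than `s`. -/
theorem norm_sq_minimizer_sub_le (hChat : Chat.IsPositive)
    (h₁ : 0 < lam₁) (h₂ : 0 < lam₂) (hw : ‖w‖ / lam₁ ≤ 1 / 4) (hK0 : 0 ≤ K)
    (hK : ∀ m h, |⟪fstar m, h m⟫| ≤ K * √⟪h, C h⟫)
    (hmin : hilbertObjective Chat w fstar lam₁ lam₂ fhat
      ≤ hilbertObjective Chat w fstar lam₁ lam₂ fstar)
    {A g θ θ' s : ℝ} (hA : A = 4 * ∑ m, ‖fstar m‖)
    (hg : g = 2 * ‖w‖ * A + lam₁ * ∑ m, ‖fstar m‖ + lam₂ * ∑ m, ‖fstar m‖ ^ 2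
      + ‖Chat - C‖ * A ^ 2)
    (hθ : θ = K * √g) (hθ' : θ' = θ * ∑ m, ‖fstar m‖⁻¹)
    (hs : s = 2 * (‖w‖ / lam₁) * A + Fintype.card ι * θ' + √(Fintype.card ι * A * θ')) :
    ‖fhat - fstar‖ ^ 2 ≤ Fintype.card ι * (s * A + 2 * θ) := by
  set Δ := fhat - fstar with hΔ
  have hb := basic_inequality hmin
  rw [← hΔ] at hb
  have hfhat := norm_minimizer_le hChat h₁ h₂ hw hmin
  have hβ : 0 ≤ ∑ m, ‖fstar m‖ := Finset.sum_nonneg fun _ _ => norm_nonneg _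
  have hA0 : 0 ≤ A := by rw [hA]; positivity
  have hΔA : ‖Δ‖ ≤ A := by
    have h3 := norm_sub_le fhat fstar
    have h5 := norm_le_sum_norm fstar
    rw [hΔ]; linarith
  have hCΔ : ⟪Δ, C Δ⟫ ≤ g := by
    have h1 : ⟪Δ, C Δ⟫ = ⟪Δ, Chat Δ⟫ - ⟪Δ, (Chat - C) Δ⟫ := by
      simp [inner_sub_right]
    have h2 : -⟪Δ, (Chat - C) Δ⟫ ≤ ‖Chat - C‖ * A ^ 2 := by
      have := inner_apply_self_le (-(Chat - C)) Δ
      rw [norm_neg, neg_apply, inner_neg_right] at this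
      refine this.trans ?_
      gcongr
    have h3 : ‖w‖ * ‖Δ‖ ≤ ‖w‖ * A := by gcongr
    have h4 : 0 ≤ ∑ m, ‖fhat m‖ := Finset.sum_nonneg fun _ _ => norm_nonneg _
    have h5 : 0 ≤ ∑ m, ‖fhat m‖ ^ 2 := Finset.sum_nonneg fun _ _ => sq_nonneg _
    simp only [Finset.sum_sub_distrib, mul_sub] at hb
    rw [h1, hg]
    nlinarith [mul_nonneg h₁.le h4, mul_nonneg h₂.le h5]
  have hθ0 : 0 ≤ θ := by rw [hθ]; positivity
  have hinner : ∀ m, -θ ≤ ⟪fstar m, Δ m⟫ := fun m => by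
    refine (abs_le.1 ((hK m Δ).trans ?_)).1
    rw [hθ]
    gcongr
  have hθ'0 : 0 ≤ θ' := by
    rw [hθ']
    exact mul_nonneg hθ0 (Finset.sum_nonneg fun _ _ => by positivity)
  have hΔm : ∀ m, fhat m = fstar m + Δ m := fun m => by simp [hΔ]
  have hcross : ∀ m, ‖fstar m‖ ^ 2 - θ ≤ ⟪fstar m, fhat m⟫ := fun m => by
    rw [hΔm, inner_add_right, real_inner_self_eq_norm_sq]
    linarith [hinner m]
  have hlow : ∀ m, ‖fstar m‖ - θ' ≤ ‖fhat m‖ := fun m => by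
    rcases (norm_nonneg (fstar m)).eq_or_lt with h0 | h0
    · rw [← h0]; linarith [norm_nonneg (fhat m)]
    · have h1 := (hcross m).trans (real_inner_le_norm _ _)
      have h2 : θ * ‖fstar m‖⁻¹ ≤ θ' := by
        rw [hθ']
        gcongr
        exact Finset.single_le_sum (f := fun m => ‖fstar m‖⁻¹)
          (fun _ _ => by positivity) (Finset.mem_univ m)
      have h3 : θ ≤ θ' * ‖fstar m‖ := by
        rwa [← div_eq_mul_inv, div_le_iff₀ h0] at h2
      nlinarith
  have hfm : ∀ m, ‖fhat m‖ + ‖fstar m‖ ≤ A := fun m => by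
    have h1 := norm_apply_le_norm fhat m
    have h2 := Finset.single_le_sum (f := fun m => ‖fstar m‖)
          (fun _ _ => norm_nonneg _) (Finset.mem_univ m)
    rw [hA]; linarith
  -- each summand of the penalty difference is bounded below
  have hterm : ∀ m, -(θ' * (lam₁ + A * lam₂)) ≤
      lam₁ * (‖fhat m‖ - ‖fstar m‖) + lam₂ * (‖fhat m‖ ^ 2 - ‖fstar m‖ ^ 2) := fun m => by
    have h1 := hlow m
    have h2 : -(θ' * A) ≤ ‖fhat m‖ ^ 2 - ‖fstar m‖ ^ 2 := by
      have e : ‖fhat m‖ ^ 2 - ‖fstar m‖ ^ 2 =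
        (‖fhat m‖ - ‖fstar m‖ + θ') * (‖fhat m‖ + ‖fstar m‖) - θ' * (‖fhat m‖ + ‖fstar m‖) := by
        ring
      rw [e]
      have h3 : 0 ≤ (‖fhat m‖ - ‖fstar m‖ + θ') * (‖fhat m‖ + ‖fstar m‖) :=
        mul_nonneg (by linarith) (by positivity)
      have h4 := mul_le_mul_of_nonneg_left (hfm m) hθ'0
      linarith
    nlinarith
  have hup : ∀ m, ‖fhat m‖ - ‖fstar m‖ ≤ s := fun m => by
    by_contra! hlt
    set r := ‖fhat m‖ - ‖fstar m‖ with hr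
    have hM0 : 0 ≤ (Fintype.card ι : ℝ) * A * θ' := by positivity
    have hs1 : √(Fintype.card ι * A * θ') < r := by
      have : 0 ≤ 2 * (‖w‖ / lam₁) * A + Fintype.card ι * θ' := by positivity
      linarith
    have hs2 : 2 * (‖w‖ / lam₁) * A + Fintype.card ι * θ' < r := by
      have : 0 ≤ √(Fintype.card ι * A * θ') := Real.sqrt_nonneg _
      linarith
    have hr0 : 0 < r := (Real.sqrt_nonneg _).trans_lt hs1
    have hsq : Fintype.card ι * A * θ' < r ^ 2 := (Real.sqrt_lt' hr0).1 hs1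
    have hsum : lam₁ * r + lam₂ * (‖fhat m‖ ^ 2 - ‖fstar m‖ ^ 2)
        ≤ 2 * (‖w‖ * A) + Fintype.card ι * (θ' * (lam₁ + A * lam₂)) := by
      have h1 : lam₁ * ∑ m, (‖fhat m‖ - ‖fstar m‖) + lam₂ * ∑ m, (‖fhat m‖ ^ 2 - ‖fstar m‖ ^ 2)
          = ∑ m, (lam₁ * (‖fhat m‖ - ‖fstar m‖) + lam₂ * (‖fhat m‖ ^ 2 - ‖fstar m‖ ^ 2)) := by
        rw [Finset.sum_add_distrib, Finset.mul_sum, Finset.mul_sum]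
      have h2 := Finset.single_le_sum (s := Finset.univ) (f := fun m =>
        lam₁ * (‖fhat m‖ - ‖fstar m‖) + lam₂ * (‖fhat m‖ ^ 2 - ‖fstar m‖ ^ 2)
          + θ' * (lam₁ + A * lam₂)) (fun i _ => by linarith [hterm i]) (Finset.mem_univ m)
      rw [Finset.sum_add_distrib, Finset.sum_const, Finset.card_univ, nsmul_eq_mul] at h2
      have h3 : ‖w‖ * ‖Δ‖ ≤ ‖w‖ * A := by gcongr
      have h4 := hChat.inner_nonneg_right Δ
      have h5 : 0 ≤ θ' * (lam₁ + A * lam₂) := by positivity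
      linarith
    have hr2 : r ^ 2 ≤ ‖fhat m‖ ^ 2 - ‖fstar m‖ ^ 2 := by
      rw [hr] at hr0 ⊢
      nlinarith [norm_nonneg (fstar m)]
    have h6 : lam₁ * (2 * (‖w‖ / lam₁) * A + Fintype.card ι * θ') < lam₁ * r := by gcongr
    have h7 : lam₁ * (2 * (‖w‖ / lam₁) * A + Fintype.card ι * θ')
        = 2 * (‖w‖ * A) + Fintype.card ι * θ' * lam₁ := by field_simp
    nlinarith
  have hsA : 0 ≤ s := by rw [hs]; positivity
  have hm : ∀ m, ‖Δ m‖ ^ 2 ≤ s * A + 2 * θ := fun m => by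
    have h1 : Δ m = fhat m - fstar m := by simp [hΔ]
    rw [h1, norm_sub_sq_real, real_inner_comm]
    have h2 := hcross m
    have h3 : (‖fhat m‖ - ‖fstar m‖) * (‖fhat m‖ + ‖fstar m‖) ≤ s * A :=
      (mul_le_mul_of_nonneg_right (hup m) (by positivity)).trans
        (mul_le_mul_of_nonneg_left (hfm m) hsA)
    nlinarith
  rw [norm_sq_eq_sum]
  refine (Finset.sum_le_sum fun m _ => hm m).trans_eq ?_
  rw [Finset.sum_const, Finset.card_univ, nsmul_eq_mul]

theorem tendsto_zero_of_div {α : Type*} {l : Filter α} {u v : α → ℝ} (hv : ∀ᶠ a in l, 0 < v a)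
    (hv0 : Tendsto v l (𝓝 0)) (h : Tendsto (fun a => u a / v a) l (𝓝 0)) :
    Tendsto u l (𝓝 0) := by
  have := h.mul hv0
  rw [zero_mul] at this
  refine this.congr' ?_
  filter_upwards [hv] with a ha
  exact div_mul_cancel₀ _ ha.ne'

theorem VanishingRegularization.tendsto_minimizer {α : Type*} {l : Filter α}
    {lam₁ lam₂ : α → ℝ} {Chat : α → PiLp 2 H →L[ℝ] PiLp 2 H} {w fhat : α → PiLp 2 H}
    (h : VanishingRegularization l C fstar lam₁ lam₂ Chat w fhat) :
    Tendsto fhat l (𝓝 fstar) := by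
  obtain ⟨K, hK0, hK⟩ := h.source
  have hw0 : Tendsto (fun a => ‖w a‖) l (𝓝 0) := tendsto_zero_of_div h.pos₁ h.tendsto₁ h.noise
  have hC0 : Tendsto (fun a => ‖Chat a - C‖) l (𝓝 0) :=
    tendsto_zero_of_div h.pos₁ h.tendsto₁ h.cov
  set A := 4 * ∑ m, ‖fstar m‖ with hA
  let g : α → ℝ := fun a => 2 * ‖w a‖ * A + lam₁ a * ∑ m, ‖fstar m‖
    + lam₂ a * ∑ m, ‖fstar m‖ ^ 2 + ‖Chat a - C‖ * A ^ 2
  let θ : α → ℝ := fun a => K * √(g a)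
  let θ' : α → ℝ := fun a => θ a * ∑ m, ‖fstar m‖⁻¹
  let s : α → ℝ := fun a => 2 * (‖w a‖ / lam₁ a) * A + Fintype.card ι * θ' a
    + √(Fintype.card ι * A * θ' a)
  have hg : Tendsto g l (𝓝 0) := by
    have := (((hw0.const_mul 2).mul_const A).add (h.tendsto₁.mul_const (∑ m, ‖fstar m‖))).add
      (h.tendsto₂.mul_const (∑ m, ‖fstar m‖ ^ 2)) |>.add (hC0.mul_const (A ^ 2))
    simpa using this
  have hθ : Tendsto θ l (𝓝 0) := by
    simpa using ((Real.continuous_sqrt.tendsto 0).comp hg).const_mul K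
  have hθ' : Tendsto θ' l (𝓝 0) := by simpa using hθ.mul_const (∑ m, ‖fstar m‖⁻¹)
  have hs : Tendsto s l (𝓝 0) := by
    have h1 := ((h.noise.const_mul 2).mul_const A).add (hθ'.const_mul (Fintype.card ι : ℝ))
    have h2 := (Real.continuous_sqrt.tendsto _).comp (hθ'.const_mul (Fintype.card ι * A))
    simpa using h1.add h2
  have hlim : Tendsto (fun a => Fintype.card ι * (s a * A + 2 * θ a)) l (𝓝 0) := by
    simpa using ((hs.mul_const A).add (hθ.const_mul 2)).const_mul (Fintype.card ι : ℝ)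
  have hsq : Tendsto (fun a => ‖fhat a - fstar‖ ^ 2) l (𝓝 0) := by
    refine tendsto_of_tendsto_of_tendsto_of_le_of_le' tendsto_const_nhds hlim
      (.of_forall fun a => by positivity) ?_
    filter_upwards [h.pos₁, h.pos₂, h.isMin, h.noise.eventually_le_const (by norm_num : (0:ℝ) < 1 / 4)]
      with a h1 h2 h3 h4
    exact norm_sq_minimizer_sub_le (h.isPositive_emp a) h1 h2 h4 hK0 hK (h3 _)
      hA rfl rfl rfl rfl
  rw [tendsto_iff_norm_sub_tendsto_zero]
  have := (Real.continuous_sqrt.tendsto 0).comp hsq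
  simpa [Function.comp_def, Real.sqrt_sq (norm_nonneg _)] using this

end Consistency

end MKL

namespace MKL

/-! ### Block ridge equations -/

section Ridge

theorem mul_norm_sq_le_sum {ι : Type*} [Fintype ι] {H : ι → Type*}
    [∀ m, NormedAddCommGroup (H m)] {I : Finset ι} {e : ι → ℝ} {u : PiLp 2 H} {c : ℝ} (hu : ∀ m, m ∉ I → u m = 0) (hc : ∀ m ∈ I, c ≤ e m) :
    c * ‖u‖ ^ 2 ≤ ∑ m, e m * ‖u m‖ ^ 2 := by
  rw [norm_sq_eq_sum, Finset.mul_sum]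
  refine Finset.sum_le_sum fun m _ => ?_
  by_cases hm : m ∈ I
  · exact mul_le_mul_of_nonneg_right (hc m hm) (sq_nonneg _)
  · simp [hu m hm]

variable {ι : Type*} [Fintype ι] {H : ι → Type*}
  [∀ m, NormedAddCommGroup (H m)] [∀ m, InnerProductSpace ℝ (H m)]

/-- `u` is supported on `I` and solves there the ridge equation
`(C u)ₘ + e m • u m = p m`, `m ∈ I`, in weak form. -/
structure IsRidge (C : PiLp 2 H →L[ℝ] PiLp 2 H) (I : Finset ι) (e : ι → ℝ) (p u : PiLp 2 H) :
    Prop where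
  supp : ∀ m, m ∉ I → u m = 0
  eq : ∀ h : PiLp 2 H, (∀ m, m ∉ I → h m = 0) →
    ⟪h, C u⟫ + ∑ m, e m * ⟪h m, u m⟫ = ⟪h, p⟫

variable {C Chat : PiLp 2 H →L[ℝ] PiLp 2 H} {I : Finset ι} {e : ι → ℝ} {p q u v : PiLp 2 H}

theorem IsRidge.add (hu : IsRidge C I e p u) (hv : IsRidge C I e q v) :
    IsRidge C I e (p + q) (u + v) where
  supp m hm := by simp [hu.supp m hm, hv.supp m hm]
  eq h hh := by
    rw [inner_add_right, ← hu.eq h hh, ← hv.eq h hh]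
    simp only [map_add, inner_add_right, PiLp.add_apply, mul_add, Finset.sum_add_distrib]
    ring

theorem IsRidge.smul (hu : IsRidge C I e p u) (t : ℝ) : IsRidge C I e (t • p) (t • u) where
  supp m hm := by simp [hu.supp m hm]
  eq h hh := by
    rw [inner_smul_right, ← hu.eq h hh]
    simp only [map_smul, inner_smul_right, PiLp.smul_apply, mul_add, Finset.mul_sum]
    congr 1
    exact Finset.sum_congr rfl fun m _ => by ring

theorem IsRidge.sub (hu : IsRidge C I e p u) (hv : IsRidge C I e q v) :
    IsRidge C I e (p - q) (u - v) := by
  simpa [sub_eq_add_neg] using hu.add (hv.smul (-1))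

theorem inner_diagOp (c : ι → ℝ) (f g : PiLp 2 H) :
    ⟪f, diagOp c g⟫ = ∑ m, c m * ⟪f m, g m⟫ := by
  simp [PiLp.inner_apply, diagOp_apply, inner_smul_right]

theorem inner_diagOp_left (c : ι → ℝ) (f g : PiLp 2 H) :
    ⟪diagOp c f, g⟫ = ⟪f, diagOp c g⟫ := by
  simp [PiLp.inner_apply, diagOp_apply, inner_smul_right, inner_smul_left]

open Classical in
/-- The coordinate projection of `⊕ₘ H m` onto the components in `I`. -/
noncomputable def blockProj (I : Finset ι) : PiLp 2 H →L[ℝ] PiLp 2 H :=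
  diagOp fun m => if m ∈ I then 1 else 0

theorem blockProj_apply_mem {m : ι} (hm : m ∈ I) : blockProj I u m = u m := by
  simp [blockProj, diagOp_apply, hm]

theorem blockProj_apply_notMem {m : ι} (hm : m ∉ I) : blockProj I u m = 0 := by
  simp [blockProj, diagOp_apply, hm]

theorem blockProj_eq_self (hu : ∀ m, m ∉ I → u m = 0) : blockProj I u = u := by
  ext m
  by_cases hm : m ∈ I
  · exact blockProj_apply_mem hm
  · rw [blockProj_apply_notMem hm, hu m hm]

theorem inner_blockProj_left (u v : PiLp 2 H) : ⟪blockProj I u, v⟫ = ⟪u, blockProj I v⟫ :=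
  inner_diagOp_left _ _ _

theorem isPositive_compress (hC : C.IsPositive) :
    (blockProj I ∘L C ∘L blockProj I).IsPositive := by
  refine (ContinuousLinearMap.isPositive_iff _).2 ⟨fun u v => ?_, fun u => ?_⟩
  · simp only [ContinuousLinearMap.coe_coe, ContinuousLinearMap.comp_apply]
    rw [inner_blockProj_left, hC.inner_left_eq_inner_right, inner_blockProj_left]
  · simp only [ContinuousLinearMap.comp_apply]
    rw [inner_blockProj_left]
    exact hC.inner_nonneg_left _

theorem exists_isRidge [∀ m, CompleteSpace (H m)] (hC : C.IsPositive) {c : ℝ} (hc : 0 < c)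
    (he : ∀ m ∈ I, c ≤ e m) (p : PiLp 2 H) : ∃ u, IsRidge C I e p u := by
  classical
  let e' : ι → ℝ := fun m => if m ∈ I then e m else c
  have he' : ∀ m, c ≤ e' m := fun m => by
    by_cases hm : m ∈ I
    · simpa [e', hm] using he m hm
    · simp [e', hm]
  obtain ⟨u, hu⟩ := exists_apply_eq_of_coercive
    (T := blockProj I ∘L C ∘L blockProj I + diagOp e') hc (fun h => by
      rw [add_apply, inner_add_right, inner_diagOp]
      have h1 := (isPositive_compress (I := I) hC).inner_nonneg_right h
      have h2 := mul_norm_sq_le_sum (I := Finset.univ) (u := h) (c := c) (e := e')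
        (by simp) fun m _ => he' m
      simp only [real_inner_self_eq_norm_sq]
      linarith) (blockProj I p)
  have hsupp : ∀ m, m ∉ I → u m = 0 := fun m hm => by
    have h1 := congrArg (fun f : PiLp 2 H => f m) hu
    simp only [add_apply, PiLp.add_apply, ContinuousLinearMap.comp_apply,
      blockProj_apply_notMem hm, diagOp_apply, zero_add] at h1
    exact (smul_eq_zero.1 h1).resolve_left (by simpa [e', hm] using hc.ne')
  refine ⟨u, hsupp, fun h hh => ?_⟩
  have h1 := congrArg (fun f : PiLp 2 H => ⟪h, f⟫) hu
  simp only [add_apply, ContinuousLinearMap.comp_apply, inner_add_right,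
    ← inner_blockProj_left, blockProj_eq_self hh, blockProj_eq_self hsupp, inner_diagOp] at h1
  rw [← h1]
  congr 1
  refine Finset.sum_congr rfl fun m _ => ?_
  by_cases hm : m ∈ I
  · simp [e', hm]
  · simp [hsupp m hm]

/-- The energy estimate behind all bounds for ridge equations. -/
theorem energy_estimate (hC : C.IsPositive) {c β γ : ℝ} (hc : 0 < c) (he : ∀ m ∈ I, c ≤ e m)
    (hβ : 0 ≤ β) (hγ : 0 ≤ γ) (hu : ∀ m, m ∉ I → u m = 0)
    (h : ⟪u, C u⟫ + ∑ m, e m * ‖u m‖ ^ 2 ≤ β * √⟪u, C u⟫ + γ * ‖u‖) :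
    √⟪u, C u⟫ ≤ β + γ / √c ∧ √c * ‖u‖ ≤ β + γ / √c := by
  set Q := ⟪u, C u⟫ + ∑ m, e m * ‖u m‖ ^ 2 with hQ
  have h0 := hC.inner_nonneg_right u
  have h1 := mul_norm_sq_le_sum hu he
  have hsc : 0 < √c := Real.sqrt_pos.2 hc
  have hQ0 : 0 ≤ Q := add_nonneg h0 ((mul_nonneg hc.le (sq_nonneg _)).trans h1)
  have h2 : √⟪u, C u⟫ ≤ √Q := Real.sqrt_le_sqrt
    (le_add_of_nonneg_right ((mul_nonneg hc.le (sq_nonneg _)).trans h1))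
  have h3 : √c * ‖u‖ ≤ √Q := by
    refine Real.le_sqrt_of_sq_le ?_
    rw [mul_pow, Real.sq_sqrt hc.le]
    linarith
  have h4 : √Q ≤ β + γ / √c := by
    rcases (Real.sqrt_nonneg Q).eq_or_lt with h5 | h5
    · rw [← h5]; positivity
    · have h6 : √Q * √Q ≤ (β + γ / √c) * √Q := by
        rw [Real.mul_self_sqrt hQ0]
        refine h.trans ?_
        rw [add_mul]
        refine add_le_add (mul_le_mul_of_nonneg_left h2 hβ) ?_
        rw [div_mul_eq_mul_div, le_div_iff₀ hsc]
        calc γ * ‖u‖ * √c = γ * (√c * ‖u‖) := by ring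
          _ ≤ γ * √Q := mul_le_mul_of_nonneg_left h3 hγ
      exact le_of_mul_le_mul_right h6 h5
  exact ⟨h2.trans h4, h3.trans h4⟩

theorem IsRidge.energy_eq (hu : IsRidge C I e p u) :
    ⟪u, C u⟫ + ∑ m, e m * ‖u m‖ ^ 2 = ⟪u, p⟫ := by
  simpa only [real_inner_self_eq_norm_sq] using hu.eq u hu.supp

theorem sqrt_inner_apply_self_le (C : PiLp 2 H →L[ℝ] PiLp 2 H) (f : PiLp 2 H) :
    √⟪f, C f⟫ ≤ √‖C‖ * ‖f‖ := by
  refine (Real.sqrt_le_sqrt (inner_apply_self_le C f)).trans_eq ?_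
  rw [Real.sqrt_mul (norm_nonneg _), Real.sqrt_sq (norm_nonneg _)]

/-- The ridge projection of `f` onto the blocks in `I` is bounded by `‖f‖ / √c`. -/
theorem IsRidge.sqrt_mul_norm_le (hC : C.IsPositive) {c : ℝ} (hc : 0 < c)
    (he : ∀ m ∈ I, c ≤ e m) {f : PiLp 2 H} (hu : IsRidge C I e (C f) u) :
    √c * ‖u‖ ≤ √‖C‖ * ‖f‖ := by
  have := (energy_estimate hC hc he (β := √⟪f, C f⟫) (γ := 0) (Real.sqrt_nonneg _) le_rfl
    hu.supp (by
      rw [hu.energy_eq, zero_mul, add_zero, mul_comm]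
      exact (le_abs_self _).trans (abs_inner_le_sqrt_mul_sqrt hC _ _))).2
  simp only [zero_div, add_zero] at this
  exact this.trans (sqrt_inner_apply_self_le C f)

/-- The ridge solution with right-hand side `(a m • fstar m)ₘ` is close to `∑ₘ a m • v m` when
`v m` represents approximately the functional `h ↦ ⟪fstar m, h m⟫` in the form of `C`. -/
theorem IsRidge.approx (hC : C.IsPositive) {c c' ā η : ℝ} (hc : 0 < c) (hη : 0 ≤ η)
    (he : ∀ m ∈ I, c ≤ e m) (he' : ∀ m ∈ I, e m ≤ c') (hc' : 0 ≤ c') {a : ι → ℝ}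
    (ha : ∀ m, |a m| ≤ ā) (hā : 0 ≤ ā) {fstar : PiLp 2 H} {v : ι → PiLp 2 H}
    (hvs : ∀ k m, m ∉ I → v k m = 0)
    (hv : ∀ m h, (∀ k, k ∉ I → h k = 0) →
      |⟪fstar m, h m⟫ - ⟪v m, C h⟫| ≤ η * √⟪h, C h⟫)
    (hu : IsRidge C I e (diagOp a fstar) u) :
    √⟪u - ∑ m, a m • v m, C (u - ∑ m, a m • v m)⟫
        ≤ ā * (Fintype.card ι * η + c' / √c * ∑ m, ‖v m‖) ∧
      √c * ‖u - ∑ m, a m • v m‖ ≤ ā * (Fintype.card ι * η + c' / √c * ∑ m, ‖v m‖) := by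
  set y := ∑ m, a m • v m with hy
  have hys : ∀ m, m ∉ I → y m = 0 := fun m hm => by
    simp [hy, hvs _ m hm]
  set d := u - y with hd
  have hds : ∀ m, m ∉ I → d m = 0 := fun m hm => by simp [hd, hu.supp m hm, hys m hm]
  have hyn : ‖y‖ ≤ ā * ∑ m, ‖v m‖ := by
    refine (norm_sum_le _ _).trans ?_
    rw [Finset.mul_sum]
    refine Finset.sum_le_sum fun m _ => ?_
    rw [norm_smul, Real.norm_eq_abs]
    exact mul_le_mul_of_nonneg_right (ha m) (norm_nonneg _)
  have h1 : ⟪d, C d⟫ + ∑ m, e m * ‖d m‖ ^ 2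
      = ∑ m, a m * (⟪fstar m, d m⟫ - ⟪v m, C d⟫) - ∑ m, e m * ⟪d m, y m⟫ := by
    have h2 := hu.eq d hds
    have hu' : u = d + y := by simp [hd]
    have h3 : ⟪d, C y⟫ = ∑ m, a m * ⟪v m, C d⟫ := by
      rw [← hC.inner_left_eq_inner_right, real_inner_comm, hy, sum_inner]
      simp [inner_smul_left]
    conv_lhs at h2 => rw [hu']
    rw [inner_diagOp, map_add, inner_add_right, h3] at h2
    simp only [PiLp.add_apply, inner_add_right, mul_add, Finset.sum_add_distrib,
      real_inner_self_eq_norm_sq] at h2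
    simp only [mul_sub, Finset.sum_sub_distrib, real_inner_comm (d _) (fstar _)] at h2 ⊢
    linarith
  have h4 : ∑ m, a m * (⟪fstar m, d m⟫ - ⟪v m, C d⟫)
      ≤ (ā * (Fintype.card ι * η)) * √⟪d, C d⟫ := by
    calc ∑ m, a m * (⟪fstar m, d m⟫ - ⟪v m, C d⟫)
        ≤ ∑ _m : ι, ā * (η * √⟪d, C d⟫) := Finset.sum_le_sum fun m _ => by
          refine (le_abs_self _).trans ?_
          rw [abs_mul]
          exact mul_le_mul (ha m) (hv m d hds) (abs_nonneg _) hā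
      _ = _ := by rw [Finset.sum_const, Finset.card_univ, nsmul_eq_mul]; ring
  have h5 : -∑ m, e m * ⟪d m, y m⟫ ≤ (c' * (ā * ∑ m, ‖v m‖)) * ‖d‖ := by
    have h6 : -∑ m, e m * ⟪d m, y m⟫ ≤ ∑ m, c' * (‖d m‖ * ‖y m‖) := by
      rw [← Finset.sum_neg_distrib]
      refine Finset.sum_le_sum fun m _ => ?_
      by_cases hm : m ∈ I
      · have h7 := (abs_le.1 (abs_real_inner_le_norm (d m) (y m))).1
        have h8 := he m hm
        have h9 := mul_nonneg (norm_nonneg (d m)) (norm_nonneg (y m))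
        nlinarith [he' m hm]
      · simp [hds m hm]
    have h10 : ∑ m, ‖d m‖ * ‖y m‖ ≤ ‖d‖ * ‖y‖ := by
      have := Finset.sum_mul_sq_le_sq_mul_sq Finset.univ (fun m => ‖d m‖) (fun m => ‖y m‖)
      rw [← norm_sq_eq_sum, ← norm_sq_eq_sum, ← mul_pow] at this
      exact le_of_sq_le_sq this (by positivity)
    rw [← Finset.mul_sum] at h6
    calc _ ≤ c' * (‖d‖ * ‖y‖) := h6.trans (mul_le_mul_of_nonneg_left h10 hc')
      _ ≤ c' * (‖d‖ * (ā * ∑ m, ‖v m‖)) := by gcongr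
      _ = _ := by ring
  have hV : 0 ≤ ∑ m, ‖v m‖ := Finset.sum_nonneg fun _ _ => norm_nonneg _
  have := energy_estimate hC hc he (β := ā * (Fintype.card ι * η))
    (γ := c' * (ā * ∑ m, ‖v m‖)) (by positivity) (by positivity) hds (by linarith)
  have h11 : ā * (Fintype.card ι * η) + c' * (ā * ∑ m, ‖v m‖) / √c
      = ā * (Fintype.card ι * η + c' / √c * ∑ m, ‖v m‖) := by ring
  rwa [h11] at this

end Ridge

/-! ### Optimality conditions and the support of the minimizer -/

section Support

variable {ι : Type*} [Fintype ι] {H : ι → Type*}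
  [∀ m, NormedAddCommGroup (H m)] [∀ m, InnerProductSpace ℝ (H m)]
  {C Chat : PiLp 2 H →L[ℝ] PiLp 2 H} {w fstar fhat : PiLp 2 H} {lam₁ lam₂ : ℝ}

/-- The stationarity condition of a minimizer `fhat`, in directions supported where `fhat` does
not vanish. There the norm is majorized by `‖f + h‖ ≤ (‖f + h‖² + ‖f‖²) / (2 ‖f‖)`, so that the
objective lies below a quadratic polynomial touching it at `fhat`. -/
theorem stationarity (hChat : Chat.IsPositive) (h₁ : 0 < lam₁)
    (hmin : ∀ g, hilbertObjective Chat w fstar lam₁ lam₂ fhat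
      ≤ hilbertObjective Chat w fstar lam₁ lam₂ g)
    {h : PiLp 2 H} (hh : ∀ m, fhat m = 0 → h m = 0) :
    ⟪h, Chat (fhat - fstar)⟫ - ⟪w, h⟫
      + ∑ m, (lam₁ * (2 * ‖fhat m‖)⁻¹ + lam₂) * ⟪fhat m, h m⟫ = 0 := by
  set b := ⟪h, Chat (fhat - fstar)⟫ - ⟪w, h⟫
      + ∑ m, (lam₁ * (2 * ‖fhat m‖)⁻¹ + lam₂) * ⟪fhat m, h m⟫ with hb
  have key : ∀ s : ℝ, 0 ≤ 0 + 2 * s * b + s ^ 2 * (⟪h, Chat h⟫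
      + ∑ m, (lam₁ * (2 * ‖fhat m‖)⁻¹ + lam₂) * ‖h m‖ ^ 2) := by
    intro s
    have h1 := hmin (fhat + s • h)
    have hsym : ⟪fhat - fstar, Chat h⟫ = ⟪h, Chat (fhat - fstar)⟫ := by
      rw [← hChat.inner_left_eq_inner_right, real_inner_comm]
    have h2 : ∀ m, ‖fhat m + s • h m‖ ^ 2
        = ‖fhat m‖ ^ 2 + (2 * s * ⟪fhat m, h m⟫ + s ^ 2 * ‖h m‖ ^ 2) := fun m => by
      rw [norm_add_sq_real, inner_smul_right, norm_smul, mul_pow, Real.norm_eq_abs, sq_abs]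
      ring
    have h3 : ∀ m, ‖fhat m + s • h m‖ ≤ ‖fhat m‖
        + (2 * ‖fhat m‖)⁻¹ * (2 * s * ⟪fhat m, h m⟫ + s ^ 2 * ‖h m‖ ^ 2) := fun m => by
      rcases eq_or_ne (fhat m) 0 with h0 | h0
      · simp [h0, hh m h0]
      · have hpos : 0 < ‖fhat m‖ := norm_pos_iff.2 h0
        rw [← sub_le_iff_le_add', inv_mul_eq_div, le_div_iff₀ (by positivity),
          ← sub_eq_iff_eq_add'.2 (h2 m)]
        nlinarith [sq_nonneg (‖fhat m + s • h m‖ - ‖fhat m‖)]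
    have h4 := mul_le_mul_of_nonneg_left (Finset.sum_le_sum fun m (_ : m ∈ Finset.univ) => h3 m)
      h₁.le
    have e : fhat + s • h - fstar = (fhat - fstar) + s • h := by abel
    simp only [hilbertObjective, e, PiLp.add_apply, PiLp.smul_apply, h2, map_add, map_smul,
      inner_add_left, inner_add_right, inner_smul_left, inner_smul_right, hsym,
      conj_trivial] at h1
    have h5 : ∑ m, (lam₁ * (2 * ‖fhat m‖)⁻¹ + lam₂) *
          (2 * s * ⟪fhat m, h m⟫ + s ^ 2 * ‖h m‖ ^ 2)
        = 2 * s * ∑ m, (lam₁ * (2 * ‖fhat m‖)⁻¹ + lam₂) * ⟪fhat m, h m⟫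
          + s ^ 2 * ∑ m, (lam₁ * (2 * ‖fhat m‖)⁻¹ + lam₂) * ‖h m‖ ^ 2 := by
      rw [Finset.mul_sum, Finset.mul_sum, ← Finset.sum_add_distrib]
      exact Finset.sum_congr rfl fun m _ => by ring
    have h6 : ∑ m, (lam₁ * (2 * ‖fhat m‖)⁻¹ + lam₂) *
          (2 * s * ⟪fhat m, h m⟫ + s ^ 2 * ‖h m‖ ^ 2)
        = lam₁ * ∑ m, (2 * ‖fhat m‖)⁻¹ * (2 * s * ⟪fhat m, h m⟫ + s ^ 2 * ‖h m‖ ^ 2)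
          + lam₂ * ∑ m, (2 * s * ⟪fhat m, h m⟫ + s ^ 2 * ‖h m‖ ^ 2) := by
      rw [Finset.mul_sum, Finset.mul_sum, ← Finset.sum_add_distrib]
      exact Finset.sum_congr rfl fun m _ => by ring
    rw [Finset.sum_add_distrib] at h1 h4
    rw [hb]
    rw [h5] at h6
    nlinarith
  have := sq_le_mul_of_quadratic_nonneg key
  rw [zero_mul] at this
  exact pow_eq_zero_iff two_ne_zero |>.1 (le_antisymm this (sq_nonneg _))

/-- The part `f` of the minimizer outside `I`, tested against the residual of its empirical ridge
projection `u` onto the blocks in `I`. The components of the minimizer in `I` drop out, and the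
empirical quadratic form contributes with a favourable sign. -/
theorem outside_norm_le {I : Finset ι} (hChat : Chat.IsPositive) (h₁ : 0 < lam₁) (h₂ : 0 < lam₂)
    (hmin : ∀ g, hilbertObjective Chat w fstar lam₁ lam₂ fhat
      ≤ hilbertObjective Chat w fstar lam₁ lam₂ g)
    (hI : ∀ m ∈ I, fhat m ≠ 0) (hstar : ∀ m, m ∉ I → fstar m = 0)
    {f u : PiLp 2 H} (hf : f = fhat - blockProj I fhat)
    (hu : IsRidge Chat I (fun m => lam₁ * (2 * ‖fhat m‖)⁻¹ + lam₂) (Chat f) u) :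
    lam₁ / 2 * ∑ m, ‖f m‖
      ≤ ∑ m, (lam₁ * (2 * ‖fhat m‖)⁻¹ + lam₂) * ⟪u m, fstar m⟫ + ⟪w, f - u⟫ := by
  set e : ι → ℝ := fun m => lam₁ * (2 * ‖fhat m‖)⁻¹ + lam₂ with he
  have hfI : ∀ m ∈ I, f m = 0 := fun m hm => by simp [hf, blockProj_apply_mem hm]
  have hfJ : ∀ m, m ∉ I → f m = fhat m := fun m hm => by simp [hf, blockProj_apply_notMem hm]
  set y := blockProj I (fhat - fstar) with hy
  have hys : ∀ m, m ∉ I → y m = 0 := fun m hm => blockProj_apply_notMem hm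
  have hΔ : fhat - fstar = y + f := by
    rw [hy, hf, map_sub, blockProj_eq_self hstar]; abel
  have k1 := stationarity hChat h₁ hmin (h := u) fun m hm =>
    hu.supp m fun hmI => hI m hmI hm
  have k2 := stationarity hChat h₁ hmin (h := f) fun m hm => by
    by_cases hmI : m ∈ I
    · exact hfI m hmI
    · rw [hfJ m hmI, hm]
  have k3 := hu.eq y hys
  have k4 := hu.energy_eq
  have e1 : ⟪f, Chat y⟫ = ⟪y, Chat f⟫ := by
    rw [← hChat.inner_left_eq_inner_right, real_inner_comm]
  have e2 : ⟪u, Chat y⟫ = ⟪y, Chat u⟫ := by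
    rw [← hChat.inner_left_eq_inner_right, real_inner_comm]
  have e3 : ⟪u, Chat f⟫ = ⟪f, Chat u⟫ := by
    rw [← hChat.inner_left_eq_inner_right, real_inner_comm]
  have k5 := hChat.inner_nonneg_right (f - u)
  simp only [map_sub, inner_sub_left, inner_sub_right] at k5
  rw [hΔ, map_add, inner_add_right] at k1 k2
  have s1 : ∑ m, e m * ⟪fhat m, u m⟫ = ∑ m, e m * ⟪y m, u m⟫ + ∑ m, e m * ⟪u m, fstar m⟫ := by
    rw [← Finset.sum_add_distrib]
    refine Finset.sum_congr rfl fun m _ => ?_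
    by_cases hm : m ∈ I
    · have : fhat m = y m + fstar m := by simp [hy, blockProj_apply_mem hm]
      rw [this, inner_add_left, real_inner_comm (u m) (fstar m)]
      ring
    · simp [hu.supp m hm]
  have s2 : lam₁ / 2 * ∑ m, ‖f m‖ ≤ ∑ m, e m * ⟪fhat m, f m⟫ := by
    rw [Finset.mul_sum]
    refine Finset.sum_le_sum fun m _ => ?_
    by_cases hm : m ∈ I
    · simp [hfI m hm]
    · rw [hfJ m hm, real_inner_self_eq_norm_sq]
      rcases eq_or_ne (‖fhat m‖) 0 with h0 | h0
      · simp [h0]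
      · have : e m * ‖fhat m‖ ^ 2 = lam₁ / 2 * ‖fhat m‖ + lam₂ * ‖fhat m‖ ^ 2 := by
          simp only [he]; field_simp
        rw [this]
        exact le_add_of_nonneg_right (by positivity)
  have s3 : 0 ≤ ∑ m, e m * ‖u m‖ ^ 2 := Finset.sum_nonneg fun m _ => by
    simp only [he]; positivity
  rw [inner_sub_right]
  rw [s1] at k1
  linarith

end Support

end MKL

namespace MKL

/-! ### Support recovery -/

section Recovery

variable {ι : Type*} [Fintype ι] {H : ι → Type*}
  [∀ m, NormedAddCommGroup (H m)] [∀ m, InnerProductSpace ℝ (H m)]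
  {C Chat : PiLp 2 H →L[ℝ] PiLp 2 H} {I : Finset ι} {fstar : PiLp 2 H}

theorem IsRidge.congr {e e' : ι → ℝ} {p u : PiLp 2 H} (hu : IsRidge C I e p u)
    (he : ∀ m ∈ I, e m = e' m) : IsRidge C I e' p u where
  supp := hu.supp
  eq h hh := by
    rw [← hu.eq h hh]
    congr 1
    refine Finset.sum_congr rfl fun m _ => ?_
    by_cases hm : m ∈ I
    · rw [he m hm]
    · simp [hh m hm]

theorem exists_block_approx (hC : C.IsPositive) {K : ℝ}
    (hK : ∀ m h, |⟪fstar m, h m⟫| ≤ K * √⟪h, C h⟫) (I : Finset ι) {η : ℝ} (hη : 0 < η) :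
    ∃ v : ι → PiLp 2 H, (∀ k m, m ∉ I → v k m = 0) ∧
      ∀ m h, (∀ k, k ∉ I → h k = 0) → |⟪fstar m, h m⟫ - ⟪v m, C h⟫| ≤ η * √⟪h, C h⟫ := by
  classical
  have hform : ∀ h : PiLp 2 H, ⟪h, (blockProj I ∘L C ∘L blockProj I) h⟫
      = ⟪blockProj I h, C (blockProj I h)⟫ := fun h => by
    rw [ContinuousLinearMap.comp_apply, ContinuousLinearMap.comp_apply, ← inner_blockProj_left]
  have h1 : ∀ m, ∃ v : PiLp 2 H, (∀ k, k ∉ I → v k = 0) ∧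
      ∀ h, (∀ k, k ∉ I → h k = 0) → |⟪fstar m, h m⟫ - ⟪v, C h⟫| ≤ η * √⟪h, C h⟫ := by
    intro m
    have hp : ∀ h : PiLp 2 H, ⟪blockProj I (PiLp.single 2 m (fstar m)), h⟫
        = ⟪fstar m, blockProj I h m⟫ := fun h => by
      rw [inner_blockProj_left, PiLp.inner_apply]
      rw [Finset.sum_eq_single m (fun k _ hk => by simp [hk]) (by simp)]
      simp
    obtain ⟨v, hv⟩ := exists_approx_of_bounded (isPositive_compress (I := I) hC)
      (p := blockProj I (PiLp.single 2 m (fstar m))) (K := K)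
      (fun h => by rw [hp, hform]; exact hK m _) hη
    refine ⟨blockProj I v, fun k hk => blockProj_apply_notMem hk, fun h hh => ?_⟩
    have := hv h
    rw [hp, hform, ContinuousLinearMap.comp_apply, ContinuousLinearMap.comp_apply,
      ← inner_blockProj_left, blockProj_eq_self hh] at this
    exact this
  choose v hv1 hv2 using h1
  exact ⟨v, hv1, hv2⟩

/-- The population gradients of two ridge problems agree to the order of `lam₁`: the penalty
weights `α m + lam₂` are fitted to the minimizer, whereas the irrepresentable condition is stated
with `lam₂` alone. Both solutions are split along their right-hand side. The parts of size `lam₁`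
are close to the same combination of the approximants `v m`; the parts of size `lam₂` differ by a
ridge solution whose right-hand side is `α` applied to the small element `xc`. -/
theorem abs_inner_ridge_sub_le [∀ m, CompleteSpace (H m)] (hC : C.IsPositive)
    {lam₁ lam₂ c₀ c₂ η δ : ℝ}
    (h₁ : 0 < lam₁) (h₂ : 0 < lam₂) (hc₀ : 0 < c₀) (hη : 0 ≤ η)
    {α β : ι → ℝ} (hα : ∀ m, 0 ≤ α m) (hα' : ∀ m, α m ≤ c₂ * lam₁) (hβ : ∀ m, 0 ≤ β m)
    (hβ' : ∀ m, β m ≤ c₂ * lam₁) (hαβ : ∀ m, |α m - β m| ≤ δ * lam₁)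
    (he : ∀ m ∈ I, c₀ * (lam₁ + lam₂) ≤ α m + lam₂)
    {v : ι → PiLp 2 H} (hvs : ∀ k m, m ∉ I → v k m = 0)
    (hv : ∀ m h, (∀ k, k ∉ I → h k = 0) → |⟪fstar m, h m⟫ - ⟪v m, C h⟫| ≤ η * √⟪h, C h⟫)
    {x z : PiLp 2 H}
    (hx : IsRidge C I (fun _ => lam₂) (diagOp (fun m => β m + lam₂) fstar) x)
    (hz : IsRidge C I (fun m => α m + lam₂) (diagOp (fun m => α m + lam₂) fstar) z)
    (hc₂ : 0 ≤ c₂) (f : PiLp 2 H) :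
    |⟪f, C z⟫ - ⟪f, C x⟫| ≤ lam₁ * ‖f‖ * (√‖C‖ *
      (c₂ * (Fintype.card ι * η + (c₂ + 1) / √c₀ * √(lam₁ + lam₂) * ∑ m, ‖v m‖)
        + c₂ * (Fintype.card ι * η + √lam₂ * ∑ m, ‖v m‖)
        + c₂ / √c₀ * (Fintype.card ι * η + 2 * √lam₂ * ∑ m, ‖v m‖))
      + ‖C‖ * δ * ∑ m, ‖v m‖) := by
  set L := lam₁ + lam₂ with hL
  have hL0 : 0 < L := by positivity
  set M : ℝ := (Fintype.card ι : ℝ) with hM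
  have hM0 : 0 ≤ M := by positivity
  set S := ∑ m, ‖v m‖ with hS
  have hS0 : 0 ≤ S := Finset.sum_nonneg fun _ _ => norm_nonneg _
  have hcL : 0 < c₀ * L := by positivity
  have hsc : 0 < √c₀ := Real.sqrt_pos.2 hc₀
  have hsl : 0 < √lam₂ := Real.sqrt_pos.2 h₂
  have hsplit : ∀ a : ι → ℝ, (diagOp (fun m => a m + lam₂) fstar : PiLp 2 H)
      = diagOp a fstar + diagOp (fun _ => lam₂) fstar := fun a => by
    ext m; simp [diagOp_apply, add_smul]
  obtain ⟨zc, hzc⟩ := exists_isRidge hC hcL he (diagOp (fun _ => lam₂) fstar)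
  obtain ⟨xc, hxc⟩ := exists_isRidge (e := fun _ => lam₂) hC h₂ (I := I) (fun _ _ => le_rfl)
    (diagOp (fun _ => lam₂) fstar)
  have hz1 : IsRidge C I (fun m => α m + lam₂) (diagOp α fstar) (z - zc) := by
    have := hz.sub hzc
    rwa [hsplit, add_sub_cancel_right] at this
  have hx1 : IsRidge C I (fun _ => lam₂) (diagOp β fstar) (x - xc) := by
    have := hx.sub hxc
    rwa [hsplit, add_sub_cancel_right] at this
  have he' : ∀ m ∈ I, α m + lam₂ ≤ (c₂ + 1) * L := fun m _ => by
    have := hα' m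
    rw [hL]; nlinarith
  have hα1 : ∀ m, |α m| ≤ c₂ * lam₁ := fun m => by rw [abs_of_nonneg (hα m)]; exact hα' m
  have hβ1 : ∀ m, |β m| ≤ c₂ * lam₁ := fun m => by rw [abs_of_nonneg (hβ m)]; exact hβ' m
  -- the two parts of size `lam₁`
  have b1 := (hz1.approx hC hcL hη he he' (by positivity) hα1 (by positivity) hvs hv).1
  have b2 := (hx1.approx hC h₂ hη (fun _ _ => le_rfl) (fun _ _ => le_rfl) h₂.le hβ1
    (by positivity) hvs hv).1
  have b3 := (hxc.approx hC h₂ hη (fun _ _ => le_rfl) (fun _ _ => le_rfl) h₂.le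
    (a := fun _ => lam₂) (fun _ => (abs_of_pos h₂).le) h₂.le hvs hv).2
  rw [Real.div_sqrt] at b2 b3
  have e1 : (c₂ + 1) * L / √(c₀ * L) = (c₂ + 1) / √c₀ * √L := by
    rw [Real.sqrt_mul hc₀.le]
    have : √L ≠ 0 := (Real.sqrt_pos.2 hL0).ne'
    field_simp
    rw [Real.sq_sqrt hL0.le]
  rw [e1] at b1
  -- `xc` is of smaller order than `√lam₂`
  have hxcn : ‖xc‖ ≤ √lam₂ * (M * η + 2 * √lam₂ * S) := by
    set y := ∑ m, lam₂ • v m with hy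
    have h1 : ‖y‖ ≤ lam₂ * S := by
      refine (norm_sum_le _ _).trans_eq ?_
      rw [hS, Finset.mul_sum]
      exact Finset.sum_congr rfl fun m _ => by rw [norm_smul, Real.norm_of_nonneg h₂.le]
    have h2 : ‖xc‖ ≤ ‖xc - y‖ + ‖y‖ := by simpa using norm_add_le (xc - y) y
    have h3 : ‖xc - y‖ ≤ √lam₂ * (M * η + √lam₂ * S) := by
      refine le_of_mul_le_mul_left ?_ hsl
      calc √lam₂ * ‖xc - y‖ ≤ lam₂ * (M * η + √lam₂ * S) := b3
        _ = √lam₂ * (√lam₂ * (M * η + √lam₂ * S)) := by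
          rw [← mul_assoc, Real.mul_self_sqrt h₂.le]
    have h4 : √lam₂ * √lam₂ = lam₂ := Real.mul_self_sqrt h₂.le
    calc ‖xc‖ ≤ √lam₂ * (M * η + √lam₂ * S) + lam₂ * S := by linarith
      _ = √lam₂ * (M * η + 2 * √lam₂ * S) := by rw [← h4]; ring_nf; rw [Real.sqrt_sq hsl.le]; ring
  -- the two parts of size `lam₂`
  have b4 : √⟪zc - xc, C (zc - xc)⟫ ≤ lam₁ * (c₂ / √c₀ * (M * η + 2 * √lam₂ * S)) := by
    set d := zc - xc with hd
    have hds : ∀ m, m ∉ I → d m = 0 := fun m hm => by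
      simp [hd, hzc.supp m hm, hxc.supp m hm]
    have h1 : ⟪d, C d⟫ + ∑ m, (α m + lam₂) * ‖d m‖ ^ 2 = -∑ m, α m * ⟪d m, xc m⟫ := by
      have h2 := hzc.eq d hds
      have h3 := hxc.eq d hds
      have h4 : zc = d + xc := by simp [hd]
      conv_lhs at h2 => rw [h4]
      simp only [map_add, inner_add_right, PiLp.add_apply, mul_add, add_mul,
        Finset.sum_add_distrib, real_inner_self_eq_norm_sq] at h2 ⊢
      linarith
    have h5 : -∑ m, α m * ⟪d m, xc m⟫ ≤ c₂ * lam₁ * ‖xc‖ * ‖d‖ := by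
      have h6 : -∑ m, α m * ⟪d m, xc m⟫ ≤ ∑ m, c₂ * lam₁ * (‖d m‖ * ‖xc m‖) := by
        rw [← Finset.sum_neg_distrib]
        refine Finset.sum_le_sum fun m _ => ?_
        have h7 := (abs_le.1 (abs_real_inner_le_norm (d m) (xc m))).1
        have h9 := mul_nonneg (norm_nonneg (d m)) (norm_nonneg (xc m))
        nlinarith [hα' m, hα m]
      have h10 : ∑ m, ‖d m‖ * ‖xc m‖ ≤ ‖d‖ * ‖xc‖ := by
        have := Finset.sum_mul_sq_le_sq_mul_sq Finset.univ (fun m => ‖d m‖) (fun m => ‖xc m‖)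
        rw [← norm_sq_eq_sum, ← norm_sq_eq_sum, ← mul_pow] at this
        exact le_of_sq_le_sq this (by positivity)
      rw [← Finset.mul_sum] at h6
      calc _ ≤ c₂ * lam₁ * (‖d‖ * ‖xc‖) := h6.trans (by gcongr)
        _ = _ := by ring
    have h11 := (energy_estimate hC hcL he (β := 0) (γ := c₂ * lam₁ * ‖xc‖) le_rfl
      (by positivity) hds (by rw [h1]; linarith)).1
    refine h11.trans ?_
    have h12 : √lam₂ ≤ √L := Real.sqrt_le_sqrt (by rw [hL]; linarith)
    have hsL : 0 < √L := Real.sqrt_pos.2 hL0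
    rw [zero_add, Real.sqrt_mul hc₀.le, div_le_iff₀ (by positivity)]
    calc c₂ * lam₁ * ‖xc‖ ≤ c₂ * lam₁ * (√lam₂ * (M * η + 2 * √lam₂ * S)) := by gcongr
      _ ≤ c₂ * lam₁ * (√L * (M * η + 2 * √lam₂ * S)) := by gcongr
      _ = _ := by field_simp
  have b5 : ‖∑ m, (α m - β m) • v m‖ ≤ δ * lam₁ * S := by
    refine (norm_sum_le _ _).trans ?_
    rw [hS, Finset.mul_sum]
    refine Finset.sum_le_sum fun m _ => ?_
    rw [norm_smul, Real.norm_eq_abs]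
    exact mul_le_mul_of_nonneg_right (hαβ m) (norm_nonneg _)
  have hdec : C z - C x = C ((z - zc) - ∑ m, α m • v m) - C ((x - xc) - ∑ m, β m • v m)
      + C (zc - xc) + C (∑ m, (α m - β m) • v m) := by
    rw [← map_sub, ← map_sub, ← map_add, ← map_add]
    congr 1
    simp only [sub_smul, Finset.sum_sub_distrib]
    abel
  have hcs : ∀ y, |⟪f, C y⟫| ≤ √‖C‖ * ‖f‖ * √⟪y, C y⟫ := fun y =>
    (abs_inner_le_sqrt_mul_sqrt hC f y).trans
      (mul_le_mul_of_nonneg_right (sqrt_inner_apply_self_le C f) (Real.sqrt_nonneg _))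
  have hcs' : ∀ y, |⟪f, C y⟫| ≤ ‖f‖ * (‖C‖ * ‖y‖) := fun y =>
    (abs_real_inner_le_norm _ _).trans
      (mul_le_mul_of_nonneg_left (C.le_opNorm y) (norm_nonneg _))
  rw [← inner_sub_right, hdec]
  simp only [inner_add_right, inner_sub_right]
  have hrC : 0 ≤ √‖C‖ * ‖f‖ := by positivity
  have t1 := (hcs _).trans (mul_le_mul_of_nonneg_left b1 hrC)
  have t2 := (hcs _).trans (mul_le_mul_of_nonneg_left b2 hrC)
  have t3 := (hcs _).trans (mul_le_mul_of_nonneg_left b4 hrC)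
  have t4 : |⟪f, C (∑ m, (α m - β m) • v m)⟫| ≤ ‖f‖ * (‖C‖ * (δ * lam₁ * S)) :=
    (hcs' _).trans (by gcongr)
  rw [abs_le] at t1 t2 t3 t4 ⊢
  constructor <;> linarith [t1.1, t2.1, t3.1, t4.1, t1.2, t2.2, t3.2, t4.2]

/-- Exchanging the empirical for the population covariance in the bias term of the empirical ridge
projection `u` of `f`, by testing the two ridge equations against each other. -/
theorem sum_mul_inner_ridge (hC : C.IsPositive) {e : ι → ℝ}
    {f u z : PiLp 2 H} (hu : IsRidge Chat I e (Chat f) u)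
    (hz : IsRidge C I e (diagOp e fstar) z) :
    ∑ m, e m * ⟪u m, fstar m⟫ = ⟪f, C z⟫ + ⟪z, (Chat - C) (f - u)⟫ := by
  have h1 := hu.eq z hz.supp
  have h2 := hz.eq u hu.supp
  rw [inner_diagOp] at h2
  rw [← h2]
  have h3 : ⟪f, C z⟫ = ⟪z, C f⟫ := by rw [← hC.inner_left_eq_inner_right, real_inner_comm]
  have h4 : ⟪u, C z⟫ = ⟪z, C u⟫ := by rw [← hC.inner_left_eq_inner_right, real_inner_comm]
  have h5 : ∑ m, e m * ⟪u m, z m⟫ = ∑ m, e m * ⟪z m, u m⟫ :=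
    Finset.sum_congr rfl fun m _ => by rw [real_inner_comm]
  simp only [sub_apply, map_sub, inner_sub_right, h3, h4, h5] at h1 ⊢
  linarith

/-- The covariance error is multiplied by a factor that stays bounded, because the source
condition makes `z` small exactly at the rate at which `u` may grow. -/
theorem cov_error_le (hC : C.IsPositive) (hChat : Chat.IsPositive) {c₀ c₁ L K B : ℝ}
    (hc₀ : 0 < c₀) (hc₁ : 0 ≤ c₁) (hL : 0 < L) (hK0 : 0 ≤ K)
    (hK : ∀ m h, |⟪fstar m, h m⟫| ≤ K * √⟪h, C h⟫) {e : ι → ℝ}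
    (he : ∀ m ∈ I, c₀ * L ≤ e m) (he' : ∀ m ∈ I, e m ≤ c₁ * L) (hB : √‖Chat‖ ≤ B)
    {f u z : PiLp 2 H} (hu : IsRidge Chat I e (Chat f) u)
    (hz : IsRidge C I e (diagOp e fstar) z) :
    |⟪z, (Chat - C) (f - u)⟫|
      ≤ ‖Chat - C‖ * ‖f‖ * (c₁ * Fintype.card ι * K / √c₀ * (√L + B / √c₀)) := by
  have hcL : 0 < c₀ * L := by positivity
  have hsc : 0 < √c₀ := Real.sqrt_pos.2 hc₀
  have hsL : 0 < √L := Real.sqrt_pos.2 hL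
  have h1 : √c₀ * √L * ‖u‖ ≤ B * ‖f‖ := by
    rw [← Real.sqrt_mul hc₀.le]
    exact (hu.sqrt_mul_norm_le hChat hcL he).trans (mul_le_mul_of_nonneg_right hB (norm_nonneg _))
  have h2 : √c₀ * √L * ‖z‖ ≤ c₁ * L * (Fintype.card ι * K) := by
    rw [← Real.sqrt_mul hc₀.le]
    have := (energy_estimate hC hcL he (β := c₁ * L * (Fintype.card ι * K)) (γ := 0)
      (by positivity) le_rfl hz.supp (by
        rw [hz.energy_eq, inner_diagOp, zero_mul, add_zero]
        calc ∑ m, e m * ⟪z m, fstar m⟫ ≤ ∑ _m : ι, c₁ * L * (K * √⟪z, C z⟫) :=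
              Finset.sum_le_sum fun m _ => by
                by_cases hm : m ∈ I
                · have h3 := hK m z
                  rw [real_inner_comm] at h3
                  calc e m * ⟪z m, fstar m⟫ ≤ e m * (K * √⟪z, C z⟫) :=
                        mul_le_mul_of_nonneg_left ((le_abs_self _).trans h3)
                          (hcL.le.trans (he m hm))
                    _ ≤ _ := mul_le_mul_of_nonneg_right (he' m hm) (by positivity)
                · rw [hz.supp m hm, inner_zero_left, mul_zero]
                  positivity
          _ = _ := by rw [Finset.sum_const, Finset.card_univ, nsmul_eq_mul]; ring)).2
    simpa using this
  have h4 : ‖u‖ ≤ B / (√c₀ * √L) * ‖f‖ := by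
    rw [div_mul_eq_mul_div, le_div_iff₀ (by positivity)]; linarith
  have h5 : ‖z‖ ≤ c₁ * Fintype.card ι * K / √c₀ * √L := by
    rw [div_mul_eq_mul_div, le_div_iff₀ hsc]
    refine le_of_mul_le_mul_right ?_ hsL
    calc ‖z‖ * √c₀ * √L = √c₀ * √L * ‖z‖ := by ring
      _ ≤ c₁ * L * (Fintype.card ι * K) := h2
      _ = c₁ * Fintype.card ι * K * (√L * √L) := by rw [Real.mul_self_sqrt hL.le]; ring
      _ = _ := by ring
  have hB0 : 0 ≤ B := (Real.sqrt_nonneg _).trans hB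
  calc |⟪z, (Chat - C) (f - u)⟫| ≤ ‖z‖ * (‖Chat - C‖ * (‖f‖ + ‖u‖)) :=
        (abs_real_inner_le_norm _ _).trans (mul_le_mul_of_nonneg_left
          (((Chat - C).le_opNorm _).trans
            (mul_le_mul_of_nonneg_left (norm_sub_le _ _) (norm_nonneg _))) (norm_nonneg _))
    _ ≤ (c₁ * Fintype.card ι * K / √c₀ * √L)
        * (‖Chat - C‖ * (‖f‖ + B / (√c₀ * √L) * ‖f‖)) := by gcongr
    _ = _ := by field_simp

set_option maxHeartbeats 1000000 in
/-- Support recovery. The vector `x` is the one in the irrepresentable condition, and the last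
hypothesis bounds the noise in all directions orthogonal, in the empirical ridge sense, to the
blocks of `fstar`, uniformly over penalty weights `e` close to the ideal ones. -/
theorem VanishingRegularization.eventually_activeSet_eq [∀ m, CompleteSpace (H m)]
    {α : Type*} {l : Filter α}
    {lam₁ lam₂ : α → ℝ} {Chat : α → PiLp 2 H →L[ℝ] PiLp 2 H} {w fhat : α → PiLp 2 H}
    (h : VanishingRegularization l C fstar lam₁ lam₂ Chat w fhat)
    {κ τ : ℝ} {N : α → ℝ} (hκ : κ < 1) (hτ : 0 < τ)
    (hirrep : ∀ᶠ a in l, ∃ x, IsRidge C (activeSet fstar) (fun _ => lam₂ a)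
      (diagOp (fun m => ‖fstar m‖⁻¹ + 2 * (lam₂ a / lam₁ a)) fstar) x ∧
      ∀ m, m ∉ activeSet fstar → ‖(C x) m‖ ≤ κ)
    (hN : Tendsto (fun a => N a / lam₁ a) l (𝓝 0))
    (hnoise : ∀ᶠ a in l, ∀ (e : ι → ℝ) (f u : PiLp 2 H),
      (∀ m ∈ activeSet fstar, 0 < e m ∧
        |(lam₁ a * (2 * ‖fstar m‖)⁻¹ + lam₂ a) / e m - 1| ≤ τ) →
      IsRidge (Chat a) (activeSet fstar) e (Chat a f) u → |⟪w a, f - u⟫| ≤ N a * ‖f‖) :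
    ∀ᶠ a in l, activeSet (fhat a) = activeSet fstar := by
  classical
  set I := activeSet fstar with hI
  have memI : ∀ m, m ∈ I ↔ 0 < ‖fstar m‖ := fun m => by simp [hI, activeSet]
  have hstar : ∀ m, m ∉ I → fstar m = 0 := fun m hm => by
    simpa [memI] using hm
  obtain ⟨K, hK0, hK⟩ := h.source
  have hlim := h.tendsto_minimizer
  have hlimm : ∀ m, Tendsto (fun a => ‖fhat a m‖) l (𝓝 ‖fstar m‖) := fun m =>
    (((PiLp.continuous_apply 2 H m).tendsto _).comp hlim).norm
  set c₂ := ∑ m ∈ I, ‖fstar m‖⁻¹ with hc₂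
  have hc₂0 : 0 ≤ c₂ := Finset.sum_nonneg fun _ _ => by positivity
  have hc₂m : ∀ m ∈ I, ‖fstar m‖⁻¹ ≤ c₂ := fun m hm =>
    Finset.single_le_sum (f := fun m => ‖fstar m‖⁻¹) (fun _ _ => by positivity) hm
  set c₀ := (2 * (‖fstar‖ + 1))⁻¹ with hc₀
  have hc₀0 : 0 < c₀ := by positivity
  have hc₀1 : c₀ ≤ 1 := inv_le_one_of_one_le₀ (by linarith [norm_nonneg fstar])
  -- the weights fitted to the minimizer, and their limits
  let A : α → ι → ℝ := fun a m => if m ∈ I then (2 * ‖fhat a m‖)⁻¹ else 0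
  have hA : ∀ m, Tendsto (fun a => A a m) l (𝓝 (2 * ‖fstar m‖)⁻¹) := fun m => by
    by_cases hm : m ∈ I
    · simp only [A, hm, if_true]
      exact ((hlimm m).const_mul 2).inv₀ (by have := (memI m).1 hm; positivity)
    · simpa [A, hm, hstar m hm] using tendsto_const_nhds
  let δ : α → ℝ := fun a => ∑ m, |A a m - (2 * ‖fstar m‖)⁻¹|
  have hδ : Tendsto δ l (𝓝 0) := by
    have : Tendsto δ l (𝓝 (∑ m : ι, |(2 * ‖fstar m‖)⁻¹ - (2 * ‖fstar m‖)⁻¹|)) :=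
      tendsto_finsetSum _ fun m _ => ((hA m).sub_const _).abs
    simpa using this
  set M : ℝ := (Fintype.card ι : ℝ) with hM
  -- choice of the approximation accuracy
  set B := √‖C‖ * (c₂ * M + c₂ * M + c₂ / √c₀ * M) with hB
  have hB0 : 0 ≤ B := by positivity
  set η := (1 - κ) / (8 * (B + 1)) with hη
  have hη0 : 0 < η := div_pos (by linarith) (by positivity)
  obtain ⟨v, hvs, hv⟩ := exists_block_approx h.isPositive hK I hη0
  set S := ∑ m, ‖v m‖ with hS
  let G : α → ℝ := fun a => √‖C‖ *
      (c₂ * (M * η + (c₂ + 1) / √c₀ * √(lam₁ a + lam₂ a) * S)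
        + c₂ * (M * η + √(lam₂ a) * S) + c₂ / √c₀ * (M * η + 2 * √(lam₂ a) * S))
      + ‖C‖ * δ a * S
  let R : α → ℝ := fun a => ‖Chat a - C‖ / lam₁ a *
    ((c₂ + 1) * M * K / √c₀ * (√(lam₁ a + lam₂ a) + √(‖C‖ + 1) / √c₀))
  have hs2 : Tendsto (fun a => √(lam₂ a)) l (𝓝 0) := by
    simpa [Function.comp_def] using (Real.continuous_sqrt.tendsto 0).comp h.tendsto₂
  have hs12 : Tendsto (fun a => √(lam₁ a + lam₂ a)) l (𝓝 0) := by
    have := h.tendsto₁.add h.tendsto₂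
    rw [add_zero] at this
    simpa [Function.comp_def] using (Real.continuous_sqrt.tendsto 0).comp this
  have hG : Tendsto G l (𝓝 (B * η)) := by
    have := ((((((hs12.const_mul ((c₂ + 1) / √c₀)).mul_const S).const_add (M * η)).const_mul
      c₂).add (((hs2.mul_const S).const_add (M * η)).const_mul c₂)).add
      ((((hs2.const_mul 2).mul_const S).const_add (M * η)).const_mul (c₂ / √c₀))).const_mul
      (√‖C‖) |>.add ((hδ.const_mul ‖C‖).mul_const S)
    refine Eq.subst (motive := fun y => Tendsto G l (𝓝 y)) ?_ this
    rw [hB]; ring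
  have hR : Tendsto R l (𝓝 0) := by
    have := h.cov.mul ((hs12.add_const (√(‖C‖ + 1) / √c₀)).const_mul ((c₂ + 1) * M * K / √c₀))
    rwa [zero_mul] at this
  have hBη : B * η < (1 - κ) / 4 := by
    rw [hη, mul_div_assoc', div_lt_div_iff₀ (by positivity) (by norm_num)]
    nlinarith [mul_nonneg hB0 (sub_nonneg.2 hκ.le)]
  have htot : ∀ᶠ a in l, G a + R a + N a / lam₁ a < (1 - κ) / 4 := by
    have := (hG.add hR).add hN
    simp only [add_zero] at this
    exact this.eventually_lt_const hBη
  have hCn : ∀ᶠ a in l, ‖Chat a - C‖ < 1 :=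
    (tendsto_zero_of_div h.pos₁ h.tendsto₁ h.cov).eventually_lt_const one_pos
  have hnz : ∀ᶠ a in l, ∀ m ∈ I, fhat a m ≠ 0 := by
    rw [Finset.eventually_all]
    intro m hm
    filter_upwards [(hlimm m).eventually_const_lt ((memI m).1 hm)] with a ha
    exact norm_pos_iff.1 ha
  have hAc₂ : ∀ᶠ a in l, ∀ m ∈ I, A a m ≤ c₂ := by
    rw [Finset.eventually_all]
    intro m hm
    have hpos := (memI m).1 hm
    refine (hA m).eventually_le_const ?_
    refine lt_of_lt_of_le ?_ (hc₂m m hm)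
    exact inv_strictAnti₀ hpos (by linarith)
  have hnorm : ∀ᶠ a in l, ‖fhat a‖ < ‖fstar‖ + 1 :=
    hlim.norm.eventually_lt_const (by linarith)
  have hclose : ∀ᶠ a in l, ∀ m ∈ I, |‖fhat a m‖ / ‖fstar m‖ - 1| < τ := by
    rw [Finset.eventually_all]
    intro m hm
    have hpos := (memI m).1 hm
    have : Tendsto (fun a => |‖fhat a m‖ / ‖fstar m‖ - 1|) l (𝓝 0) := by
      have := (((hlimm m).div_const ‖fstar m‖).sub_const 1).abs
      rwa [div_self hpos.ne', sub_self, abs_zero] at this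
    exact this.eventually_lt_const hτ
  filter_upwards [h.pos₁, h.pos₂, h.isMin, hirrep, hnoise, htot, hCn, hnz, hAc₂, hnorm, hclose]
    with a h₁ h₂ hmin ⟨x, hx, hxκ⟩ hnoise htot hCn hnz hAc₂ hnorm hclose
  set e : ι → ℝ := fun m => lam₁ a * (2 * ‖fhat a m‖)⁻¹ + lam₂ a with he
  set e' : ι → ℝ := fun m => lam₁ a * A a m + lam₂ a with he'
  have hee' : ∀ m ∈ I, e m = e' m := fun m hm => by simp [he, he', A, hm]
  have hL : 0 < lam₁ a + lam₂ a := by positivity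
  have helow : ∀ m ∈ I, c₀ * (lam₁ a + lam₂ a) ≤ e m := fun m hm => by
    have h1 : c₀ ≤ (2 * ‖fhat a m‖)⁻¹ := by
      have := norm_pos_iff.2 (hnz m hm)
      refine inv_anti₀ (by positivity) ?_
      have := norm_apply_le_norm (fhat a) m
      linarith
    simp only [he]
    nlinarith
  have hA0 : ∀ m, 0 ≤ A a m := fun m => by simp only [A]; split_ifs <;> positivity
  have hA2 : ∀ m, A a m ≤ c₂ := fun m => by
    by_cases hm : m ∈ I
    · exact hAc₂ m hm
    · simpa [A, hm] using hc₂0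
  have hehigh : ∀ m ∈ I, e m ≤ (c₂ + 1) * (lam₁ a + lam₂ a) := fun m hm => by
    rw [hee' m hm]
    simp only [he']
    nlinarith [hA2 m]
  set f := fhat a - blockProj I (fhat a) with hf
  obtain ⟨u, hu⟩ := exists_isRidge (h.isPositive_emp a) (mul_pos hc₀0 hL) helow (Chat a f)
  obtain ⟨z, hz⟩ := exists_isRidge h.isPositive (mul_pos hc₀0 hL) helow (diagOp e fstar)
  have k1 := outside_norm_le (h.isPositive_emp a) h₁ h₂ hmin hnz hstar hf hu
  rw [sum_mul_inner_ridge h.isPositive hu hz] at k1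
  have k2 := cov_error_le (B := √(‖C‖ + 1)) h.isPositive (h.isPositive_emp a) hc₀0
    (by positivity) hL hK0 hK helow hehigh (by
      refine Real.sqrt_le_sqrt ?_
      have := norm_add_le (Chat a - C) C
      rw [sub_add_cancel] at this
      linarith) hu hz
  have k3 := hnoise e f u (fun m hm => by
    have hfm := norm_pos_iff.2 (hnz m hm)
    have hsm := (memI m).1 hm
    have hem : 0 < e m := (mul_pos hc₀0 hL).trans_le (helow m hm)
    refine ⟨hem, ?_⟩
    have h1 : (lam₁ a * (2 * ‖fstar m‖)⁻¹ + lam₂ a) / e m - 1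
        = (lam₁ a * (2 * ‖fhat a m‖)⁻¹ / e m) * (‖fhat a m‖ / ‖fstar m‖ - 1) := by
      field_simp
      simp only [he]
      field_simp
      ring
    rw [h1, abs_mul]
    refine (mul_le_of_le_one_left (abs_nonneg _) ?_).trans (hclose m hm).le
    rw [abs_of_nonneg (by positivity), div_le_one hem]
    simp only [he]
    linarith) hu
  have hdiag : ∀ m, m ∈ I ∨ fstar m = 0 := fun m => or_iff_not_imp_left.2 (hstar m)
  have hz' : IsRidge C I (fun m => lam₁ a * A a m + lam₂ a)
      (diagOp (fun m => lam₁ a * A a m + lam₂ a) fstar) z := by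
    have h1 : (diagOp e fstar : PiLp 2 H) = diagOp e' fstar := by
      ext m
      rcases hdiag m with hm | hm
      · rw [diagOp_apply, diagOp_apply, hee' m hm]
      · simp [diagOp_apply, hm]
    rw [h1] at hz
    exact hz.congr hee'
  have hx' : IsRidge C I (fun _ => lam₂ a)
      (diagOp (fun m => lam₁ a * (2 * ‖fstar m‖)⁻¹ + lam₂ a) fstar) ((lam₁ a / 2) • x) := by
    have h1 : (diagOp (fun m => lam₁ a * (2 * ‖fstar m‖)⁻¹ + lam₂ a) fstar : PiLp 2 H)
        = (lam₁ a / 2) • diagOp (fun m => ‖fstar m‖⁻¹ + 2 * (lam₂ a / lam₁ a)) fstar := by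
      ext m
      rw [PiLp.smul_apply, diagOp_apply, diagOp_apply, smul_smul]
      congr 1
      rw [mul_inv]
      field_simp
    rw [h1]
    exact hx.smul _
  have k4 := abs_inner_ridge_sub_le (c₀ := c₀) (c₂ := c₂) (η := η) (δ := δ a) h.isPositive h₁ h₂
    hc₀0 hη0.le (α := fun m => lam₁ a * A a m)
    (β := fun m => lam₁ a * (2 * ‖fstar m‖)⁻¹)
    (fun m => mul_nonneg h₁.le (hA0 m))
    (fun m => by rw [mul_comm]; exact mul_le_mul_of_nonneg_right (hA2 m) h₁.le)
    (fun m => by positivity)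
    (fun m => by
      rw [mul_comm]
      refine mul_le_mul_of_nonneg_right ?_ h₁.le
      rcases hdiag m with hm | hm
      · refine le_trans ?_ (hc₂m m hm)
        exact inv_anti₀ ((memI m).1 hm) (by linarith [norm_nonneg (fstar m)])
      · simpa [hm] using hc₂0)
    (fun m => by
      rw [← mul_sub, abs_mul, abs_of_pos h₁, mul_comm]
      exact mul_le_mul_of_nonneg_right (Finset.single_le_sum
        (f := fun m => |A a m - (2 * ‖fstar m‖)⁻¹|) (fun _ _ => abs_nonneg _)
        (Finset.mem_univ m)) h₁.le)
    (fun m hm => (helow m hm).trans_eq (hee' m hm)) hvs hv hx' hz' hc₂0 f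
  have hfI : ∀ m ∈ I, f m = 0 := fun m hm => by simp [hf, blockProj_apply_mem hm]
  have k5 : ⟪f, C ((lam₁ a / 2) • x)⟫ ≤ lam₁ a / 2 * (κ * ∑ m, ‖f m‖) := by
    rw [map_smul, inner_smul_right]
    refine mul_le_mul_of_nonneg_left ?_ (by positivity)
    rw [PiLp.inner_apply, Finset.mul_sum]
    refine Finset.sum_le_sum fun m _ => ?_
    by_cases hm : m ∈ I
    · simp [hfI m hm]
    · rw [mul_comm]
      exact (real_inner_le_norm _ _).trans
        (mul_le_mul_of_nonneg_left (hxκ m hm) (norm_nonneg _))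
  have hf0 : ∑ m, ‖f m‖ = 0 := by
    by_contra hne
    have hpos : 0 < ∑ m, ‖f m‖ :=
      lt_of_le_of_ne (Finset.sum_nonneg fun _ _ => norm_nonneg _) (Ne.symm hne)
    have hfn := norm_le_sum_norm f
    have k4' : ⟪f, C z⟫ - ⟪f, C ((lam₁ a / 2) • x)⟫ ≤ lam₁ a * ‖f‖ * G a :=
      (le_abs_self _).trans k4
    have k2' : ⟪z, (Chat a - C) (f - u)⟫ ≤ lam₁ a * ‖f‖ * R a := by
      refine (le_abs_self _).trans (k2.trans_eq ?_)
      simp only [R, hM]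
      field_simp
    have k3' : ⟪w a, f - u⟫ ≤ lam₁ a * ‖f‖ * (N a / lam₁ a) := by
      refine (le_abs_self _).trans (k3.trans_eq ?_)
      field_simp
    have k6 : lam₁ a / 2 * ∑ m, ‖f m‖ ≤ lam₁ a / 2 * (κ * ∑ m, ‖f m‖)
        + lam₁ a * ‖f‖ * (G a + R a + N a / lam₁ a) := by linarith
    have k7 : lam₁ a * ‖f‖ * (G a + R a + N a / lam₁ a)
        ≤ lam₁ a * ‖f‖ * ((1 - κ) / 4) := mul_le_mul_of_nonneg_left htot.le (by positivity)
    have k8 : lam₁ a * ‖f‖ * ((1 - κ) / 4) ≤ lam₁ a * (∑ m, ‖f m‖) * ((1 - κ) / 4) := by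
      have : 0 ≤ (1 - κ) / 4 := by linarith
      gcongr
    have k9 : 0 < lam₁ a * (∑ m, ‖f m‖) * ((1 - κ) / 4) := by
      have : 0 < (1 - κ) / 4 := by linarith
      positivity
    linarith
  have hfz : ∀ m, f m = 0 := fun m => norm_eq_zero.1
    ((Finset.sum_eq_zero_iff_of_nonneg fun _ _ => norm_nonneg _).1 hf0 m (Finset.mem_univ m))
  ext m
  by_cases hm : m ∈ I
  · simp only [hm, iff_true, activeSet, Finset.mem_filter, Finset.mem_univ, true_and]
    exact norm_pos_iff.2 (hnz m hm)
  · have : fhat a m = 0 := by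
      have := hfz m
      simpa [hf, blockProj_apply_notMem hm] using this
    simp [hm, activeSet, this]

end Recovery

end MKL

namespace MKL

/-! ### The source condition in the joint space -/

section Factor

variable {E : Type*} [NormedAddCommGroup E] [InnerProductSpace ℝ E] [CompleteSpace E]

/-- A functional vanishing on the kernel and on the range of a positive operator is zero. -/
theorem eq_zero_of_ker_of_range {S : E →L[ℝ] E} (hS : S.IsPositive) {φ : E →L[ℝ] ℝ}
    (hker : ∀ x, S x = 0 → φ x = 0) (hrange : ∀ x, φ (S x) = 0) (x : E) : φ x = 0 := by
  obtain ⟨p, rfl⟩ := (InnerProductSpace.toDual ℝ E).surjective φ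
  simp only [InnerProductSpace.toDual_apply_apply] at hker hrange ⊢
  have h1 : S p = 0 := by
    rw [← inner_self_eq_zero (𝕜 := ℝ), hS.inner_left_eq_inner_right]
    exact hrange (S p)
  have h2 : p = 0 := inner_self_eq_zero.1 (hker p h1)
  rw [h2, inner_zero_left]

/-- If `C = S V S` with `V` invertible and equal to the identity on the kernel of `S`, then the
form of `C` controls the norm of `S v`. The operator `V` is symmetric and nonnegative, since it is
so on the range and on the kernel of `S`. -/
theorem exists_coercive_of_factor {S V C : E →L[ℝ] E} (hS : S.IsPositive) (hC : C.IsPositive)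
    (hSVS : ∀ v, S (V (S v)) = C v) (hker : ∀ h, S h = 0 → V h = h)
    (hker' : ∀ h g, S h = 0 → ⟪h, V g⟫ = ⟪h, g⟫) (hV : IsUnit V) :
    ∃ c : ℝ, 0 < c ∧ ∀ v, c * ‖S v‖ ^ 2 ≤ ⟪v, C v⟫ := by
  have hSinner : ∀ a b, ⟪S a, b⟫ = ⟪a, S b⟫ := hS.inner_left_eq_inner_right
  have hsym1 : ∀ a g, ⟪S a, V g⟫ = ⟪V (S a), g⟫ := fun a g => by
    have := eq_zero_of_ker_of_range hS
      (φ := (innerSL ℝ (S a)) ∘L V - innerSL ℝ (V (S a))) (fun x hx => by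
        simp only [sub_apply, ContinuousLinearMap.comp_apply, innerSL_apply_apply]
        rw [hker x hx, real_inner_comm x (V (S a)), hker' x _ hx, real_inner_comm, sub_self])
      (fun b => by
        simp only [sub_apply, ContinuousLinearMap.comp_apply, innerSL_apply_apply]
        rw [hSinner, hSVS, ← hSinner, hSVS, hC.inner_left_eq_inner_right, sub_self]) g
    simpa [sub_eq_zero] using this
  have hsym : ∀ f g, ⟪V f, g⟫ = ⟪f, V g⟫ := fun f g => by
    have := eq_zero_of_ker_of_range hS
      (φ := innerSL ℝ (V g) - (innerSL ℝ g) ∘L V) (fun x hx => by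
        simp only [sub_apply, ContinuousLinearMap.comp_apply, innerSL_apply_apply]
        rw [hker x hx, real_inner_comm, hker' x _ hx, real_inner_comm, sub_self])
      (fun b => by
        simp only [sub_apply, ContinuousLinearMap.comp_apply, innerSL_apply_apply]
        rw [real_inner_comm, hsym1, real_inner_comm, sub_self]) f
    simp only [sub_apply, ContinuousLinearMap.comp_apply, innerSL_apply_apply, sub_eq_zero] at this
    rw [real_inner_comm, ← this, real_inner_comm]
  have hnonneg : ∀ h, 0 ≤ ⟪h, V h⟫ := fun h => by
    obtain ⟨h₀, hh₀, h₁, hh₁, rfl⟩ := S.ker.exists_add_mem_mem_orthogonal h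
    have h0 : S h₀ = 0 := hh₀
    have hcl : 0 ≤ ⟪h₁, V h₁⟫ := by
      rw [S.orthogonal_ker, hS.isSelfAdjoint.adjoint_eq] at hh₁
      have hclosed : IsClosed {h : E | 0 ≤ ⟪h, V h⟫} :=
        isClosed_le continuous_const (continuous_id.inner V.continuous)
      refine closure_minimal ?_ hclosed hh₁
      rintro _ ⟨v, rfl⟩
      simp only [ContinuousLinearMap.coe_coe, Set.mem_ofPred_eq]
      rw [hSinner, hSVS]
      exact hC.inner_nonneg_right v
    have h01 : ⟪h₀, h₁⟫ = 0 := hh₁ h₀ hh₀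
    have h1 : ⟪h₁, V h₀⟫ = 0 := by rw [hker h₀ h0, real_inner_comm, h01]
    have h2 : ⟪h₀, V h₁⟫ = 0 := by rw [hker' h₀ _ h0, h01]
    rw [map_add, inner_add_left, inner_add_right, inner_add_right, h1, h2, hker h₀ h0]
    have := real_inner_self_nonneg (x := h₀)
    linarith
  have hVpos : V.IsPositive := (ContinuousLinearMap.isPositive_iff _).2
    ⟨fun f g => hsym f g, fun h => by rw [real_inner_comm]; exact hnonneg h⟩
  obtain ⟨c, hc, hcV⟩ := exists_coercive_of_isUnit hVpos hV
  refine ⟨c, hc, fun v => (hcV (S v)).trans_eq ?_⟩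
  rw [hSinner, hSVS]

end Factor

/-- The block-diagonal operator with blocks `R m`. -/
noncomputable def blockDiag {ι : Type*} {H : ι → Type*} [∀ m, NormedAddCommGroup (H m)]
    [∀ m, InnerProductSpace ℝ (H m)] (R : ∀ m, H m →L[ℝ] H m) : PiLp 2 H →L[ℝ] PiLp 2 H :=
  (PiLp.continuousLinearEquiv 2 ℝ H).symm.toContinuousLinearMap ∘L
    ContinuousLinearMap.pi fun m => R m ∘L PiLp.proj 2 H m

theorem blockDiag_apply {ι : Type*} {H : ι → Type*} [∀ m, NormedAddCommGroup (H m)]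
    [∀ m, InnerProductSpace ℝ (H m)] (R : ∀ m, H m →L[ℝ] H m) (f : PiLp 2 H) (m : ι) :
    blockDiag R f m = R m (f m) := by
  simp [blockDiag]

theorem isPositive_blockDiag {ι : Type*} [Fintype ι] {H : ι → Type*}
    [∀ m, NormedAddCommGroup (H m)] [∀ m, InnerProductSpace ℝ (H m)] {R : ∀ m, H m →L[ℝ] H m} (hR : ∀ m, (R m).IsPositive) :
    (blockDiag R).IsPositive := by
  refine (ContinuousLinearMap.isPositive_iff _).2 ⟨fun f g => ?_, fun f => ?_⟩
  · simp only [ContinuousLinearMap.coe_coe, PiLp.inner_apply, blockDiag_apply]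
    exact Finset.sum_congr rfl fun m _ => (hR m).inner_left_eq_inner_right _ _
  · simp only [PiLp.inner_apply, blockDiag_apply]
    exact Finset.sum_nonneg fun m _ => (hR m).inner_nonneg_left _

section Features

variable {𝒳 : Type*} [MeasurableSpace 𝒳] {ι : Type*} [Fintype ι] {H : ι → Type*}
  [∀ m, NormedAddCommGroup (H m)] [∀ m, InnerProductSpace ℝ (H m)] [∀ m, CompleteSpace (H m)]
  [∀ m, RKHS ℝ (H m) 𝒳 ℝ]

/-- The joint population covariance operator on `⊕ₘ H m`. -/
noncomputable def jointCov (ν : Measure 𝒳) : PiLp 2 H →L[ℝ] PiLp 2 H :=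
  blockOp (crossCov (H := H) ν)

theorem abs_evalSum_le (hB : SeparableBoundedKernels (𝒳 := 𝒳) H) (f : PiLp 2 H) (x : 𝒳) :
    |evalSum f x| ≤ ∑ m, ‖f m‖ :=
  (Finset.abs_sum_le_sum_abs _ _).trans
    (Finset.sum_le_sum fun m _ => abs_apply_le_norm hB m (f m) x)

theorem integrable_mul_apply (ν : Measure 𝒳) [IsProbabilityMeasure ν]
    (hM : ∀ (m : ι) (f : H m), Measurable fun x => f x)
    (hB : SeparableBoundedKernels (𝒳 := 𝒳) H) {l m : ι} (f : H l) (g : H m) :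
    Integrable (fun x => f x * g x) ν :=
  Integrable.of_bound ((hM l f).mul (hM m g)).aestronglyMeasurable (‖f‖ * ‖g‖)
    (.of_forall fun x => by
      rw [norm_mul]
      exact mul_le_mul (abs_apply_le_norm hB l f x) (abs_apply_le_norm hB m g x)
        (norm_nonneg _) (norm_nonneg _))

theorem inner_jointCov (ν : Measure 𝒳) [IsProbabilityMeasure ν]
    (hM : ∀ (m : ι) (f : H m), Measurable fun x => f x)
    (hB : SeparableBoundedKernels (𝒳 := 𝒳) H) (f g : PiLp 2 H) :
    ⟪f, jointCov ν g⟫ = ∫ x, evalSum f x * evalSum g x ∂ν := by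
  have h1 : ∀ x, evalSum f x * evalSum g x = ∑ l, ∑ m, f l x * g m x := fun x => by
    rw [evalSum, evalSum, Finset.sum_mul_sum]
  simp only [h1]
  rw [integral_finsetSum _ fun l _ => integrable_finsetSum _ fun m _ =>
    integrable_mul_apply ν hM hB _ _, PiLp.inner_apply]
  refine Finset.sum_congr rfl fun l _ => ?_
  rw [integral_finsetSum _ fun m _ => integrable_mul_apply ν hM hB _ _, jointCov, blockOp_apply,
    inner_sum]
  exact Finset.sum_congr rfl fun m _ => inner_crossCov ν hM hB l m _ _

theorem isPositive_jointCov (ν : Measure 𝒳) [IsProbabilityMeasure ν]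
    (hM : ∀ (m : ι) (f : H m), Measurable fun x => f x)
    (hB : SeparableBoundedKernels (𝒳 := 𝒳) H) :
    (jointCov (H := H) ν).IsPositive := by
  refine (ContinuousLinearMap.isPositive_iff _).2 ⟨fun f g => ?_, fun f => ?_⟩
  · rw [ContinuousLinearMap.coe_coe, real_inner_comm, inner_jointCov ν hM hB,
      inner_jointCov ν hM hB]
    simp only [mul_comm]
  · rw [real_inner_comm, inner_jointCov ν hM hB]
    exact integral_nonneg fun x => mul_self_nonneg _

/-- Invertibility of the joint correlation operator turns the componentwise source condition into
a bound of each component of `fstar` by the joint covariance form. -/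
theorem exists_source_bound (ν : Measure 𝒳) [IsProbabilityMeasure ν]
    (hM : ∀ (m : ι) (f : H m), Measurable fun x => f x)
    (hB : SeparableBoundedKernels (𝒳 := 𝒳) H) {fstar : PiLp 2 H}
    (hsource : SourceCondition ν fstar) (hcorr : CorrelationCondition ν H) :
    ∃ K : ℝ, 0 ≤ K ∧ ∀ m (h : PiLp 2 H), |⟪fstar m, h m⟫| ≤ K * √⟪h, jointCov ν h⟫ := by
  choose R hR g hg using hsource
  obtain ⟨V, hV, -, hunit⟩ := hcorr
  have hfac : ∀ l m, R l ∘L V l m ∘L R m = crossCov ν l m := fun l m => by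
    obtain ⟨Rl, Rm, hl, hm, h⟩ := hV.factor l m
    rwa [eq_of_isPositive_of_comp_self_eq hl.1 (hR l).1 (hl.2.trans (hR l).2.symm),
      eq_of_isPositive_of_comp_self_eq hm.1 (hR m).1 (hm.2.trans (hR m).2.symm)] at h
  have hRker : ∀ m (f : H m), R m f = 0 → crossCov ν m m f = 0 := fun m f hf => by
    rw [← (hR m).2, ContinuousLinearMap.comp_apply, hf, map_zero]
  have hSpos : (blockDiag R).IsPositive := isPositive_blockDiag fun m => (hR m).1
  have hkerm : ∀ {h : PiLp 2 H}, blockDiag R h = 0 → ∀ m, R m (h m) = 0 := fun {h} hh m => by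
    rw [← blockDiag_apply, hh]; rfl
  have hSVS : ∀ v, blockDiag R (blockOp V (blockDiag R v)) = jointCov ν v := fun v => by
    ext l
    rw [blockDiag_apply, blockOp_apply, map_sum, jointCov, blockOp_apply]
    have : ∀ m, R l (V l m (blockDiag R v m)) = crossCov ν l m (v m) := fun m => by
      rw [← hfac, blockDiag_apply]; rfl
    simp only [this]
  obtain ⟨c, hc, hcoer⟩ := exists_coercive_of_factor (E := PiLp 2 H) (S := blockDiag R) (V := blockOp V)
    (C := jointCov ν) hSpos (isPositive_jointCov ν hM hB)
    hSVS
    (fun h hh => by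
      ext l
      rw [blockOp_apply, Finset.sum_eq_single l
        (fun m _ hm => hV.ker_right l m hm.symm _ (hRker m _ (hkerm hh m))) (by simp), hV.diag]
      rfl)
    (fun h f hh => by
      rw [PiLp.inner_apply, PiLp.inner_apply]
      refine Finset.sum_congr rfl fun l _ => ?_
      rw [blockOp_apply, inner_sum, Finset.sum_eq_single l
        (fun m _ hm => hV.ker_left l m hm.symm _ _ (hRker l _ (hkerm hh l))) (by simp), hV.diag]
      rfl) hunit
  refine ⟨∑ m, ‖g m‖ / √c, Finset.sum_nonneg fun m _ => by positivity, fun m h => ?_⟩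
  have hsc : 0 < √c := Real.sqrt_pos.2 hc
  have h1 : ‖R m (h m)‖ ≤ √⟪h, jointCov ν h⟫ / √c := by
    rw [le_div_iff₀ hsc]
    refine Real.le_sqrt_of_sq_le ?_
    rw [mul_pow, Real.sq_sqrt hc.le, mul_comm]
    refine le_trans ?_ (hcoer h)
    have := norm_apply_le_norm (blockDiag R h) m
    rw [blockDiag_apply] at this
    gcongr
  rw [hg m, (hR m).1.inner_left_eq_inner_right]
  calc |⟪g m, R m (h m)⟫| ≤ ‖g m‖ * (√⟪h, jointCov ν h⟫ / √c) :=
        (abs_real_inner_le_norm _ _).trans (mul_le_mul_of_nonneg_left h1 (norm_nonneg _))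
    _ = ‖g m‖ / √c * √⟪h, jointCov ν h⟫ := by ring
    _ ≤ _ := by
      gcongr
      exact Finset.single_le_sum (f := fun m => ‖g m‖ / √c) (fun _ _ => by positivity)
        (Finset.mem_univ m)

/-- The vector in the irrepresentable condition is the gradient, outside the support, of a
population ridge problem on the support. -/
theorem exists_isRidge_irrepVec (ν : Measure 𝒳) [IsProbabilityMeasure ν]
    (hM : ∀ (m : ι) (f : H m), Measurable fun x => f x)
    (hB : SeparableBoundedKernels (𝒳 := 𝒳) H) (fstar : PiLp 2 H) {lam₁ lam₂ : ℝ}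
    (h₂ : 0 < lam₂) :
    ∃ x, IsRidge (jointCov ν) (activeSet fstar) (fun _ => lam₂)
      (diagOp (fun m => ‖fstar m‖⁻¹ + 2 * (lam₂ / lam₁)) fstar) x ∧
      ∀ m, (jointCov ν x) m = irrepVec ν fstar lam₁ lam₂ m := by
  classical
  set I := activeSet fstar with hI
  -- extension by zero from the blocks in `I`
  let ext : PiLp 2 (fun m : I => H m) → PiLp 2 H := fun y =>
    WithLp.toLp 2 fun m => if h : m ∈ I then y ⟨m, h⟩ else 0
  have ext_mem : ∀ y (m : I), ext y m = y m := fun y m => by simp [ext]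
  have ext_not : ∀ y m, m ∉ I → ext y m = 0 := fun y m hm => by simp [ext, hm]
  have hcov : ∀ y m, (jointCov ν (ext y)) m = covRow ν m I y := fun y m => by
    rw [jointCov, blockOp_apply, covRow, sum_apply]
    rw [← Finset.sum_subset (Finset.subset_univ I) fun l _ hl => by rw [ext_not y l hl, map_zero],
      ← Finset.sum_coe_sort]
    refine Finset.sum_congr rfl fun l _ => ?_
    rw [ext_mem]; rfl
  have hcovOn : ∀ y (m : I), covOn (H := H) ν I y m = (jointCov ν (ext y)) m := fun y m => by
    rw [hcov, covOn, blockOp_apply, covRow, sum_apply]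
    rfl
  have hinner : ∀ (y : PiLp 2 (fun m : I => H m)) (f : PiLp 2 H),
      ⟪ext y, f⟫ = ∑ m : I, ⟪y m, f m⟫ := fun y f => by
    rw [PiLp.inner_apply, ← Finset.sum_subset (Finset.subset_univ I) fun l _ hl => by
      rw [ext_not y l hl, inner_zero_left], ← Finset.sum_coe_sort]
    exact Finset.sum_congr rfl fun l _ => by rw [ext_mem]
  have hunit : IsUnit (covOn (H := H) ν I + lam₂ • 1) := by
    refine isUnit_of_coercive h₂ fun y => ?_
    have h1 := (isPositive_jointCov (H := H) ν hM hB).inner_nonneg_right (ext y)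
    rw [hinner] at h1
    rw [add_apply, inner_add_right, PiLp.inner_apply, smul_apply, inner_smul_right,
      one_apply_eq_self, real_inner_self_eq_norm_sq]
    simp only [hcovOn]
    linarith
  set rhs : PiLp 2 (fun m : I => H m) :=
    (invNormDiag fstar + (2 * (lam₂ / lam₁)) • 1) (restrict I fstar) with hrhs
  set y := Ring.inverse (covOn (H := H) ν I + lam₂ • 1) rhs with hy
  have hyeq : (covOn (H := H) ν I + lam₂ • 1) y = rhs := by
    rw [hy, ← mul_apply_eq_comp, Ring.mul_inverse_cancel _ hunit, one_apply_eq_self]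
  refine ⟨ext y, ⟨ext_not y, fun h hh => ?_⟩, fun m => hcov y m⟩
  have hsum : ∀ F : ι → ℝ, (∀ m, m ∉ I → F m = 0) → ∑ m, F m = ∑ m : I, F m := fun F hF => by
    rw [← Finset.sum_subset (Finset.subset_univ I) fun l _ hl => hF l hl, ← Finset.sum_coe_sort]
  rw [inner_diagOp, PiLp.inner_apply, ← Finset.sum_add_distrib,
    hsum _ fun m hm => by simp [hh m hm], hsum _ fun m hm => by simp [hh m hm]]
  refine Finset.sum_congr rfl fun m _ => ?_
  have h1 := congrArg (fun f : PiLp 2 (fun m : I => H m) => f m) hyeq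
  simp only [add_apply, PiLp.add_apply, hcovOn, smul_apply, one_apply_eq_self,
    PiLp.smul_apply, hrhs, invNormDiag] at h1
  rw [ext_mem, ← inner_smul_right, ← inner_add_right, h1, ← inner_smul_right, add_smul,
    diagOp_apply]
  rfl

end Features

end MKL

namespace MKL

/-! ### The sample in Hilbert space form -/

section Sample

variable {𝒳 : Type*} {ι : Type*} {H : ι → Type*}
  [∀ m, NormedAddCommGroup (H m)] [∀ m, InnerProductSpace ℝ (H m)] [∀ m, CompleteSpace (H m)]
  [∀ m, RKHS ℝ (H m) 𝒳 ℝ]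

/-- The canonical feature `kₘ(x, ·)`. -/
noncomputable def blockFeature (H : ι → Type*)
    [∀ m, NormedAddCommGroup (H m)] [∀ m, InnerProductSpace ℝ (H m)] [∀ m, CompleteSpace (H m)]
    [∀ m, RKHS ℝ (H m) 𝒳 ℝ] (m : ι) (x : 𝒳) : H m :=
  RKHS.kerFun (H m) x 1

theorem inner_blockFeature (m : ι) (x : 𝒳) (f : H m) : ⟪blockFeature H m x, f⟫ = f x := by
  simp [blockFeature]

variable [Fintype ι]

/-- The joint feature `(kₘ(x, ·))ₘ`, which represents the evaluation `f ↦ ∑ₘ fₘ(x)`. -/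
noncomputable def feature (H : ι → Type*)
    [∀ m, NormedAddCommGroup (H m)] [∀ m, InnerProductSpace ℝ (H m)] [∀ m, CompleteSpace (H m)]
    [∀ m, RKHS ℝ (H m) 𝒳 ℝ] (x : 𝒳) : PiLp 2 H :=
  WithLp.toLp 2 fun m => blockFeature H m x

theorem inner_feature (x : 𝒳) (f : PiLp 2 H) : ⟪feature H x, f⟫ = evalSum f x := by
  simp [PiLp.inner_apply, feature, evalSum, inner_blockFeature]

theorem evalSum_sub (f g : PiLp 2 H) (x : 𝒳) : evalSum (f - g) x = evalSum f x - evalSum g x := by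
  rw [← inner_feature, inner_sub_right, inner_feature, inner_feature]

/-- The empirical covariance operator. -/
noncomputable def empCov (H : ι → Type*)
    [∀ m, NormedAddCommGroup (H m)] [∀ m, InnerProductSpace ℝ (H m)] [∀ m, CompleteSpace (H m)]
    [∀ m, RKHS ℝ (H m) 𝒳 ℝ] {n : ℕ} (x : Fin n → 𝒳) : PiLp 2 H →L[ℝ] PiLp 2 H :=
  (1 / (n : ℝ)) • ∑ i, (innerSL ℝ (feature H (x i))).smulRight (feature H (x i))

/-- The noise vector `n⁻¹ ∑ᵢ εᵢ (kₘ(xᵢ, ·))ₘ`. -/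
noncomputable def noiseVec (H : ι → Type*)
    [∀ m, NormedAddCommGroup (H m)] [∀ m, InnerProductSpace ℝ (H m)] [∀ m, CompleteSpace (H m)]
    [∀ m, RKHS ℝ (H m) 𝒳 ℝ] {n : ℕ} (x : Fin n → 𝒳) (ε : Fin n → ℝ) : PiLp 2 H :=
  (1 / (n : ℝ)) • ∑ i, ε i • feature H (x i)

theorem inner_empCov {n : ℕ} (x : Fin n → 𝒳) (f g : PiLp 2 H) :
    ⟪f, empCov H x g⟫ = 1 / (n : ℝ) * ∑ i, evalSum f (x i) * evalSum g (x i) := by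
  simp only [empCov, smul_apply, sum_apply, ContinuousLinearMap.smulRight_apply,
    innerSL_apply_apply, inner_smul_right, inner_sum, inner_feature]
  congr 1
  refine Finset.sum_congr rfl fun i _ => ?_
  rw [real_inner_comm, inner_feature, mul_comm]

theorem inner_noiseVec {n : ℕ} (x : Fin n → 𝒳) (ε : Fin n → ℝ) (f : PiLp 2 H) :
    ⟪noiseVec H x ε, f⟫ = 1 / (n : ℝ) * ∑ i, ε i * evalSum f (x i) := by
  simp [noiseVec, inner_smul_left, sum_inner, inner_feature]

theorem isPositive_empCov {n : ℕ} (x : Fin n → 𝒳) : (empCov H x).IsPositive := by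
  refine (ContinuousLinearMap.isPositive_iff _).2 ⟨fun f g => ?_, fun f => ?_⟩
  · rw [ContinuousLinearMap.coe_coe, real_inner_comm, inner_empCov, inner_empCov]
    simp only [mul_comm]
  · rw [real_inner_comm, inner_empCov]
    exact mul_nonneg (by positivity) (Finset.sum_nonneg fun i _ => mul_self_nonneg _)

/-- The objective differs from its Hilbert space form by a constant. -/
theorem objective_eq (n : ℕ) (lam₁ lam₂ : ℝ) (x : ℕ → 𝒳) (y : ℕ → ℝ) (fstar f : PiLp 2 H) :
    objective n lam₁ lam₂ x y f
      = hilbertObjective (empCov H fun i : Fin n => x i)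
          (noiseVec H (fun i : Fin n => x i) fun i : Fin n => y i - evalSum fstar (x i))
          fstar lam₁ lam₂ f
        + 1 / (n : ℝ) * ∑ i : Fin n, (y i - evalSum fstar (x i)) ^ 2 := by
  have h : ∑ i : Fin n, (y i - evalSum f (x i)) ^ 2
      = ∑ i : Fin n, evalSum (f - fstar) (x i) * evalSum (f - fstar) (x i)
        - 2 * ∑ i : Fin n, (y i - evalSum fstar (x i)) * evalSum (f - fstar) (x i)
        + ∑ i : Fin n, (y i - evalSum fstar (x i)) ^ 2 := by
    rw [Finset.mul_sum, ← Finset.sum_sub_distrib, ← Finset.sum_add_distrib]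
    refine Finset.sum_congr rfl fun i _ => ?_
    rw [evalSum_sub]; ring
  rw [objective, hilbertObjective, inner_empCov, inner_noiseVec, Finset.sum_range, h]
  ring

/-- The normalized Gram matrix of block `m`. -/
noncomputable def blockGram (H : ι → Type*)
    [∀ m, NormedAddCommGroup (H m)] [∀ m, InnerProductSpace ℝ (H m)] [∀ m, CompleteSpace (H m)]
    [∀ m, RKHS ℝ (H m) 𝒳 ℝ] {n : ℕ} (x : Fin n → 𝒳) (m : ι) : Matrix (Fin n) (Fin n) ℝ :=
  Matrix.of fun a b => 1 / (n : ℝ) * ⟪blockFeature H m (x a), blockFeature H m (x b)⟫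

/-- The normalized Gram matrix of the joint features. -/
noncomputable def jointGram (H : ι → Type*)
    [∀ m, NormedAddCommGroup (H m)] [∀ m, InnerProductSpace ℝ (H m)] [∀ m, CompleteSpace (H m)]
    [∀ m, RKHS ℝ (H m) 𝒳 ℝ] {n : ℕ} (x : Fin n → 𝒳) : Matrix (Fin n) (Fin n) ℝ :=
  ∑ m, blockGram H x m

theorem jointGram_apply {n : ℕ} (x : Fin n → 𝒳) (a b : Fin n) :
    jointGram H x a b = 1 / (n : ℝ) * ⟪feature H (x a), feature H (x b)⟫ := by
  simp [jointGram, Matrix.sum_apply, blockGram, PiLp.inner_apply, feature, Finset.mul_sum]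

open Matrix in
theorem dotProduct_gram_mulVec {E : Type*} [NormedAddCommGroup E] [InnerProductSpace ℝ E]
    {n : ℕ} (φ : Fin n → E) {K : Matrix (Fin n) (Fin n) ℝ}
    (hK : ∀ a b, K a b = 1 / (n : ℝ) * ⟪φ a, φ b⟫) (c d : Fin n → ℝ) :
    c ⬝ᵥ K *ᵥ d = 1 / (n : ℝ) * ⟪∑ i, c i • φ i, ∑ i, d i • φ i⟫ := by
  rw [sum_inner, Finset.mul_sum]
  simp only [dotProduct, mulVec, hK]
  refine Finset.sum_congr rfl fun i _ => ?_
  rw [inner_sum, Finset.mul_sum, Finset.mul_sum]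
  refine Finset.sum_congr rfl fun j _ => ?_
  rw [inner_smul_left, inner_smul_right, conj_trivial]
  ring

open Matrix in
/-- The values at the sample points of the residual `f - u` of a ridge projection solve a linear
system with the Gram matrices. -/
theorem IsRidge.residual_eq {n : ℕ} {x : Fin n → 𝒳} {I : Finset ι} {e : ι → ℝ}
    {f u : PiLp 2 H} (hu : IsRidge (empCov H x) I e (empCov H x f) u) (he : ∀ m ∈ I, 0 < e m) :
    (fun a => evalSum (f - u) (x a))
      + ∑ m ∈ I, (e m)⁻¹ • (blockGram H x m *ᵥ fun a => evalSum (f - u) (x a))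
      = fun a => evalSum f (x a) := by
  classical
  have key : ∀ m ∈ I, ∀ a,
      e m * u m (x a) = (blockGram H x m *ᵥ fun a => evalSum (f - u) (x a)) a := by
    intro m hm a
    set h : PiLp 2 H := PiLp.single 2 m (blockFeature H m (x a)) with hh
    have hm' : h m = blockFeature H m (x a) := by simp [hh]
    have hk : ∀ k, k ≠ m → h k = 0 := fun k hk => by simp [hh, hk]
    have h1 := hu.eq h fun k hkI => hk k fun hkm => hkI (hkm ▸ hm)
    rw [Finset.sum_eq_single m (fun k _ hkm => by rw [hk k hkm, inner_zero_left, mul_zero])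
      (by simp), hm', inner_blockFeature] at h1
    have h2 : ⟪h, empCov H x (f - u)⟫ = e m * u m (x a) := by
      rw [map_sub, inner_sub_right, ← h1]; ring
    rw [← h2, inner_empCov]
    simp only [mulVec, dotProduct, blockGram, Matrix.of_apply, Finset.mul_sum]
    refine Finset.sum_congr rfl fun b _ => ?_
    have h3 : evalSum h (x b) = ⟪blockFeature H m (x a), blockFeature H m (x b)⟫ := by
      rw [evalSum, Finset.sum_eq_single m (fun k _ hkm => by rw [hk k hkm]; simp) (by simp), hm',
        ← inner_blockFeature, real_inner_comm]
    rw [h3]; ring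
  ext a
  have h1 : evalSum u (x a)
      = ∑ m ∈ I, (e m)⁻¹ * (blockGram H x m *ᵥ fun a => evalSum (f - u) (x a)) a := by
    rw [evalSum, ← Finset.sum_subset (Finset.subset_univ I) fun m _ hm => by
      rw [hu.supp m hm]; simp]
    refine Finset.sum_congr rfl fun m hm => ?_
    rw [← key m hm, inv_mul_cancel_left₀ (he m hm).ne']
  simp only [Pi.add_apply, Finset.sum_apply, Pi.smul_apply, smul_eq_mul]
  rw [← h1, evalSum_sub, sub_add_cancel]

theorem norm_blockFeature_le [MeasurableSpace 𝒳] (hB : SeparableBoundedKernels (𝒳 := 𝒳) H) (m : ι)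
    (x : 𝒳) : ‖blockFeature H m x‖ ≤ 1 := by
  have h1 := (le_abs_self _).trans (abs_apply_le_norm hB m (blockFeature H m x) x)
  rw [← inner_blockFeature, real_inner_self_eq_norm_sq, sq] at h1
  rcases (norm_nonneg (blockFeature H m x)).eq_or_lt with h | h
  · rw [← h]; exact zero_le_one
  · exact le_of_mul_le_mul_right (by linarith) h

theorem norm_feature_sq_le [MeasurableSpace 𝒳] (hB : SeparableBoundedKernels (𝒳 := 𝒳) H) (x : 𝒳) :
    ‖feature H x‖ ^ 2 ≤ Fintype.card ι := by
  rw [norm_sq_eq_sum]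
  calc ∑ m, ‖feature H x m‖ ^ 2 ≤ ∑ _m : ι, (1 : ℝ) := Finset.sum_le_sum fun m _ =>
        pow_le_one₀ (norm_nonneg _) (norm_blockFeature_le hB m x)
    _ = _ := by simp

end Sample

end MKL

namespace MKL

/-! ### A perturbation bound uniform over penalty weights -/

section Neumann

open Matrix

variable {n : ℕ} {ι : Type*}

theorem dotProduct_mulVec_comm {A : Matrix (Fin n) (Fin n) ℝ} (hA : A.PosSemidef)
    (c d : Fin n → ℝ) : c ⬝ᵥ A *ᵥ d = d ⬝ᵥ A *ᵥ c := by
  have h : Aᵀ = A := by simpa using hA.isHermitian.eq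
  rw [dotProduct_mulVec, ← mulVec_transpose, h, dotProduct_comm]

theorem dotProduct_mulVec_self_nonneg {A : Matrix (Fin n) (Fin n) ℝ} (hA : A.PosSemidef)
    (c : Fin n → ℝ) : 0 ≤ c ⬝ᵥ A *ᵥ c := by
  simpa using hA.dotProduct_mulVec_nonneg c

theorem dotProduct_mulVec_sq_le {A : Matrix (Fin n) (Fin n) ℝ} (hA : A.PosSemidef)
    (c d : Fin n → ℝ) : (c ⬝ᵥ A *ᵥ d) ^ 2 ≤ (c ⬝ᵥ A *ᵥ c) * (d ⬝ᵥ A *ᵥ d) := by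
  refine sq_le_mul_of_quadratic_nonneg fun s => ?_
  have h := dotProduct_mulVec_self_nonneg hA (c + s • d)
  simp only [mulVec_add, mulVec_smul, dotProduct_add, add_dotProduct, dotProduct_smul,
    smul_dotProduct, smul_eq_mul, dotProduct_mulVec_comm hA d c] at h
  linarith

/-- The inverse of the regularized Gram matrix `1 + ∑ X l`. -/
noncomputable def resolvent (I : Finset ι) (X : ι → Matrix (Fin n) (Fin n) ℝ) :
    Matrix (Fin n) (Fin n) ℝ :=
  (1 + ∑ l ∈ I, X l)⁻¹

variable {I : Finset ι} {X : ι → Matrix (Fin n) (Fin n) ℝ}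

theorem posSemidef_sum_mem (hX : ∀ l, (X l).PosSemidef) (I : Finset ι) :
    (∑ l ∈ I, X l).PosSemidef :=
  Matrix.posSemidef_sum I fun l _ => hX l

theorem posDef_one_add (hX : ∀ l, (X l).PosSemidef) : (1 + ∑ l ∈ I, X l).PosDef :=
  Matrix.PosDef.one.add_posSemidef (posSemidef_sum_mem hX I)

theorem mulVec_resolvent (hX : ∀ l, (X l).PosSemidef) (c : Fin n → ℝ) :
    (1 + ∑ l ∈ I, X l) *ᵥ (resolvent I X *ᵥ c) = c := by
  rw [mulVec_mulVec, resolvent, Matrix.mul_nonsing_inv _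
    ((Matrix.isUnit_iff_isUnit_det _).1 (posDef_one_add hX).isUnit), one_mulVec]

/-- The form of the resolvent, in terms of the solution `y` of the regularized system. -/
theorem dotProduct_resolvent (hX : ∀ l, (X l).PosSemidef) (c : Fin n → ℝ) :
    c ⬝ᵥ resolvent I X *ᵥ c = (resolvent I X *ᵥ c) ⬝ᵥ (1 + ∑ l ∈ I, X l) *ᵥ
      (resolvent I X *ᵥ c) := by
  rw [mulVec_resolvent hX, dotProduct_comm]

theorem dotProduct_one_add (y z : Fin n → ℝ) : y ⬝ᵥ (1 + ∑ l ∈ I, X l) *ᵥ z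
    = y ⬝ᵥ z + ∑ l ∈ I, y ⬝ᵥ X l *ᵥ z := by
  rw [add_mulVec, one_mulVec, dotProduct_add, Matrix.sum_mulVec, dotProduct_sum]

theorem norm_resolvent_le (hX : ∀ l, (X l).PosSemidef) (c : Fin n → ℝ) :
    (resolvent I X *ᵥ c) ⬝ᵥ (resolvent I X *ᵥ c) ≤ c ⬝ᵥ resolvent I X *ᵥ c := by
  rw [dotProduct_resolvent hX, dotProduct_one_add]
  exact le_add_of_nonneg_right
    (Finset.sum_nonneg fun l _ => dotProduct_mulVec_self_nonneg (hX l) _)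

theorem dotProduct_self_nonneg' (c : Fin n → ℝ) : 0 ≤ c ⬝ᵥ c :=
  Finset.sum_nonneg fun _ _ => mul_self_nonneg _

theorem dotProduct_sq_le (c d : Fin n → ℝ) : (c ⬝ᵥ d) ^ 2 ≤ (c ⬝ᵥ c) * (d ⬝ᵥ d) := by
  simpa [dotProduct, sq] using Finset.sum_mul_sq_le_sq_mul_sq Finset.univ c d

theorem resolvent_form_nonneg (hX : ∀ l, (X l).PosSemidef) (c : Fin n → ℝ) :
    0 ≤ c ⬝ᵥ resolvent I X *ᵥ c :=
  (dotProduct_self_nonneg' _).trans (norm_resolvent_le hX c)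

theorem resolvent_form_le (hX : ∀ l, (X l).PosSemidef) (c : Fin n → ℝ) :
    c ⬝ᵥ resolvent I X *ᵥ c ≤ c ⬝ᵥ c := by
  have h1 := dotProduct_sq_le c (resolvent I X *ᵥ c)
  have h2 := norm_resolvent_le (I := I) hX c
  have h3 := resolvent_form_nonneg (I := I) hX c
  have h4 := dotProduct_self_nonneg' c
  rcases h3.eq_or_lt with h5 | h5
  · rw [← h5]; exact h4
  · nlinarith [mul_le_mul_of_nonneg_left h2 h4]

theorem le_one_add_form {l : ι} (hX : ∀ l, (X l).PosSemidef) (hl : l ∈ I) (y : Fin n → ℝ) :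
    y ⬝ᵥ X l *ᵥ y ≤ y ⬝ᵥ (1 + ∑ l ∈ I, X l) *ᵥ y := by
  rw [dotProduct_one_add]
  have := Finset.single_le_sum (f := fun l => y ⬝ᵥ X l *ᵥ y)
    (fun k _ => dotProduct_mulVec_self_nonneg (hX k) y) hl
  have h2 := dotProduct_self_nonneg' y
  linarith

/-- One step of the Neumann series does not increase the form of the resolvent. -/
theorem resolvent_form_step_le {l : ι} (hX : ∀ l, (X l).PosSemidef) (hl : l ∈ I)
    (c : Fin n → ℝ) :
    (X l *ᵥ (resolvent I X *ᵥ c)) ⬝ᵥ resolvent I X *ᵥ (X l *ᵥ (resolvent I X *ᵥ c))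
      ≤ c ⬝ᵥ resolvent I X *ᵥ c := by
  set b := resolvent I X *ᵥ c with hb
  set y := resolvent I X *ᵥ (X l *ᵥ b) with hy
  have h1 : (X l *ᵥ b) ⬝ᵥ y = b ⬝ᵥ X l *ᵥ y := by
    rw [dotProduct_mulVec_comm (hX l), dotProduct_comm]
  have h2 := dotProduct_mulVec_sq_le (hX l) b y
  have h3 : y ⬝ᵥ X l *ᵥ y ≤ (X l *ᵥ b) ⬝ᵥ y := by
    rw [hy, dotProduct_resolvent hX, ← hy]
    exact le_one_add_form hX hl y
  have h4 : b ⬝ᵥ X l *ᵥ b ≤ c ⬝ᵥ b := by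
    rw [hb, dotProduct_resolvent hX, ← hb]
    exact le_one_add_form hX hl b
  have h5 := dotProduct_mulVec_self_nonneg (hX l) b
  rw [h1] at h3 ⊢
  have h6 : 0 ≤ b ⬝ᵥ X l *ᵥ y := by
    rw [← h1, hy]; exact resolvent_form_nonneg hX _
  rcases h6.eq_or_lt with h7 | h7
  · rw [← h7]; exact h5.trans h4
  · nlinarith [mul_le_mul_of_nonneg_left h3 h5]

/-- The bound for the `k`-th order terms of the Neumann series of a linear functional `c`, summed
over all words in the index set. It uses `√s ≤ (s + 1) / 2` for the form of `K`, so that it is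
polynomial in `c`. -/
noncomputable def neumannBound (I : Finset ι) (X : ι → Matrix (Fin n) (Fin n) ℝ)
    (K : Matrix (Fin n) (Fin n) ℝ) : ℕ → (Fin n → ℝ) → ℝ
  | 0, c => ((resolvent I X *ᵥ c) ⬝ᵥ K *ᵥ (resolvent I X *ᵥ c) + 1) / 2
  | k + 1, c => ∑ l ∈ I, neumannBound I X K k (X l *ᵥ (resolvent I X *ᵥ c))

/-- The solution `r` of a perturbed system `(1 + ∑ (1 + t l) X l) r = a`, tested against `c`. -/
theorem abs_dotProduct_le_neumann (hX : ∀ l, (X l).PosSemidef) {K : Matrix (Fin n) (Fin n) ℝ}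
    {t : ι → ℝ} {τ F ρ : ℝ} (hρ : 0 ≤ ρ) (hτ : 0 ≤ τ) (ht : ∀ l ∈ I, |t l| ≤ τ)
    {a r : Fin n → ℝ}
    (hr : (1 + ∑ l ∈ I, X l) *ᵥ r + ∑ l ∈ I, t l • (X l *ᵥ r) = a)
    (ha : ∀ d, |d ⬝ᵥ a| ≤ F * ((d ⬝ᵥ K *ᵥ d + 1) / 2))
    (hrem : ∀ c, |c ⬝ᵥ r| ≤ ρ * √(c ⬝ᵥ resolvent I X *ᵥ c)) (k : ℕ) (c : Fin n → ℝ) :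
    |c ⬝ᵥ r| ≤ F * ∑ j ∈ Finset.range k, τ ^ j * neumannBound I X K j c
      + (τ * I.card) ^ k * (ρ * √(c ⬝ᵥ resolvent I X *ᵥ c)) := by
  induction k generalizing c with
  | zero => simpa using hrem c
  | succ k ih =>
    set b := resolvent I X *ᵥ c with hb
    have h1 : c ⬝ᵥ r = b ⬝ᵥ (1 + ∑ l ∈ I, X l) *ᵥ r := by
      rw [dotProduct_mulVec_comm (posDef_one_add hX).posSemidef, hb, mulVec_resolvent hX,
        dotProduct_comm]
    have h2 : c ⬝ᵥ r = b ⬝ᵥ a - ∑ l ∈ I, t l * ((X l *ᵥ b) ⬝ᵥ r) := by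
      rw [h1, ← hr, dotProduct_add, dotProduct_sum]
      have : ∀ l, b ⬝ᵥ t l • (X l *ᵥ r) = t l * ((X l *ᵥ b) ⬝ᵥ r) := fun l => by
        rw [dotProduct_smul, smul_eq_mul, dotProduct_mulVec_comm (hX l), dotProduct_comm r]
      simp only [this]
      ring
    have h3 : |∑ l ∈ I, t l * ((X l *ᵥ b) ⬝ᵥ r)|
        ≤ ∑ l ∈ I, τ * (F * ∑ j ∈ Finset.range k, τ ^ j * neumannBound I X K j (X l *ᵥ b)
          + (τ * I.card) ^ k * (ρ * √(c ⬝ᵥ b))) := by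
      refine (Finset.abs_sum_le_sum_abs _ _).trans (Finset.sum_le_sum fun l hl => ?_)
      rw [abs_mul]
      refine mul_le_mul (ht l hl) ((ih _).trans ?_) (abs_nonneg _) hτ
      gcongr
      exact resolvent_form_step_le hX hl c
    have h4 : |c ⬝ᵥ r| ≤ |b ⬝ᵥ a| + |∑ l ∈ I, t l * ((X l *ᵥ b) ⬝ᵥ r)| := by
      rw [h2]; exact abs_sub _ _
    have h5 := ha b
    refine (h4.trans (add_le_add h5 h3)).trans_eq ?_
    have h6 : ∀ j, τ ^ (j + 1) * neumannBound I X K (j + 1) c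
        = ∑ l ∈ I, τ * (τ ^ j * neumannBound I X K j (X l *ᵥ b)) := fun j => by
      rw [neumannBound, Finset.mul_sum]
      exact Finset.sum_congr rfl fun l _ => by rw [pow_succ]; ring
    have h7 : neumannBound I X K 0 c = (b ⬝ᵥ K *ᵥ b + 1) / 2 := rfl
    rw [Finset.sum_range_succ']
    simp only [h6, h7, mul_add, Finset.sum_add_distrib, Finset.sum_const, nsmul_eq_mul]
    rw [Finset.sum_comm]
    simp only [Finset.mul_sum]
    have h8 : ∀ l j, τ * (F * (τ ^ j * neumannBound I X K j (X l *ᵥ b)))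
        = F * (τ * (τ ^ j * neumannBound I X K j (X l *ᵥ b))) := fun l j => by ring
    simp only [h8, pow_succ, pow_zero]
    ring

/-- The remainder of the Neumann series: perturbed solutions are bounded in the form of the
unperturbed system. -/
theorem abs_dotProduct_le_of_perturbed (hX : ∀ l, (X l).PosSemidef)
    {t : ι → ℝ} (ht : ∀ l ∈ I, |t l| ≤ 1 / 2) {a r : Fin n → ℝ}
    (hr : (1 + ∑ l ∈ I, X l) *ᵥ r + ∑ l ∈ I, t l • (X l *ᵥ r) = a) (c : Fin n → ℝ) :
    |c ⬝ᵥ r| ≤ (2 * √(a ⬝ᵥ a)) * √(c ⬝ᵥ resolvent I X *ᵥ c) := by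
  set b := resolvent I X *ᵥ c with hb
  set M := 1 + ∑ l ∈ I, X l with hM
  have hMp : M.PosSemidef := (posDef_one_add hX).posSemidef
  have h1 : c ⬝ᵥ r = b ⬝ᵥ M *ᵥ r := by
    rw [dotProduct_mulVec_comm hMp, hb, hM, mulVec_resolvent hX, dotProduct_comm]
  have h2 := dotProduct_mulVec_sq_le hMp b r
  rw [← h1] at h2
  have h3 : b ⬝ᵥ M *ᵥ b = c ⬝ᵥ b := by rw [hb, dotProduct_resolvent hX]
  have h4 : r ⬝ᵥ a = r ⬝ᵥ r + ∑ l ∈ I, (1 + t l) * (r ⬝ᵥ X l *ᵥ r) := by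
    rw [← hr, dotProduct_add, hM, dotProduct_one_add, dotProduct_sum, add_assoc,
      ← Finset.sum_add_distrib]
    congr 1
    exact Finset.sum_congr rfl fun l _ => by rw [dotProduct_smul, smul_eq_mul]; ring
  have h5 : r ⬝ᵥ M *ᵥ r ≤ 2 * (r ⬝ᵥ a) := by
    rw [h4, hM, dotProduct_one_add, mul_add, Finset.mul_sum]
    refine add_le_add (by linarith [dotProduct_self_nonneg' r]) (Finset.sum_le_sum fun l hl => ?_)
    have := (abs_le.1 (ht l hl)).1
    nlinarith [dotProduct_mulVec_self_nonneg (hX l) r]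
  have h6 : r ⬝ᵥ r ≤ 2 * (r ⬝ᵥ a) := by
    refine le_trans ?_ h5
    rw [hM, dotProduct_one_add]
    exact le_add_of_nonneg_right
      (Finset.sum_nonneg fun l _ => dotProduct_mulVec_self_nonneg (hX l) _)
  have h7 := dotProduct_sq_le r a
  have h8 := dotProduct_self_nonneg' a
  have h9 : r ⬝ᵥ M *ᵥ r ≤ 4 * (a ⬝ᵥ a) := by
    rcases le_or_gt (r ⬝ᵥ a) 0 with h | h
    · linarith
    · nlinarith
  have h10 : (c ⬝ᵥ r) ^ 2 ≤ (2 ^ 2 * (a ⬝ᵥ a)) * (c ⬝ᵥ b) := by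
    have := mul_le_mul_of_nonneg_left h9 (dotProduct_mulVec_self_nonneg hMp b)
    rw [h3] at this h2
    linarith
  refine (Real.abs_le_sqrt h10).trans_eq ?_
  rw [Real.sqrt_mul (by positivity), Real.sqrt_mul (by norm_num), Real.sqrt_sq (by norm_num)]

end Neumann

end MKL

namespace MKL

/-! ### Concentration of the empirical covariance operator -/

section Covariance

theorem exists_countable_hilbertBasis (E : Type*) [NormedAddCommGroup E] [InnerProductSpace ℝ E]
    [CompleteSpace E] [TopologicalSpace.SeparableSpace E] :
    ∃ s : Set E, s.Countable ∧ Nonempty (HilbertBasis s ℝ E) := by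
  obtain ⟨s, b, hb⟩ := exists_hilbertBasis ℝ E
  refine ⟨s, Set.PairwiseDisjoint.countable_of_isOpen (s := fun v : E => Metric.ball v (1 / 2))
    (fun v hv w hw hvw => Metric.ball_disjoint_ball ?_) (fun v _ => Metric.isOpen_ball)
    (fun v _ => ⟨v, Metric.mem_ball_self (by norm_num)⟩), ⟨b⟩⟩
  have h1 : ‖v‖ = 1 := by
    have := b.orthonormal.1 ⟨v, hv⟩
    rwa [hb] at this
  have h2 : ⟪v, w⟫ = 0 := by
    have := b.orthonormal.2 (i := ⟨v, hv⟩) (j := ⟨w, hw⟩) (by simpa using hvw)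
    rwa [hb] at this
  have h3 : ‖v - w‖ ^ 2 = ‖v‖ ^ 2 - 2 * ⟪v, w⟫ + ‖w‖ ^ 2 := norm_sub_sq_real v w
  rw [h1, h2] at h3
  rw [dist_eq_norm]
  nlinarith [norm_nonneg (v - w), sq_nonneg ‖w‖]

variable {E : Type*} [NormedAddCommGroup E] [InnerProductSpace ℝ E]

/-- Weak measurability suffices for inner products in a separable Hilbert space. -/
theorem measurable_inner_of_weak [CompleteSpace E] [TopologicalSpace.SeparableSpace E]
    {Z : Type*} [MeasurableSpace Z] {φ ψ : Z → E} (hφ : ∀ v, Measurable fun z => ⟪φ z, v⟫)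
    (hψ : ∀ v, Measurable fun z => ⟪ψ z, v⟫) : Measurable fun z => ⟪φ z, ψ z⟫ := by
  obtain ⟨s, hs, ⟨b⟩⟩ := exists_countable_hilbertBasis E
  have : Countable s := hs
  refine measurable_of_tendsto_metrizable' (u := (atTop : Filter (Finset s)))
    (f := fun t z => ∑ i ∈ t, ⟪φ z, b i⟫ * ⟪b i, ψ z⟫) (fun t => ?_)
    (tendsto_pi_nhds.2 fun z => b.hasSum_inner_mul_inner (φ z) (ψ z))
  refine Finset.measurable_fun_sum t fun i _ => (hφ _).mul ?_
  simpa only [real_inner_comm] using hψ (b i)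

theorem ofReal_norm_sq_eq_tsum {s : Type*} (b : HilbertBasis s ℝ E) (v : E) :
    ENNReal.ofReal (‖v‖ ^ 2) = ∑' i, ENNReal.ofReal (⟪v, b i⟫ ^ 2) := by
  have h := b.hasSum_inner_mul_inner v v
  have h2 : ∀ i, ⟪v, b i⟫ * ⟪b i, v⟫ = ⟪v, b i⟫ ^ 2 := fun i => by
    rw [real_inner_comm, sq]
  simp only [h2, real_inner_self_eq_norm_sq] at h
  rw [← h.tsum_eq, ENNReal.ofReal_tsum_of_nonneg (fun i => sq_nonneg _) h.summable]

/-- The operator norm is at most the Hilbert–Schmidt norm. -/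
theorem ofReal_opNorm_sq_le_tsum [CompleteSpace E] {s : Type*} (b : HilbertBasis s ℝ E)
    (T : E →L[ℝ] E) :
    ENNReal.ofReal (‖T‖ ^ 2) ≤ ∑' i, ∑' j, ENNReal.ofReal (⟪b i, T (b j)⟫ ^ 2) := by
  set S := ∑' i, ∑' j, ENNReal.ofReal (⟪b i, T (b j)⟫ ^ 2) with hS
  rcases eq_or_ne S ⊤ with h | h
  · rw [h]; exact le_top
  have hS' : S = ∑' i, ENNReal.ofReal (‖ContinuousLinearMap.adjoint T (b i)‖ ^ 2) := by
    refine tsum_congr fun i => ?_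
    rw [ofReal_norm_sq_eq_tsum b]
    simp only [ContinuousLinearMap.adjoint_inner_left]
  have key : ∀ v, ENNReal.ofReal (‖T v‖ ^ 2) ≤ S * ENNReal.ofReal (‖v‖ ^ 2) := by
    intro v
    rw [ofReal_norm_sq_eq_tsum b, hS', ← ENNReal.tsum_mul_right]
    refine ENNReal.tsum_le_tsum fun i => ?_
    rw [← ENNReal.ofReal_mul (by positivity), ← mul_pow, ← ContinuousLinearMap.adjoint_inner_right,
      real_inner_comm, ← sq_abs]
    exact ENNReal.ofReal_le_ofReal (pow_le_pow_left₀ (abs_nonneg _) (abs_real_inner_le_norm _ _) 2)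
  have h2 : ‖T‖ ≤ √S.toReal := by
    refine T.opNorm_le_bound (Real.sqrt_nonneg _) fun v => ?_
    refine le_of_sq_le_sq ?_ (by positivity)
    rw [mul_pow, Real.sq_sqrt ENNReal.toReal_nonneg]
    have := ENNReal.toReal_mono (ENNReal.mul_ne_top h ENNReal.ofReal_ne_top) (key v)
    rwa [ENNReal.toReal_mul, ENNReal.toReal_ofReal (by positivity),
      ENNReal.toReal_ofReal (by positivity)] at this
  refine ENNReal.ofReal_le_of_le_toReal ?_
  rw [← Real.sq_sqrt (ENNReal.toReal_nonneg (a := S))]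
  exact pow_le_pow_left₀ (norm_nonneg _) h2 2

variable {Z : Type*} [MeasurableSpace Z]

/-- The variance of a sample mean. -/
theorem lintegral_sq_mean_sub_le (P : Measure Z) [IsProbabilityMeasure P] {g : Z → ℝ}
    (hg : Measurable g) {c : ℝ} (hc : ∀ z, |g z| ≤ c) {n : ℕ} (hn : n ≠ 0) :
    ∫⁻ z, ENNReal.ofReal ((1 / (n : ℝ) * ∑ i, g (z i) - ∫ y, g y ∂P) ^ 2)
        ∂Measure.pi (fun _ : Fin n => P)
      ≤ ENNReal.ofReal (1 / n) * ∫⁻ y, ENNReal.ofReal (g y ^ 2) ∂P := by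
  have hL : MemLp g 2 P := MemLp.of_bound hg.aestronglyMeasurable c (.of_forall hc)
  set π := Measure.pi (fun _ : Fin n => P) with hπ
  set S : (Fin n → Z) → ℝ := ∑ i, fun z => g (z i) with hS
  have hSi : ∀ i : Fin n, MemLp (fun z : Fin n → Z => g (z i)) 2 π := fun i =>
    hL.comp_measurePreserving (measurePreserving_eval (fun _ : Fin n => P) i)
  have hSL : MemLp S 2 π := memLp_finsetSum' _ fun i _ => hSi i
  have hY : MemLp (fun z => 1 / (n : ℝ) * S z) 2 π := hSL.const_mul _
  have hVar : Var[fun z => 1 / (n : ℝ) * S z; π] = 1 / n * Var[g; P] := by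
    rw [variance_const_mul, hS, hπ, variance_sum_pi fun _ => hL]
    simp only [Finset.sum_const, Finset.card_univ, Fintype.card_fin, nsmul_eq_mul]
    field_simp
  have hmean : ∫ z, 1 / (n : ℝ) * S z ∂π = ∫ y, g y ∂P := by
    rw [integral_const_mul]
    have h1 : ∫ z, S z ∂π = ∑ i : Fin n, ∫ z, g (z i) ∂π := by
      rw [hS, ← integral_finsetSum _ fun i _ => (hSi i).integrable (by norm_num)]
      simp
    have h2 : ∀ i : Fin n, ∫ z, g (z i) ∂π = ∫ y, g y ∂P := fun i => by
      have hp := measurePreserving_eval (fun _ : Fin n => P) i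
      rw [← hp.map_eq, integral_map hp.aemeasurable hg.aestronglyMeasurable]
    rw [h1]
    simp only [h2, Finset.sum_const, Finset.card_univ, Fintype.card_fin, nsmul_eq_mul]
    field_simp
  have h3 := evariance_eq_lintegral_ofReal (fun z => 1 / (n : ℝ) * S z) π
  rw [hmean, ← ofReal_variance hY, hVar] at h3
  have h4 : ∀ z, S z = ∑ i, g (z i) := fun z => by simp [hS]
  simp only [h4] at h3
  rw [← h3, ENNReal.ofReal_mul (by positivity)]
  gcongr
  rw [← ofReal_integral_eq_lintegral_ofReal hL.integrable_sq (.of_forall fun _ => sq_nonneg _)]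
  exact ENNReal.ofReal_le_ofReal (variance_le_expectation_sq hg.aestronglyMeasurable)

/-- The mean squared error of the empirical covariance of bounded features is of order `1 / n`. -/
theorem exists_cov_error_bound [CompleteSpace E] [TopologicalSpace.SeparableSpace E]
    (P : Measure Z) [IsProbabilityMeasure P] {φ : Z → E}
    (hφ : ∀ v, Measurable fun z => ⟪φ z, v⟫) {κ : ℝ} (hκ : ∀ z, ‖φ z‖ ^ 2 ≤ κ)
    {C : E →L[ℝ] E} (hC : ∀ f g, ⟪f, C g⟫ = ∫ z, ⟪φ z, f⟫ * ⟪φ z, g⟫ ∂P)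
    {n : ℕ} (hn : n ≠ 0) {T : (Fin n → Z) → E →L[ℝ] E}
    (hT : ∀ z f g, ⟪f, T z g⟫ = 1 / (n : ℝ) * ∑ i, ⟪φ (z i), f⟫ * ⟪φ (z i), g⟫) :
    ∃ S : (Fin n → Z) → ℝ≥0∞, Measurable S ∧ (∀ z, ENNReal.ofReal (‖T z - C‖ ^ 2) ≤ S z) ∧
      ∫⁻ z, S z ∂Measure.pi (fun _ => P) ≤ ENNReal.ofReal (κ ^ 2 / n) := by
  obtain ⟨s, hs, ⟨b⟩⟩ := exists_countable_hilbertBasis E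
  have : Countable s := hs
  have hg : ∀ i j, Measurable fun z => ⟪φ z, b i⟫ * ⟪φ z, b j⟫ := fun i j =>
    (hφ _).mul (hφ _)
  have hgn : ∀ i j, Measurable fun z : Fin n → Z =>
      1 / (n : ℝ) * ∑ k, ⟪φ (z k), b i⟫ * ⟪φ (z k), b j⟫ := fun i j =>
    (Finset.measurable_fun_sum _ fun k _ => (hg i j).comp (measurable_pi_apply k)).const_mul _
  have hb : ∀ z i, |⟪φ z, b i⟫| ≤ ‖φ z‖ := fun z i => by
    refine (abs_real_inner_le_norm _ _).trans_eq ?_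
    rw [b.orthonormal.1 i, mul_one]
  have hbd : ∀ i j z, |⟪φ z, b i⟫ * ⟪φ z, b j⟫| ≤ κ := fun i j z => by
    rw [abs_mul]
    refine le_trans ?_ (hκ z)
    rw [sq]
    exact mul_le_mul (hb z i) (hb z j) (abs_nonneg _) (norm_nonneg _)
  have hm : ∀ i j, Measurable fun z : Fin n → Z =>
      ENNReal.ofReal (⟪b i, (T z - C) (b j)⟫ ^ 2) := fun i j => by
    simp only [sub_apply, inner_sub_right, hT, hC]
    exact (((hgn i j).sub_const _).pow_const 2).ennreal_ofReal
  refine ⟨fun z => ∑' i, ∑' j, ENNReal.ofReal (⟪b i, (T z - C) (b j)⟫ ^ 2),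
    Measurable.tsum fun i => Measurable.tsum fun j => hm i j,
    fun z => ofReal_opNorm_sq_le_tsum b _, ?_⟩
  rw [lintegral_tsum fun i => (Measurable.tsum fun j => hm i j).aemeasurable]
  simp_rw [lintegral_tsum fun j => (hm _ j).aemeasurable]
  calc ∑' i, ∑' j, ∫⁻ z, ENNReal.ofReal (⟪b i, (T z - C) (b j)⟫ ^ 2) ∂Measure.pi (fun _ => P)
      ≤ ∑' i, ∑' j, ENNReal.ofReal (1 / n) *
          ∫⁻ y, ENNReal.ofReal ((⟪φ y, b i⟫ * ⟪φ y, b j⟫) ^ 2) ∂P := by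
        refine ENNReal.tsum_le_tsum fun i => ENNReal.tsum_le_tsum fun j => ?_
        simp only [sub_apply, inner_sub_right, hT, hC]
        exact lintegral_sq_mean_sub_le P (hg i j) (hbd i j) hn
    _ = ENNReal.ofReal (1 / n) * ∫⁻ y, ENNReal.ofReal (‖φ y‖ ^ 2) * ENNReal.ofReal (‖φ y‖ ^ 2) ∂P := by
        simp_rw [ENNReal.tsum_mul_left, mul_pow, ENNReal.ofReal_mul (sq_nonneg _)]
        congr 1
        have h1 : ∀ i j, Measurable fun y =>
            ENNReal.ofReal (⟪φ y, b i⟫ ^ 2) * ENNReal.ofReal (⟪φ y, b j⟫ ^ 2) := fun i j =>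
          ((hφ _).pow_const 2).ennreal_ofReal.mul ((hφ _).pow_const 2).ennreal_ofReal
        simp_rw [← lintegral_tsum fun j => (h1 _ j).aemeasurable]
        rw [← lintegral_tsum fun i => (Measurable.tsum fun j => h1 i j).aemeasurable]
        refine lintegral_congr fun y => ?_
        simp_rw [ENNReal.tsum_mul_left, ENNReal.tsum_mul_right, ← ofReal_norm_sq_eq_tsum b]
    _ ≤ ENNReal.ofReal (1 / n) * ∫⁻ _y, ENNReal.ofReal κ * ENNReal.ofReal κ ∂P := by
        gcongr <;> exact hκ _
    _ ≤ ENNReal.ofReal (κ ^ 2 / n) := by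
        rcases isEmpty_or_nonempty Z with h | ⟨⟨z⟩⟩
        · have h0 : P = 0 := Measure.eq_zero_of_isEmpty P
          simp [h0]
        have h0 : 0 ≤ κ := (sq_nonneg _).trans (hκ z)
        rw [lintegral_const, measure_univ, mul_one, ← ENNReal.ofReal_mul h0,
          ← ENNReal.ofReal_mul (by positivity)]
        refine (congrArg ENNReal.ofReal ?_).le
        ring

end Covariance

end MKL

namespace MKL

/-! ### Quadratic forms in the noise -/

section NoiseForm

open Matrix
open scoped MatrixOrder

variable {n : ℕ}

theorem abs_entry_le_trace {G : Matrix (Fin n) (Fin n) ℝ} (hG : G.PosSemidef) (i j : Fin n) :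
    |G i j| ≤ G.trace := by
  have hd : ∀ k, 0 ≤ G k k := fun k => by
    simpa using dotProduct_mulVec_self_nonneg hG (Pi.single k 1)
  have ht : ∀ k, G k k ≤ G.trace := fun k =>
    Finset.single_le_sum (f := fun k => G k k) (fun k _ => hd k) (Finset.mem_univ k)
  have h := dotProduct_mulVec_sq_le hG (Pi.single i 1) (Pi.single j 1)
  simp only [single_one_dotProduct, mulVec_single_one, col_apply] at h
  refine abs_le_of_sq_le_sq (h.trans ?_) ((hd i).trans (ht i))
  rw [sq]
  exact mul_le_mul (ht i) (ht j) (hd j) ((hd i).trans (ht i))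

/-- Conjugation by a contraction does not increase the trace. -/
theorem trace_conj_le {K W : Matrix (Fin n) (Fin n) ℝ} (hK : K.PosSemidef)
    (hW : ∀ v, (W *ᵥ v) ⬝ᵥ (W *ᵥ v) ≤ v ⬝ᵥ v) : (Wᵀ * K * W).trace ≤ K.trace := by
  obtain ⟨B, rfl⟩ : ∃ B : Matrix (Fin n) (Fin n) ℝ, K = Bᴴ * B :=
    CStarAlgebra.nonneg_iff_eq_star_mul_self.1 hK.nonneg
  have hWT : ∀ v, (Wᵀ *ᵥ v) ⬝ᵥ (Wᵀ *ᵥ v) ≤ v ⬝ᵥ v := fun v => by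
    have h1 : (Wᵀ *ᵥ v) ⬝ᵥ (Wᵀ *ᵥ v) = v ⬝ᵥ W *ᵥ (Wᵀ *ᵥ v) := by
      rw [dotProduct_mulVec v, ← mulVec_transpose]
    have h2 := dotProduct_sq_le v (W *ᵥ (Wᵀ *ᵥ v))
    have h3 := hW (Wᵀ *ᵥ v)
    have h4 := dotProduct_self_nonneg' v
    rw [← h1] at h2
    rcases (dotProduct_self_nonneg' (Wᵀ *ᵥ v)).eq_or_lt with h | h
    · rw [← h]; exact h4
    · nlinarith [mul_le_mul_of_nonneg_left h3 h4]
  have h1 : (Wᵀ * (Bᴴ * B) * W).trace = ∑ i, (Wᵀ *ᵥ (B i)) ⬝ᵥ (Wᵀ *ᵥ (B i)) := by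
    have : Wᵀ * (Bᴴ * B) * W = (B * W)ᵀ * (B * W) := by
      rw [transpose_mul, conjTranspose_eq_transpose_of_trivial]; simp only [Matrix.mul_assoc]
    rw [this, trace_mul_comm, trace]
    refine Finset.sum_congr rfl fun i _ => ?_
    rw [mulVec_transpose]
    rfl
  have h2 : (Bᴴ * B).trace = ∑ i, (B i) ⬝ᵥ (B i) := by
    rw [conjTranspose_eq_transpose_of_trivial, trace_mul_comm, trace]
    rfl
  rw [h1, h2]
  exact Finset.sum_le_sum fun i _ => hWT _

section

variable {ι : Type*}

/-- The matrix of the quadratic part of `c ↦ 2 * neumannBound I X K k (W c)`. -/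
noncomputable def neumannForm (I : Finset ι) (X : ι → Matrix (Fin n) (Fin n) ℝ)
    (K : Matrix (Fin n) (Fin n) ℝ) : ℕ → Matrix (Fin n) (Fin n) ℝ → Matrix (Fin n) (Fin n) ℝ
  | 0, W => (resolvent I X * W)ᵀ * K * (resolvent I X * W)
  | k + 1, W => ∑ l ∈ I, neumannForm I X K k (X l * (resolvent I X * W))

variable {I : Finset ι} {X : ι → Matrix (Fin n) (Fin n) ℝ} {K : Matrix (Fin n) (Fin n) ℝ}

theorem neumannBound_mulVec (k : ℕ) (W : Matrix (Fin n) (Fin n) ℝ) (c : Fin n → ℝ) :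
    neumannBound I X K k (W *ᵥ c) = (c ⬝ᵥ neumannForm I X K k W *ᵥ c + (I.card : ℝ) ^ k) / 2 := by
  induction k generalizing W with
  | zero =>
    rw [neumannBound, neumannForm, pow_zero, Matrix.mul_assoc, ← mulVec_mulVec c,
      dotProduct_mulVec c, ← mulVec_transpose, transpose_transpose]
    simp only [mulVec_mulVec]
  | succ k ih =>
    rw [neumannBound, neumannForm, Matrix.sum_mulVec, dotProduct_sum]
    simp only [mulVec_mulVec, ih]
    rw [← Finset.sum_div, Finset.sum_add_distrib, Finset.sum_const, nsmul_eq_mul, pow_succ']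

theorem posSemidef_neumannForm (hK : K.PosSemidef) (k : ℕ) (W : Matrix (Fin n) (Fin n) ℝ) :
    (neumannForm I X K k W).PosSemidef := by
  induction k generalizing W with
  | zero =>
    rw [neumannForm, ← conjTranspose_eq_transpose_of_trivial]
    exact hK.conjTranspose_mul_mul_same _
  | succ k ih => exact posSemidef_sum _ fun l _ => ih _

theorem trace_neumannForm_le (hX : ∀ l, (X l).PosSemidef) (hK : K.PosSemidef) (k : ℕ)
    {W : Matrix (Fin n) (Fin n) ℝ}
    (hW : ∀ v, (W *ᵥ v) ⬝ᵥ resolvent I X *ᵥ (W *ᵥ v) ≤ v ⬝ᵥ v) :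
    (neumannForm I X K k W).trace ≤ (I.card : ℝ) ^ k * K.trace := by
  induction k generalizing W with
  | zero =>
    rw [pow_zero, one_mul]
    refine trace_conj_le hK fun v => ?_
    rw [← mulVec_mulVec]
    exact (norm_resolvent_le hX _).trans (hW v)
  | succ k ih =>
    rw [neumannForm, trace_sum]
    refine (Finset.sum_le_sum fun l hl => ih fun v => ?_).trans_eq ?_
    · rw [← mulVec_mulVec, ← mulVec_mulVec]
      exact (resolvent_form_step_le hX hl _).trans (hW v)
    · rw [Finset.sum_const, nsmul_eq_mul, pow_succ']; ring

/-- The matrix of the quadratic form controlling the Neumann series up to order `N`. -/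
noncomputable def noiseForm (I : Finset ι) (X : ι → Matrix (Fin n) (Fin n) ℝ)
    (K : Matrix (Fin n) (Fin n) ℝ) (τ : ℝ) (N : ℕ) : Matrix (Fin n) (Fin n) ℝ :=
  ∑ j ∈ Finset.range N, τ ^ j • neumannForm I X K j 1

theorem geom_half_le {q : ℝ} (hq : 0 ≤ q) (hq' : q ≤ 1 / 2) (N : ℕ) :
    ∑ j ∈ Finset.range N, q ^ j ≤ 2 := by
  have h := geom_sum_Ico_le_of_lt_one (m := 0) (n := N) hq (by linarith)
  rw [← Finset.range_eq_Ico, pow_zero] at h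
  refine h.trans ?_
  rw [div_le_iff₀ (by linarith)]
  linarith

theorem sum_neumannBound_le {τ : ℝ} (hτ : 0 ≤ τ) (hτI : τ * I.card ≤ 1 / 2) (N : ℕ)
    (c : Fin n → ℝ) : ∑ j ∈ Finset.range N, τ ^ j * neumannBound I X K j c
      ≤ (c ⬝ᵥ noiseForm I X K τ N *ᵥ c) / 2 + 1 := by
  have h : ∀ j, τ ^ j * neumannBound I X K j c
      = (c ⬝ᵥ (τ ^ j • neumannForm I X K j 1) *ᵥ c) / 2 + (τ * I.card) ^ j / 2 := fun j => by
    have := neumannBound_mulVec (I := I) (X := X) (K := K) j 1 c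
    rw [one_mulVec] at this
    rw [this, smul_mulVec, dotProduct_smul, smul_eq_mul, mul_pow]; ring
  simp only [h, Finset.sum_add_distrib, noiseForm, Matrix.sum_mulVec, dotProduct_sum,
    ← Finset.sum_div]
  linarith [geom_half_le (by positivity) hτI N]

theorem posSemidef_noiseForm (hK : K.PosSemidef) {τ : ℝ} (hτ : 0 ≤ τ) (N : ℕ) :
    (noiseForm I X K τ N).PosSemidef :=
  posSemidef_sum _ fun j _ => (posSemidef_neumannForm hK j 1).smul (pow_nonneg hτ j)

theorem trace_noiseForm_le (hX : ∀ l, (X l).PosSemidef) (hK : K.PosSemidef) {τ : ℝ} (hτ : 0 ≤ τ)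
    (hτI : τ * I.card ≤ 1 / 2) (N : ℕ) : (noiseForm I X K τ N).trace ≤ 2 * K.trace := by
  rw [noiseForm, trace_sum]
  calc ∑ j ∈ Finset.range N, (τ ^ j • neumannForm I X K j 1).trace
      ≤ ∑ j ∈ Finset.range N, (τ * I.card) ^ j * K.trace := Finset.sum_le_sum fun j _ => by
        rw [trace_smul, smul_eq_mul, mul_pow, mul_assoc]
        refine mul_le_mul_of_nonneg_left (trace_neumannForm_le hX hK j fun v => ?_)
          (pow_nonneg hτ j)
        rw [one_mulVec]
        exact resolvent_form_le hX v
    _ ≤ 2 * K.trace := by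
        rw [← Finset.sum_mul]
        exact mul_le_mul_of_nonneg_right (geom_half_le (by positivity) hτI N) hK.trace_nonneg

end

section Measurability

variable {Z : Type*} [MeasurableSpace Z]

theorem measurable_entry_mul {A B : Z → Matrix (Fin n) (Fin n) ℝ}
    (hA : ∀ i j, Measurable fun z => A z i j) (hB : ∀ i j, Measurable fun z => B z i j)
    (i j : Fin n) : Measurable fun z => (A z * B z) i j := by
  simp only [Matrix.mul_apply]
  exact Finset.measurable_fun_sum _ fun k _ => (hA i k).mul (hB k j)

theorem measurable_entry_sum {ι : Type*} (s : Finset ι) {A : ι → Z → Matrix (Fin n) (Fin n) ℝ}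
    (hA : ∀ l i j, Measurable fun z => A l z i j) (i j : Fin n) :
    Measurable fun z => (∑ l ∈ s, A l z) i j := by
  simp only [Matrix.sum_apply]
  exact Finset.measurable_fun_sum _ fun l _ => hA l i j

theorem measurable_det {A : Z → Matrix (Fin n) (Fin n) ℝ}
    (hA : ∀ i j, Measurable fun z => A z i j) : Measurable fun z => (A z).det := by
  simp only [Matrix.det_apply, Units.smul_def, zsmul_eq_mul]
  exact Finset.measurable_fun_sum _ fun σ _ =>
    (Finset.measurable_fun_prod _ fun i _ => hA _ _).const_mul _

theorem measurable_entry_inv {A : Z → Matrix (Fin n) (Fin n) ℝ}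
    (hA : ∀ i j, Measurable fun z => A z i j) (i j : Fin n) :
    Measurable fun z => (A z)⁻¹ i j := by
  simp only [Matrix.inv_def, Ring.inverse_eq_inv', Matrix.smul_apply, smul_eq_mul,
    Matrix.adjugate_apply]
  refine (measurable_det hA).inv.mul (measurable_det fun k l => ?_)
  simp only [Matrix.updateRow_apply]
  split_ifs
  · exact measurable_const
  · exact hA k l

theorem measurable_entry_noiseForm {ι : Type*} {I : Finset ι}
    {X : Z → ι → Matrix (Fin n) (Fin n) ℝ} (hX : ∀ l i j, Measurable fun z => X z l i j)
    {K : Z → Matrix (Fin n) (Fin n) ℝ} (hK : ∀ i j, Measurable fun z => K z i j) (τ : ℝ) (N : ℕ)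
    (i j : Fin n) : Measurable fun z => noiseForm I (X z) (K z) τ N i j := by
  have hQ : ∀ i j, Measurable fun z => resolvent I (X z) i j :=
    measurable_entry_inv fun i j => by
      simp only [Matrix.add_apply]
      exact (measurable_entry_sum I (fun l i j => hX l i j) i j).const_add _
  have hF : ∀ k {W : Z → Matrix (Fin n) (Fin n) ℝ}, (∀ i j, Measurable fun z => W z i j) →
      ∀ i j, Measurable fun z => neumannForm I (X z) (K z) k (W z) i j := by
    intro k
    induction k with
    | zero =>
      intro W hW
      have h := measurable_entry_mul hQ hW
      exact measurable_entry_mul (measurable_entry_mul (fun i j => h j i) hK) h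
    | succ k ih =>
      intro W hW
      exact measurable_entry_sum I fun l =>
        ih (measurable_entry_mul (hX l) (measurable_entry_mul hQ hW))
  refine measurable_entry_sum _ (fun k i j => ?_) i j
  simp only [Matrix.smul_apply]
  exact (hF k (W := fun _ => 1) (fun _ _ => measurable_const) i j).const_mul _

end Measurability

end NoiseForm

end MKL

namespace MKL

/-! ### Expectations over the sample -/

section Noise

variable {𝒳 : Type*} [MeasurableSpace 𝒳]

section Model

variable {ι : Type*} [Fintype ι] {H : ι → Type*}
  [∀ m, NormedAddCommGroup (H m)] [∀ m, InnerProductSpace ℝ (H m)] [∀ m, RKHS ℝ (H m) 𝒳 ℝ]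

theorem measurable_evalSum (hM : ∀ (m : ι) (f : H m), Measurable fun x : 𝒳 => f x)
    (f : PiLp 2 H) : Measurable fun x : 𝒳 => evalSum f x :=
  Finset.measurable_fun_sum _ fun m _ => hM m (f m)

/-- The noise is orthogonal to bounded functions of the covariate. -/
theorem RegressionModel.integral_noise_mul [∀ m, CompleteSpace (H m)]
    (hM : ∀ (m : ι) (f : H m), Measurable fun x : 𝒳 => f x)
    (hB : SeparableBoundedKernels (𝒳 := 𝒳) H) {P : Measure (𝒳 × ℝ)} [IsProbabilityMeasure P]
    {fstar : PiLp 2 H} (h : RegressionModel P fstar) {g : 𝒳 → ℝ} (hg : Measurable g) {c : ℝ}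
    (hc : ∀ x, |g x| ≤ c) : ∫ z, (z.2 - evalSum fstar z.1) * g z.1 ∂P = 0 := by
  obtain ⟨h1, -, L, hL⟩ := h
  have hm : MeasurableSpace.comap (Prod.fst : 𝒳 × ℝ → 𝒳) inferInstance
      ≤ Prod.instMeasurableSpace := measurable_fst.comap_le
  have hfst : Measurable[MeasurableSpace.comap (Prod.fst : 𝒳 × ℝ → 𝒳) inferInstance]
      (Prod.fst : 𝒳 × ℝ → 𝒳) := comap_measurable _
  have hfm : Measurable fun z : 𝒳 × ℝ => evalSum fstar z.1 :=
    (measurable_evalSum hM fstar).comp measurable_fst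
  have hfb : ∀ z : 𝒳 × ℝ, |evalSum fstar z.1| ≤ ∑ m, ‖fstar m‖ := fun z => abs_evalSum_le hB _ _
  have hfi : Integrable (fun z : 𝒳 × ℝ => evalSum fstar z.1) P :=
    Integrable.of_bound hfm.aestronglyMeasurable _ (.of_forall hfb)
  have hεi : Integrable (fun z : 𝒳 × ℝ => z.2 - evalSum fstar z.1) P :=
    Integrable.of_bound (measurable_snd.sub hfm).aestronglyMeasurable L hL
  have hyi : Integrable (fun z : 𝒳 × ℝ => z.2) P := by
    simpa [Pi.add_def] using hεi.add hfi
  have h2 : P[fun z => z.2 - evalSum fstar z.1 |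
      MeasurableSpace.comap Prod.fst inferInstance] =ᵐ[P] 0 := by
    have h3 := condExp_sub hyi hfi (MeasurableSpace.comap Prod.fst inferInstance)
    have h4 : P[fun z => evalSum fstar z.1 |
      MeasurableSpace.comap Prod.fst inferInstance] = fun z => evalSum fstar z.1 :=
      condExp_of_stronglyMeasurable hm
        (((measurable_evalSum hM fstar).comp hfst).stronglyMeasurable) hfi
    filter_upwards [h1, h3] with z hz1 hz3
    change (P[(fun z => z.2) - (fun z => evalSum fstar z.1) |
      MeasurableSpace.comap Prod.fst inferInstance]) z = 0
    rw [hz3, Pi.sub_apply, hz1, h4, sub_self]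
  have h5 := condExp_mul_of_stronglyMeasurable_right (m := MeasurableSpace.comap Prod.fst inferInstance) (μ := P)
    (f := fun z => z.2 - evalSum fstar z.1) (g := fun z => g z.1)
    ((hg.comp hfst).stronglyMeasurable)
    (hεi.mul_bdd (hg.comp measurable_fst).aestronglyMeasurable (.of_forall fun z => hc z.1)) hεi
  rw [← integral_condExp hm (f := fun z => (z.2 - evalSum fstar z.1) * g z.1)]
  refine integral_eq_zero_of_ae ?_
  filter_upwards [h2, h5] with z hz2 hz5
  refine hz5.trans ?_
  rw [Pi.mul_apply, hz2, Pi.zero_apply, zero_mul]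

end Model

variable {Z : Type*} [MeasurableSpace Z] {P : Measure Z} [IsProbabilityMeasure P]
  {ε : Z → ℝ} {p : Z → 𝒳} {L : ℝ}

theorem ae_pi_forall_abs_le (hL : ∀ᵐ z ∂P, |ε z| ≤ L) (n : ℕ) :
    ∀ᵐ z ∂Measure.pi (fun _ : Fin n => P), ∀ i, |ε (z i)| ≤ L :=
  ae_all_iff.2 fun i =>
    (measurePreserving_eval (fun _ : Fin n => P) i).quasiMeasurePreserving.ae hL

theorem integrable_noise_mul (hε : Measurable ε) (hL : ∀ᵐ z ∂P, |ε z| ≤ L) (hp : Measurable p)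
    {n : ℕ} (i j : Fin n) {g : (Fin n → 𝒳) → ℝ} (hg : Measurable g) {c : ℝ}
    (hc : ∀ x, |g x| ≤ c) :
    Integrable (fun z => ε (z i) * ε (z j) * g fun a => p (z a))
      (Measure.pi (fun _ : Fin n => P)) := by
  have hgm : Measurable fun z : Fin n → Z => g fun a => p (z a) :=
    hg.comp (measurable_pi_iff.2 fun a => hp.comp (measurable_pi_apply a))
  refine Integrable.of_bound (((hε.comp (measurable_pi_apply i)).mul
    (hε.comp (measurable_pi_apply j))).mul hgm).aestronglyMeasurable (L * L * c) ?_
  filter_upwards [ae_pi_forall_abs_le hL n] with z hz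
  have h0 : 0 ≤ L := (abs_nonneg _).trans (hz i)
  rw [Real.norm_eq_abs, abs_mul, abs_mul]
  exact mul_le_mul (mul_le_mul (hz i) (hz j) (abs_nonneg _) h0) (hc _) (abs_nonneg _)
    (mul_nonneg h0 h0)

/-- Noise terms of different observations are uncorrelated given all covariates. -/
theorem integral_noise_mul_noise (hε : Measurable ε) (hL : ∀ᵐ z ∂P, |ε z| ≤ L)
    (hp : Measurable p)
    (horth : ∀ g : 𝒳 → ℝ, Measurable g → ∀ c, (∀ x, |g x| ≤ c) → ∫ z, ε z * g (p z) ∂P = 0)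
    {n : ℕ} {i j : Fin n} (hij : i ≠ j) {g : (Fin n → 𝒳) → ℝ} (hg : Measurable g) {c : ℝ}
    (hc : ∀ x, |g x| ≤ c) :
    ∫ z, ε (z i) * ε (z j) * g (fun a => p (z a)) ∂Measure.pi (fun _ : Fin n => P) = 0 := by
  obtain _ | n := n
  · exact i.elim0
  have hmp := (measurePreserving_piFinSuccAbove (fun _ : Fin (n + 1) => P) i).symm
  have hint := integrable_noise_mul hε hL hp i j hg hc
  rw [← hmp.integral_comp' (g := fun z => ε (z i) * ε (z j) * g (fun a => p (z a)))]
  have hint' := hmp.integrable_comp_emb (MeasurableEquiv.measurableEmbedding _) |>.2 hint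
  refine (integral_prod_symm _ hint').trans ?_
  obtain ⟨k, rfl⟩ := Fin.exists_succAbove_eq hij.symm
  refine integral_eq_zero_of_ae (.of_forall fun z' => ?_)
  have h1 : ∀ z, (MeasurableEquiv.piFinSuccAbove (fun _ : Fin (n + 1) => Z) i).symm (z, z')
      = i.insertNth z z' := fun z => rfl
  have h2 : ∀ z, (fun a => p ((i.insertNth z z' : Fin (n + 1) → Z) a))
      = i.insertNth (p z) fun a => p (z' a) := fun z => by
    ext a
    refine Fin.succAboveCases i ?_ (fun b => ?_) a <;> simp
  simp only [Function.comp_apply, h1, h2, Fin.insertNth_apply_same, Fin.insertNth_apply_succAbove, Pi.zero_apply]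
  have h3 : ∀ z, ε z * ε (z' k) * g (i.insertNth (p z) fun a => p (z' a))
      = ε (z' k) * (ε z * g (i.insertNth (p z) fun a => p (z' a))) := fun z => by ring
  simp only [h3]
  rw [integral_const_mul, horth (fun x => g (i.insertNth x fun a => p (z' a))) (hg.comp ?_) c
    fun x => hc _, mul_zero]
  refine measurable_pi_iff.2 fun a => ?_
  refine Fin.succAboveCases i ?_ (fun b => ?_) a
  · simp [measurable_id']
  · simp

open Matrix in
/-- The expectation of a quadratic form in the noise whose matrix depends on the covariates. -/
theorem lintegral_noise_form_le (hε : Measurable ε) (hL : ∀ᵐ z ∂P, |ε z| ≤ L)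
    (hp : Measurable p)
    (horth : ∀ g : 𝒳 → ℝ, Measurable g → ∀ c, (∀ x, |g x| ≤ c) → ∫ z, ε z * g (p z) ∂P = 0)
    {n : ℕ} {G : (Fin n → 𝒳) → Matrix (Fin n) (Fin n) ℝ} (hG : ∀ x, (G x).PosSemidef)
    (hGm : ∀ i j, Measurable fun x => G x i j) {T : ℝ} (hT : ∀ x, (G x).trace ≤ T) :
    ∫⁻ z, ENNReal.ofReal ((fun i => ε (z i)) ⬝ᵥ G (fun a => p (z a)) *ᵥ fun i => ε (z i))
        ∂Measure.pi (fun _ : Fin n => P) ≤ ENNReal.ofReal (L ^ 2 * T) := by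
  have hb : ∀ i j x, |G x i j| ≤ T := fun i j x => (abs_entry_le_trace (hG x) i j).trans (hT x)
  have hint : ∀ i j, Integrable (fun z => ε (z i) * ε (z j) * G (fun a => p (z a)) i j)
      (Measure.pi (fun _ : Fin n => P)) := fun i j =>
    integrable_noise_mul hε hL hp i j (hGm i j) (hb i j)
  have hform : ∀ z : Fin n → Z, (fun i => ε (z i)) ⬝ᵥ G (fun a => p (z a)) *ᵥ (fun i => ε (z i))
      = ∑ i, ∑ j, ε (z i) * ε (z j) * G (fun a => p (z a)) i j := fun z => by
    simp only [dotProduct, mulVec, Finset.mul_sum]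
    exact Finset.sum_congr rfl fun i _ => Finset.sum_congr rfl fun j _ => by ring
  rw [← ofReal_integral_eq_lintegral_ofReal]
  rotate_left
  · simp only [hform]
    exact integrable_finsetSum _ fun i _ => integrable_finsetSum _ fun j _ => hint i j
  · exact .of_forall fun z => dotProduct_mulVec_self_nonneg (hG _) _
  refine ENNReal.ofReal_le_ofReal ?_
  have hdiag : ∀ i, ∑ j, ∫ z, ε (z i) * ε (z j) * G (fun a => p (z a)) i j
        ∂Measure.pi (fun _ : Fin n => P)
      = ∫ z, ε (z i) * ε (z i) * G (fun a => p (z a)) i i ∂Measure.pi (fun _ : Fin n => P) :=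
    fun i => Finset.sum_eq_single i (fun j _ hij =>
      integral_noise_mul_noise hε hL hp horth hij.symm (hGm i j) (hb i j)) (by simp)
  simp only [hform]
  rw [integral_finsetSum _ fun i _ => integrable_finsetSum _ fun j _ => hint i j]
  simp_rw [integral_finsetSum _ fun j _ => hint _ j, hdiag]
  rw [← integral_finsetSum _ fun i _ => hint i i]
  refine (integral_mono_ae (g := fun _ => L ^ 2 * T)
    (integrable_finsetSum _ fun i _ => hint i i) (integrable_const _) ?_).trans (by simp)
  filter_upwards [ae_pi_forall_abs_le hL n] with z hz
  have hd : ∀ k, 0 ≤ G (fun a => p (z a)) k k := fun k => by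
    simpa using dotProduct_mulVec_self_nonneg (hG fun a => p (z a)) (Pi.single k 1)
  calc ∑ i, ε (z i) * ε (z i) * G (fun a => p (z a)) i i
      ≤ ∑ i, L ^ 2 * G (fun a => p (z a)) i i := Finset.sum_le_sum fun i _ => by
        refine mul_le_mul_of_nonneg_right ?_ (hd i)
        rw [← sq, ← sq_abs]
        exact pow_le_pow_left₀ (abs_nonneg _) (hz i) 2
    _ = L ^ 2 * (G fun a => p (z a)).trace := by rw [← Finset.mul_sum]; rfl
    _ ≤ L ^ 2 * T := mul_le_mul_of_nonneg_left (hT _) (sq_nonneg _)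

end Noise

end MKL

namespace MKL

/-! ### The noise term on the sample -/

section SampleNoise

open Matrix

variable {𝒳 : Type*} {ι : Type*} {H : ι → Type*}
  [∀ m, NormedAddCommGroup (H m)] [∀ m, InnerProductSpace ℝ (H m)] [∀ m, CompleteSpace (H m)]
  [∀ m, RKHS ℝ (H m) 𝒳 ℝ] {n : ℕ}

theorem posSemidef_blockGram (x : Fin n → 𝒳) (m : ι) : (blockGram H x m).PosSemidef := by
  refine PosSemidef.of_dotProduct_mulVec_nonneg (IsHermitian.ext fun a b => ?_) fun c => ?_
  · simp only [blockGram, of_apply, star_trivial]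
    rw [real_inner_comm]
  · rw [star_trivial, dotProduct_gram_mulVec (K := blockGram H x m) (fun a => blockFeature H m (x a))
      (fun a b => rfl), real_inner_self_eq_norm_sq]
    positivity

theorem measurable_blockGram [MeasurableSpace 𝒳]
    (hM : ∀ (m : ι) (f : H m), Measurable fun x : 𝒳 => f x)
    (hB : SeparableBoundedKernels (𝒳 := 𝒳) H) (m : ι) (i j : Fin n) :
    Measurable fun x : Fin n → 𝒳 => blockGram H x m i j := by
  have := (hB m).1
  have h : ∀ i : Fin n, ∀ v : H m, Measurable fun x : Fin n → 𝒳 => ⟪blockFeature H m (x i), v⟫ :=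
    fun i v => by
      simp only [inner_blockFeature]
      exact (hM m v).comp (measurable_pi_apply i)
  exact (measurable_inner_of_weak (h i) (h j)).const_mul _

variable [Fintype ι]

theorem posSemidef_jointGram (x : Fin n → 𝒳) : (jointGram H x).PosSemidef :=
  Matrix.posSemidef_sum _ fun m _ => posSemidef_blockGram x m

theorem trace_jointGram_le [MeasurableSpace 𝒳] (hB : SeparableBoundedKernels (𝒳 := 𝒳) H)
    (x : Fin n → 𝒳) : (jointGram H x).trace ≤ Fintype.card ι := by
  have h : ∀ a, jointGram H x a a ≤ 1 / (n : ℝ) * Fintype.card ι := fun a => by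
    rw [jointGram_apply, real_inner_self_eq_norm_sq]
    exact mul_le_mul_of_nonneg_left (norm_feature_sq_le hB _) (by positivity)
  refine (Finset.sum_le_sum fun a _ => h a).trans ?_
  rw [Finset.sum_const, Finset.card_univ, Fintype.card_fin, nsmul_eq_mul, ← mul_assoc]
  rcases eq_or_ne (n : ℝ) 0 with h0 | h0
  · simp [h0]
  · rw [mul_one_div_cancel h0, one_mul]

theorem measurable_jointGram [MeasurableSpace 𝒳]
    (hM : ∀ (m : ι) (f : H m), Measurable fun x : 𝒳 => f x)
    (hB : SeparableBoundedKernels (𝒳 := 𝒳) H) (i j : Fin n) :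
    Measurable fun x : Fin n → 𝒳 => jointGram H x i j :=
  measurable_entry_sum _ (fun m i j => measurable_blockGram hM hB m i j) i j

/-- The inequality `s ≤ √n (s² / n + 1) / 2`, which trades a norm for a quadratic form. -/
theorem le_sqrt_mul_form (hn : n ≠ 0) (s : ℝ) :
    s ≤ √(n : ℝ) * ((1 / (n : ℝ) * s ^ 2 + 1) / 2) := by
  have h0 : 0 < √(n : ℝ) := Real.sqrt_pos.2 (by positivity)
  have h1 : 1 / (n : ℝ) * s ^ 2 = (s / √(n : ℝ)) ^ 2 := by
    rw [div_pow, Real.sq_sqrt (by positivity)]; ring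
  have h2 : s = √(n : ℝ) * (s / √(n : ℝ)) := by field_simp
  rw [h1]
  conv_lhs => rw [h2]
  refine mul_le_mul_of_nonneg_left ?_ h0.le
  nlinarith [sq_nonneg (s / √(n : ℝ) - 1)]

theorem norm_sum_feature_sq (x : Fin n → 𝒳) (d : Fin n → ℝ) :
    d ⬝ᵥ jointGram H x *ᵥ d = 1 / (n : ℝ) * ‖∑ i, d i • feature H (x i)‖ ^ 2 := by
  rw [dotProduct_gram_mulVec (fun a => feature H (x a)) (jointGram_apply x),
    real_inner_self_eq_norm_sq]

theorem abs_dotProduct_eval_le (hn : n ≠ 0) (x : Fin n → 𝒳) (f : PiLp 2 H) (d : Fin n → ℝ) :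
    |d ⬝ᵥ fun a => evalSum f (x a)|
      ≤ (√(n : ℝ) * ‖f‖) * ((d ⬝ᵥ jointGram H x *ᵥ d + 1) / 2) := by
  have h1 : (d ⬝ᵥ fun a => evalSum f (x a)) = ⟪∑ i, d i • feature H (x i), f⟫ := by
    simp [sum_inner, inner_smul_left, inner_feature, dotProduct]
  rw [h1, norm_sum_feature_sq]
  refine (abs_real_inner_le_norm _ _).trans ?_
  rw [mul_right_comm]
  exact mul_le_mul_of_nonneg_right (le_sqrt_mul_form hn _) (norm_nonneg _)

theorem norm_noiseVec_le (hn : n ≠ 0) (x : Fin n → 𝒳) (ε : Fin n → ℝ) :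
    ‖noiseVec H x ε‖ ≤ 1 / √(n : ℝ) * ((ε ⬝ᵥ jointGram H x *ᵥ ε + 1) / 2) := by
  have h0 : 0 < (n : ℝ) := by positivity
  rw [noiseVec, norm_smul, norm_sum_feature_sq, Real.norm_of_nonneg (by positivity)]
  refine (mul_le_mul_of_nonneg_left (le_sqrt_mul_form hn _)
    (by positivity : (0 : ℝ) ≤ 1 / n)).trans_eq ?_
  rw [← mul_assoc]
  congr 1
  rw [one_div, one_div, ← div_eq_inv_mul, Real.sqrt_div_self']
  exact one_div _

/-- The noise tested against the residual `f - u` of a ridge projection, uniformly over `f` and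
over penalty weights `e` close to `e₀`. -/
theorem abs_inner_noiseVec_le [MeasurableSpace 𝒳] (hB : SeparableBoundedKernels (𝒳 := 𝒳) H)
    (hn : n ≠ 0) {x : Fin n → 𝒳} {ε : Fin n → ℝ} {L : ℝ} (hε : ∀ i, |ε i| ≤ L)
    {I : Finset ι} {e₀ e : ι → ℝ} (he₀ : ∀ m, 0 < e₀ m) {τ : ℝ} (hτ : 0 ≤ τ) (hτ' : τ ≤ 1 / 2)
    (hτI : τ * I.card ≤ 1 / 2) (he : ∀ m ∈ I, 0 < e m ∧ |e₀ m / e m - 1| ≤ τ)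
    {f u : PiLp 2 H} (hu : IsRidge (empCov H x) I e (empCov H x f) u) (N : ℕ) :
    |⟪noiseVec H x ε, f - u⟫|
      ≤ (1 / √(n : ℝ) * ((ε ⬝ᵥ noiseForm I (fun m => (e₀ m)⁻¹ • blockGram H x m)
            (jointGram H x) τ N *ᵥ ε) / 2 + 1)
          + (1 / 2) ^ N * (2 * √(Fintype.card ι : ℝ) * L)) * ‖f‖ := by
  set X : ι → Matrix (Fin n) (Fin n) ℝ := fun m => (e₀ m)⁻¹ • blockGram H x m with hXdef
  have hX : ∀ m, (X m).PosSemidef := fun m =>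
    (posSemidef_blockGram x m).smul (inv_nonneg.2 (he₀ m).le)
  set r : Fin n → ℝ := fun a => evalSum (f - u) (x a) with hr
  set a : Fin n → ℝ := fun a => evalSum f (x a) with ha
  have h0 : 0 < (n : ℝ) := by positivity
  have hs0 : 0 < √(n : ℝ) := Real.sqrt_pos.2 h0
  have hL0 : 0 ≤ L := (abs_nonneg _).trans (hε ⟨0, Nat.pos_of_ne_zero hn⟩)
  have hsys : (1 + ∑ l ∈ I, X l) *ᵥ r + ∑ l ∈ I, (e₀ l / e l - 1) • (X l *ᵥ r) = a := by
    have h3 := hu.residual_eq fun m hm => (he m hm).1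
    rw [← hr, ← ha] at h3
    rw [← h3, add_mulVec, one_mulVec, Matrix.sum_mulVec, add_assoc, ← Finset.sum_add_distrib]
    congr 1
    refine Finset.sum_congr rfl fun m hm => ?_
    rw [hXdef, smul_mulVec, smul_smul, ← add_smul]
    congr 1
    have h1 := (he₀ m).ne'
    have h2 := (he m hm).1.ne'
    field_simp
    ring
  have hinner : ⟪noiseVec H x ε, f - u⟫ = 1 / (n : ℝ) * (ε ⬝ᵥ r) := inner_noiseVec _ _ _
  have hrem := abs_dotProduct_le_of_perturbed hX
    (fun l hl => (he l hl).2.trans hτ') hsys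
  have hmain := abs_dotProduct_le_neumann hX (ρ := 2 * √(a ⬝ᵥ a)) (by positivity) hτ
    (fun l hl => (he l hl).2) hsys (abs_dotProduct_eval_le hn x f) hrem N ε
  have hsum := sum_neumannBound_le (I := I) (X := X) (K := jointGram H x) hτ hτI N ε
  have haa : √(a ⬝ᵥ a) ≤ √(n : ℝ) * √(Fintype.card ι : ℝ) * ‖f‖ := by
    refine Real.sqrt_le_iff.2 ⟨by positivity, ?_⟩
    rw [mul_pow, mul_pow, Real.sq_sqrt h0.le, Real.sq_sqrt (by positivity)]
    have h1 : ∀ i, a i * a i ≤ Fintype.card ι * ‖f‖ ^ 2 := fun i => by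
      have h2 : |a i| ≤ ‖feature H (x i)‖ * ‖f‖ := by
        rw [ha]
        simp only
        rw [← inner_feature]
        exact abs_real_inner_le_norm _ _
      rw [← abs_mul_abs_self, ← sq]
      refine (pow_le_pow_left₀ (abs_nonneg _) h2 2).trans ?_
      rw [mul_pow]
      exact mul_le_mul_of_nonneg_right (norm_feature_sq_le hB _) (sq_nonneg _)
    refine (Finset.sum_le_sum fun i _ => h1 i).trans_eq ?_
    rw [Finset.sum_const, Finset.card_univ, Fintype.card_fin, nsmul_eq_mul, mul_assoc]
  have hQ : √(ε ⬝ᵥ resolvent I X *ᵥ ε) ≤ √(n : ℝ) * L := by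
    refine Real.sqrt_le_iff.2 ⟨by positivity, (resolvent_form_le hX ε).trans ?_⟩
    rw [mul_pow, Real.sq_sqrt h0.le]
    refine (Finset.sum_le_sum fun i _ => (?_ : ε i * ε i ≤ L ^ 2)).trans_eq ?_
    · rw [← abs_mul_abs_self, ← sq]
      exact pow_le_pow_left₀ (abs_nonneg _) (hε i) 2
    · rw [Finset.sum_const, Finset.card_univ, Fintype.card_fin, nsmul_eq_mul]
  rw [hinner, abs_mul, abs_of_nonneg (by positivity : (0 : ℝ) ≤ 1 / n)]
  have hn2 : √(n : ℝ) * √(n : ℝ) = n := Real.mul_self_sqrt h0.le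
  calc 1 / (n : ℝ) * |ε ⬝ᵥ r|
      ≤ 1 / (n : ℝ) * ((√(n : ℝ) * ‖f‖) *
            ((ε ⬝ᵥ noiseForm I X (jointGram H x) τ N *ᵥ ε) / 2 + 1)
          + (1 / 2) ^ N * (2 * (√(n : ℝ) * √(Fintype.card ι : ℝ) * ‖f‖) * (√(n : ℝ) * L))) := by
        refine mul_le_mul_of_nonneg_left (hmain.trans (add_le_add ?_ ?_)) (by positivity)
        · exact mul_le_mul_of_nonneg_left hsum (by positivity)
        · gcongr
    _ = _ := by
        have h3 : 1 / (n : ℝ) * √(n : ℝ) = 1 / √(n : ℝ) := by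
          rw [div_mul_eq_mul_div, one_mul, Real.sqrt_div_self', one_div]
        rw [add_mul, mul_add]
        congr 1
        · rw [← h3]; ring
        · calc _ = (1 / (n : ℝ) * (√(n : ℝ) * √(n : ℝ)))
              * ((1 / 2) ^ N * (2 * √(Fintype.card ι : ℝ) * L) * ‖f‖) := by ring
            _ = _ := by rw [hn2, one_div_mul_cancel h0.ne', one_mul]

end SampleNoise

end MKL

namespace MKL

/-! ### Convergence in probability along a filter -/

section ProbFilter

variable {Ω : Type*} [MeasurableSpace Ω] {μ : Measure Ω}

/-- The filter on `ℕ × Ω` of the events of asymptotic probability one: a property holds eventually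
along it when the probability that it fails at stage `n` tends to `0`. -/
def probFilter (μ : Measure Ω) : Filter (ℕ × Ω) where
  sets := {S | Tendsto (fun n => μ {ω | (n, ω) ∉ S}) atTop (𝓝 0)}
  univ_sets := by simp
  sets_of_superset {S T} hS hST := tendsto_of_tendsto_of_tendsto_of_le_of_le tendsto_const_nhds hS
    (fun _ => zero_le) fun _ => measure_mono fun _ hω h => hω (hST h)
  inter_sets {S T} hS hT := by
    have h : Tendsto (fun n => μ {ω | (n, ω) ∉ S} + μ {ω | (n, ω) ∉ T}) atTop (𝓝 0) := by
      simpa using Tendsto.add hS hT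
    refine tendsto_of_tendsto_of_tendsto_of_le_of_le tendsto_const_nhds h
      (fun _ => zero_le) fun n => (measure_mono fun ω hω => ?_).trans (measure_union_le _ _)
    simp only [Set.mem_ofPred_eq, Set.mem_inter_iff, not_and_or] at hω
    exact hω

theorem eventually_probFilter {p : ℕ × Ω → Prop} :
    (∀ᶠ a in probFilter μ, p a) ↔ Tendsto (fun n => μ {ω | ¬ p (n, ω)}) atTop (𝓝 0) :=
  Iff.rfl

theorem eventually_probFilter_of_ae {p : ℕ × Ω → Prop}
    (h : ∀ᶠ n in atTop, ∀ᵐ ω ∂μ, p (n, ω)) : ∀ᶠ a in probFilter μ, p a :=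
  eventually_probFilter.2 (tendsto_const_nhds.congr' (h.mono fun _ hn => (ae_iff.1 hn).symm))

theorem tendsto_fst_probFilter : Tendsto Prod.fst (probFilter μ) atTop := fun S hS =>
  eventually_probFilter_of_ae (p := fun a => a.1 ∈ S)
    (Filter.mem_of_superset hS fun _ hn => ae_of_all μ fun _ => hn)

/-- Random variables with bounded expectations, multiplied by a null sequence, tend to zero in
probability. -/
theorem tendsto_mul_probFilter {A : ℕ → Ω → ℝ≥0∞} (hA : ∀ᶠ n in atTop, AEMeasurable (A n) μ)
    {c : ℝ≥0∞} (hc : c ≠ ⊤) (hAc : ∀ᶠ n in atTop, ∫⁻ ω, A n ω ∂μ ≤ c) {δ : ℕ → ℝ}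
    (hδ : Tendsto δ atTop (𝓝 0)) {q : ℕ × Ω → ℝ} (hq₀ : ∀ᶠ n in atTop, ∀ ω, 0 ≤ q (n, ω))
    (hq : ∀ᶠ n in atTop, ∀ ω, ENNReal.ofReal (q (n, ω)) ≤ A n ω) :
    Tendsto (fun a => δ a.1 * q a) (probFilter μ) (𝓝 0) := by
  rw [Metric.tendsto_nhds]
  intro η hη
  rw [eventually_probFilter]
  have hη' : ENNReal.ofReal η ≠ 0 := by simpa using hη
  have hlim : Tendsto (fun n => ENNReal.ofReal |δ n| * c / ENNReal.ofReal η) atTop (𝓝 0) := by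
    have h1 : Tendsto (fun n => ENNReal.ofReal |δ n|) atTop (𝓝 0) := by
      simpa using ENNReal.tendsto_ofReal hδ.abs
    have h2 := ENNReal.Tendsto.mul_const (b := c) h1 (.inr hc)
    have h3 := ENNReal.Tendsto.div_const h2 (.inr hη')
    simpa using h3
  refine tendsto_of_tendsto_of_tendsto_of_le_of_le' tendsto_const_nhds hlim
    (.of_forall fun _ => zero_le) ?_
  filter_upwards [hA, hAc, hq₀, hq] with n hAn hAcn hq₀n hqn
  calc μ {ω | ¬ dist (δ n * q (n, ω)) 0 < η}
      ≤ μ {ω | ENNReal.ofReal η ≤ ENNReal.ofReal |δ n| * A n ω} := by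
        refine measure_mono fun ω hω => ?_
        simp only [Set.mem_ofPred_eq, not_lt, dist_zero_right, norm_mul, Real.norm_eq_abs,
          abs_of_nonneg (hq₀n ω)] at hω ⊢
        refine (ENNReal.ofReal_le_ofReal hω).trans ?_
        rw [ENNReal.ofReal_mul (abs_nonneg _)]
        gcongr
        exact hqn ω
    _ ≤ (∫⁻ ω, ENNReal.ofReal |δ n| * A n ω ∂μ) / ENNReal.ofReal η :=
        meas_ge_le_lintegral_div (hAn.const_mul _) hη' ENNReal.ofReal_ne_top
    _ ≤ ENNReal.ofReal |δ n| * c / ENNReal.ofReal η := by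
        rw [lintegral_const_mul'' _ hAn]
        gcongr

end ProbFilter

/-! ### The random sample -/

section RandomSample

variable {𝒳 : Type*} [MeasurableSpace 𝒳] {ι : Type*} [Fintype ι] {H : ι → Type*}
  [∀ m, NormedAddCommGroup (H m)] [∀ m, InnerProductSpace ℝ (H m)] [∀ m, RKHS ℝ (H m) 𝒳 ℝ]
  {P : Measure (𝒳 × ℝ)} {Ω : Type*} [MeasurableSpace Ω] {μ : Measure Ω}
  {X : ℕ → Ω → 𝒳} {Y : ℕ → Ω → ℝ} {fstar : PiLp 2 H}

theorem hasLaw_sample [IsProbabilityMeasure μ] (hlaw : ∀ i, HasLaw (fun ω => (X i ω, Y i ω)) P μ)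
    (hindep : iIndepFun (fun i ω => (X i ω, Y i ω)) μ) (n : ℕ) :
    HasLaw (fun ω (i : Fin n) => (X i ω, Y i ω)) (Measure.pi fun _ => P) μ :=
  iIndepFun.hasLaw_pi (fun i : Fin n => hlaw i) (hindep.precomp Fin.val_injective)

/-- The covariates of the first `n` observations, at the point `(n, ω)`. -/
def covariates (X : ℕ → Ω → 𝒳) (a : ℕ × Ω) : Fin a.1 → 𝒳 := fun i => X i a.2

/-- The noise of the first `n` observations, at the point `(n, ω)`. -/
noncomputable def noise (X : ℕ → Ω → 𝒳) (Y : ℕ → Ω → ℝ) (fstar : PiLp 2 H) (a : ℕ × Ω) :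
    Fin a.1 → ℝ :=
  fun i => Y i a.2 - evalSum fstar (X i a.2)

theorem eventually_noise_le (hlaw : ∀ i, HasLaw (fun ω => (X i ω, Y i ω)) P μ)
    (hM : ∀ (m : ι) (f : H m), Measurable fun x : 𝒳 => f x) {L : ℝ}
    (hL : ∀ᵐ z ∂P, |z.2 - evalSum fstar z.1| ≤ L) :
    ∀ᶠ a in probFilter μ, ∀ i, |noise X Y fstar a i| ≤ L := by
  refine eventually_probFilter_of_ae (.of_forall fun n =>
    (ae_all_iff (p := fun ω (i : Fin n) => |noise X Y fstar (n, ω) i| ≤ L)).2 fun i => ?_)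
  have hm : Measurable fun z : 𝒳 × ℝ => z.2 - evalSum fstar z.1 :=
    measurable_snd.sub ((measurable_evalSum hM fstar).comp measurable_fst)
  have h := (hlaw i).map_eq
  rw [← h] at hL
  exact ae_of_ae_map (hlaw i).aemeasurable hL

variable [∀ m, CompleteSpace (H m)] [IsProbabilityMeasure P]

theorem inner_jointCov_fst (hM : ∀ (m : ι) (f : H m), Measurable fun x : 𝒳 => f x)
    (hB : SeparableBoundedKernels (𝒳 := 𝒳) H) (f g : PiLp 2 H) :
    ⟪f, jointCov P.fst g⟫ = ∫ z, ⟪feature H z.1, f⟫ * ⟪feature H z.1, g⟫ ∂P := by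
  rw [inner_jointCov P.fst hM hB, Measure.fst, integral_map measurable_fst.aemeasurable
    (f := fun x => evalSum f x * evalSum g x)
    ((measurable_evalSum hM f).mul (measurable_evalSum hM g)).aestronglyMeasurable]
  simp only [inner_feature]

variable [IsProbabilityMeasure μ]

/-- The error of the empirical covariance operator is of order `1 / √n` in probability. -/
theorem tendsto_mul_cov_error (hlaw : ∀ i, HasLaw (fun ω => (X i ω, Y i ω)) P μ)
    (hindep : iIndepFun (fun i ω => (X i ω, Y i ω)) μ)
    (hM : ∀ (m : ι) (f : H m), Measurable fun x : 𝒳 => f x)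
    (hB : SeparableBoundedKernels (𝒳 := 𝒳) H) {δ : ℕ → ℝ} (hδ : Tendsto δ atTop (𝓝 0)) :
    Tendsto (fun a => δ a.1 * (a.1 * ‖empCov H (covariates X a) - jointCov P.fst‖ ^ 2))
      (probFilter μ) (𝓝 0) := by
  have hsep : ∀ m, TopologicalSpace.SeparableSpace (H m) := fun m => (hB m).1
  have hφ : ∀ v : PiLp 2 H, Measurable fun z : 𝒳 × ℝ => ⟪feature H z.1, v⟫ := fun v => by
    simp only [inner_feature]
    exact (measurable_evalSum hM v).comp measurable_fst
  have key : ∀ n : ℕ, ∃ S : (Fin n → 𝒳 × ℝ) → ℝ≥0∞, n ≠ 0 → Measurable S ∧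
      (∀ z, ENNReal.ofReal (‖empCov H (fun i => (z i).1) - jointCov P.fst‖ ^ 2) ≤ S z) ∧
      ∫⁻ z, S z ∂Measure.pi (fun _ => P)
        ≤ ENNReal.ofReal ((Fintype.card ι : ℝ) ^ 2 / n) := fun n => by
    rcases eq_or_ne n 0 with h | h
    · exact ⟨0, fun h' => (h' h).elim⟩
    · obtain ⟨S, hS⟩ := exists_cov_error_bound P hφ (fun z => norm_feature_sq_le hB z.1)
        (inner_jointCov_fst hM hB) h (T := fun z => empCov H fun i => (z i).1)
        (fun z f g => by rw [inner_empCov]; simp only [inner_feature])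
      exact ⟨S, fun _ => hS⟩
  choose S hS using key
  refine tendsto_mul_probFilter (A := fun n ω => n * S n fun i => (X i ω, Y i ω))
    (c := ENNReal.ofReal ((Fintype.card ι : ℝ) ^ 2)) ?_ ENNReal.ofReal_ne_top ?_ hδ
    (.of_forall fun n ω => by positivity) ?_
  · filter_upwards [eventually_ne_atTop 0] with n hn
    exact ((hS n hn).1.comp_aemeasurable (hasLaw_sample hlaw hindep n).aemeasurable).const_mul _
  · filter_upwards [eventually_ne_atTop 0] with n hn
    have hl := hasLaw_sample hlaw hindep n
    rw [lintegral_const_mul'' (f := fun ω => S n fun i => (X i ω, Y i ω)) _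
      ((hS n hn).1.comp_aemeasurable hl.aemeasurable), hl.lintegral_comp (f := S n) (hS n hn).1.aemeasurable]
    refine (mul_le_mul_right (hS n hn).2.2 _).trans ?_
    rw [← ENNReal.ofReal_natCast, ← ENNReal.ofReal_mul (by positivity)]
    refine (congrArg ENNReal.ofReal ?_).le
    field_simp
  · filter_upwards [eventually_ne_atTop 0] with n hn ω
    rw [ENNReal.ofReal_mul (by positivity), ENNReal.ofReal_natCast]
    gcongr
    exact (hS n hn).2.1 fun i => (X i ω, Y i ω)

open Matrix in
/-- Quadratic forms in the noise with matrices of bounded trace are bounded in probability. -/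
theorem tendsto_mul_noise_form (hlaw : ∀ i, HasLaw (fun ω => (X i ω, Y i ω)) P μ)
    (hindep : iIndepFun (fun i ω => (X i ω, Y i ω)) μ)
    (hM : ∀ (m : ι) (f : H m), Measurable fun x : 𝒳 => f x)
    (hB : SeparableBoundedKernels (𝒳 := 𝒳) H) (hreg : RegressionModel P fstar)
    {G : ∀ n, (Fin n → 𝒳) → Matrix (Fin n) (Fin n) ℝ} {T : ℝ}
    (hG : ∀ᶠ n in atTop, ∀ x, (G n x).PosSemidef)
    (hGm : ∀ᶠ n in atTop, ∀ i j, Measurable fun x => G n x i j)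
    (hT : ∀ᶠ n in atTop, ∀ x, (G n x).trace ≤ T) {δ : ℕ → ℝ} (hδ : Tendsto δ atTop (𝓝 0)) :
    Tendsto (fun a => δ a.1 * (noise X Y fstar a ⬝ᵥ G a.1 (covariates X a) *ᵥ noise X Y fstar a))
      (probFilter μ) (𝓝 0) := by
  obtain ⟨L, hL⟩ := hreg.2.2
  have hε : Measurable fun z : 𝒳 × ℝ => z.2 - evalSum fstar z.1 :=
    measurable_snd.sub ((measurable_evalSum hM fstar).comp measurable_fst)
  set S : ∀ n, (Fin n → 𝒳 × ℝ) → ℝ≥0∞ := fun n z => ENNReal.ofReal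
    ((fun i => (z i).2 - evalSum fstar (z i).1) ⬝ᵥ G n (fun i => (z i).1) *ᵥ
      fun i => (z i).2 - evalSum fstar (z i).1) with hS
  have hSm : ∀ᶠ n in atTop, Measurable (S n) := by
    filter_upwards [hGm] with n hn
    simp only [hS, dotProduct, mulVec]
    refine (Finset.measurable_fun_sum _ fun i _ => (hε.comp (measurable_pi_apply i)).mul
      (Finset.measurable_fun_sum _ fun j _ => Measurable.mul ?_
        (hε.comp (measurable_pi_apply j)))).ennreal_ofReal
    exact (hn i j).comp (measurable_pi_iff.2 fun k => measurable_fst.comp (measurable_pi_apply k))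
  refine tendsto_mul_probFilter (A := fun n ω => S n fun i => (X i ω, Y i ω))
    (c := ENNReal.ofReal (L ^ 2 * T)) ?_ ENNReal.ofReal_ne_top ?_ hδ ?_
    (.of_forall fun n ω => le_rfl)
  · filter_upwards [hSm] with n hn
    exact hn.comp_aemeasurable (hasLaw_sample hlaw hindep n).aemeasurable
  · filter_upwards [hSm, hG, hGm, hT] with n hn hGn hGmn hTn
    rw [(hasLaw_sample hlaw hindep n).lintegral_comp (f := S n) hn.aemeasurable]
    exact lintegral_noise_form_le hε hL measurable_fst
      (fun g hg c hc => hreg.integral_noise_mul hM hB hg hc) hGn hGmn hTn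
  · filter_upwards [hG] with n hn ω
    exact dotProduct_mulVec_self_nonneg (hn _) _

end RandomSample

end MKL

namespace MKL

/-! ### Consistency of the elastic-net estimator -/

section Consistency

variable {𝒳 : Type*} [MeasurableSpace 𝒳] {ι : Type*} [Fintype ι] {H : ι → Type*}
  [∀ m, NormedAddCommGroup (H m)] [∀ m, InnerProductSpace ℝ (H m)] [∀ m, RKHS ℝ (H m) 𝒳 ℝ]

/-- Finitely many strict bounds on limits superior have a common strict margin. -/
theorem exists_irrep_margin {ν : Measure 𝒳} {fstar : PiLp 2 H} {lam₁ lam₂ : ℕ → ℝ}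
    (h : ∀ m, m ∉ activeSet fstar →
      limsup (fun n => ‖irrepVec ν fstar (lam₁ n) (lam₂ n) m‖ₑ) atTop < 1) :
    ∃ κ < (1 : ℝ), ∀ᶠ n in atTop, ∀ m, m ∉ activeSet fstar →
      ‖irrepVec ν fstar (lam₁ n) (lam₂ n) m‖ ≤ κ := by
  have h1 : ∀ᶠ κ in 𝓝[<] (1 : ℝ), ∀ m, m ∉ activeSet fstar →
      ∀ᶠ n in atTop, ‖irrepVec ν fstar (lam₁ n) (lam₂ n) m‖ ≤ κ := by
    refine eventually_all.2 fun m => ?_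
    by_cases hm : m ∈ activeSet fstar
    · exact .of_forall fun _ h => (h hm).elim
    obtain ⟨r, hr, hr1⟩ := exists_between (h m hm)
    have hr2 : r.toReal < 1 := by
      simpa using (ENNReal.toReal_lt_toReal hr1.ne_top ENNReal.one_ne_top).2 hr1
    filter_upwards [Ioo_mem_nhdsLT hr2] with κ hκ _
    filter_upwards [eventually_lt_of_limsup_lt hr] with n hn
    have := (ENNReal.toReal_lt_toReal enorm_ne_top hr1.ne_top).2 hn
    rw [toReal_enorm] at this
    exact (this.trans hκ.1).le
  obtain ⟨κ, hκ, hκ1⟩ := (h1.and self_mem_nhdsWithin).exists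
  refine ⟨κ, hκ1, eventually_all.2 fun m => ?_⟩
  by_cases hm : m ∈ activeSet fstar
  · exact .of_forall fun _ h => (h hm).elim
  · exact (hκ m hm).mono fun n hn _ => hn

variable [∀ m, CompleteSpace (H m)]
  {P : Measure (𝒳 × ℝ)} [IsProbabilityMeasure P]
  {Ω : Type*} [MeasurableSpace Ω] {μ : Measure Ω} [IsProbabilityMeasure μ]
  {X : ℕ → Ω → 𝒳} {Y : ℕ → Ω → ℝ} {fstar : PiLp 2 H} {lam₁ lam₂ : ℕ → ℝ}

theorem eventually_pos_of_sqrt (h : Tendsto (fun n : ℕ => lam₁ n * √(n : ℝ)) atTop atTop) :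
    ∀ᶠ n in atTop, 0 < lam₁ n := by
  filter_upwards [h.eventually_gt_atTop 0] with n hn
  exact pos_of_mul_pos_left hn (Real.sqrt_nonneg _)

theorem tendsto_inv_sqrt_div (h : Tendsto (fun n : ℕ => lam₁ n * √(n : ℝ)) atTop atTop) :
    Tendsto (fun n : ℕ => 1 / √(n : ℝ) / lam₁ n) atTop (𝓝 0) := by
  refine h.inv_tendsto_atTop.congr fun n => ?_
  rw [Pi.inv_apply, div_div, one_div, mul_comm]

theorem tendsto_half_pow_div (h : Tendsto (fun n : ℕ => lam₁ n * √(n : ℝ)) atTop atTop) :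
    Tendsto (fun n : ℕ => (1 / 2 : ℝ) ^ n / lam₁ n) atTop (𝓝 0) := by
  refine squeeze_zero' ?_ ?_ (tendsto_inv_sqrt_div h)
  · filter_upwards [eventually_pos_of_sqrt h] with n hn
    positivity
  · filter_upwards [eventually_pos_of_sqrt h, eventually_ne_atTop 0] with n hn hn0
    refine div_le_div_of_nonneg_right ?_ hn.le
    have h1 : (1 : ℝ) ≤ n := by exact_mod_cast Nat.one_le_iff_ne_zero.2 hn0
    have h2 : √(n : ℝ) ≤ 2 ^ n := by
      refine (Real.sqrt_le_sqrt (le_self_pow₀ h1 two_ne_zero)).trans ?_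
      rw [Real.sqrt_sq (by positivity)]
      exact_mod_cast Nat.lt_two_pow_self.le
    rw [one_div_pow]
    exact one_div_le_one_div_of_le (Real.sqrt_pos.2 (by positivity)) h2

/-- The random elastic-net problems are instances of vanishing regularization along the filter of
convergence in probability. -/
theorem vanishingRegularization_sample
    (hmeas : ∀ (m : ι) (f : H m), Measurable fun x : 𝒳 => f x)
    (hlaw : ∀ i, HasLaw (fun ω => (X i ω, Y i ω)) P μ)
    (hindep : iIndepFun (fun i ω => (X i ω, Y i ω)) μ)
    (hA1 : RegressionModel P fstar) (hA2 : SeparableBoundedKernels (𝒳 := 𝒳) H)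
    (hA3 : SourceCondition P.fst fstar) (hA10 : CorrelationCondition P.fst H)
    (hlam₂_pos : ∀ n, 0 < lam₂ n) (hlam₁ : Tendsto lam₁ atTop (𝓝 0))
    (hlam₂ : Tendsto lam₂ atTop (𝓝 0))
    (hsqrt : Tendsto (fun n : ℕ => lam₁ n * √(n : ℝ)) atTop atTop)
    {fhat : ℕ → Ω → PiLp 2 H}
    (hfhat : ∀ n ω, IsMinOn
      (objective n (lam₁ n) (lam₂ n) (fun i => X i ω) (fun i => Y i ω)) Set.univ (fhat n ω)) :
    VanishingRegularization (probFilter μ) (jointCov P.fst) fstar (fun a => lam₁ a.1)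
      (fun a => lam₂ a.1) (fun a => empCov H (covariates X a))
      (fun a => noiseVec H (covariates X a) (noise X Y fstar a)) (fun a => fhat a.1 a.2) := by
  have hfst := tendsto_fst_probFilter (μ := μ)
  have hpos : ∀ᶠ a in probFilter μ, 0 < lam₁ a.1 := hfst.eventually (eventually_pos_of_sqrt hsqrt)
  have hn0 : ∀ᶠ a in probFilter μ, a.1 ≠ 0 := hfst.eventually (eventually_ne_atTop 0)
  have hδ := tendsto_inv_sqrt_div hsqrt
  have hδ' : Tendsto (fun a : ℕ × Ω => 1 / √(a.1 : ℝ) / lam₁ a.1) (probFilter μ) (𝓝 0) :=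
    hδ.comp hfst
  refine ⟨isPositive_jointCov P.fst hmeas hA2, fun a => isPositive_empCov _, hpos,
    .of_forall fun a => hlam₂_pos a.1, hlam₁.comp hfst, hlam₂.comp hfst, ?_, ?_,
    exists_source_bound P.fst hmeas hA2 hA3 hA10, .of_forall fun a g => ?_⟩
  · have h1 := tendsto_mul_noise_form (G := fun n x => jointGram H x) hlaw hindep hmeas hA2 hA1
      (.of_forall fun n x => posSemidef_jointGram x)
      (.of_forall fun n i j => measurable_jointGram hmeas hA2 i j)
      (.of_forall fun n x => trace_jointGram_le hA2 x) hδ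
    have h2 := (h1.add hδ').div_const 2
    rw [add_zero, zero_div] at h2
    refine squeeze_zero' ?_ ?_ h2
    · filter_upwards [hpos] with a ha
      positivity
    · filter_upwards [hpos, hn0] with a ha hna
      rw [div_le_iff₀ ha]
      refine (norm_noiseVec_le hna _ _).trans_eq ?_
      field_simp
  · have h1 := tendsto_mul_cov_error (H := H) hlaw hindep hmeas hA2 hδ
    have h2 := (h1.add hδ').div_const 2
    rw [add_zero, zero_div] at h2
    refine squeeze_zero' ?_ ?_ h2
    · filter_upwards [hpos] with a ha
      positivity
    · filter_upwards [hpos, hn0] with a ha hna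
      rw [div_le_iff₀ ha]
      have h3 := le_sqrt_mul_form hna (a.1 * ‖empCov H (covariates X a) - jointCov P.fst‖)
      have h4 : 0 < (a.1 : ℝ) := by positivity
      have h5 : √(a.1 : ℝ) / a.1 = 1 / √(a.1 : ℝ) := by
        rw [Real.sqrt_div_self', one_div]
      rw [← le_div_iff₀' h4] at h3
      refine h3.trans_eq ?_
      rw [mul_div_right_comm, h5]
      field_simp
  · have h := hfhat a.1 a.2 (Set.mem_univ g)
    simp only [Set.mem_ofPred_eq, objective_eq _ _ _ _ _ fstar] at h
    exact le_of_add_le_add_right h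

/-- The elastic-net estimator selects the right blocks with probability tending to one. -/
theorem eventually_activeSet_sample
    (hmeas : ∀ (m : ι) (f : H m), Measurable fun x : 𝒳 => f x)
    (hlaw : ∀ i, HasLaw (fun ω => (X i ω, Y i ω)) P μ)
    (hindep : iIndepFun (fun i ω => (X i ω, Y i ω)) μ)
    (hA1 : RegressionModel P fstar) (hA2 : SeparableBoundedKernels (𝒳 := 𝒳) H)
    (hlam₂_pos : ∀ n, 0 < lam₂ n)
    (hsqrt : Tendsto (fun n : ℕ => lam₁ n * √(n : ℝ)) atTop atTop)
    (hirrep : ∀ m, m ∉ activeSet fstar →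
      limsup (fun n => ‖irrepVec P.fst fstar (lam₁ n) (lam₂ n) m‖ₑ) atTop < 1)
    {fhat : ℕ × Ω → PiLp 2 H}
    (h : VanishingRegularization (probFilter μ) (jointCov P.fst) fstar (fun a => lam₁ a.1)
      (fun a => lam₂ a.1) (fun a => empCov H (covariates X a))
      (fun a => noiseVec H (covariates X a) (noise X Y fstar a)) fhat) :
    ∀ᶠ a in probFilter μ, activeSet (fhat a) = activeSet fstar := by
  have hfst := tendsto_fst_probFilter (μ := μ)
  have hn0 : ∀ᶠ a in probFilter μ, a.1 ≠ 0 := hfst.eventually (eventually_ne_atTop 0)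
  have hδ := tendsto_inv_sqrt_div hsqrt
  obtain ⟨κ, hκ, hκ'⟩ := exists_irrep_margin hirrep
  obtain ⟨L, hL⟩ := hA1.2.2
  set I := activeSet fstar with hI
  set τ : ℝ := 1 / (2 * (I.card + 1)) with hτ
  have hτ0 : 0 < τ := by positivity
  have hτ1 : τ ≤ 1 / 2 := by
    rw [hτ]
    exact one_div_le_one_div_of_le (by norm_num) (by linarith [Nat.cast_nonneg (α := ℝ) I.card])
  have hτI : τ * I.card ≤ 1 / 2 := by
    rw [hτ, div_mul_eq_mul_div, one_mul, div_le_div_iff₀ (by positivity) (by norm_num)]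
    linarith
  -- the ideal penalty weights
  set e₀ : ℕ → ι → ℝ := fun n m => lam₁ n * (2 * ‖fstar m‖)⁻¹ + lam₂ n with he₀
  have he₀pos : ∀ n, 0 < lam₁ n → ∀ m, 0 < e₀ n m := fun n hn m =>
    add_pos_of_nonneg_of_pos (by positivity) (hlam₂_pos n)
  set G : ∀ n, (Fin n → 𝒳) → Matrix (Fin n) (Fin n) ℝ := fun n x =>
    noiseForm I (fun m => (e₀ n m)⁻¹ • blockGram H x m) (jointGram H x) τ n with hG
  have hform := tendsto_mul_noise_form (G := G) (T := 2 * Fintype.card ι) hlaw hindep hmeas hA2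
    hA1 (.of_forall fun n x => posSemidef_noiseForm (posSemidef_jointGram x) hτ0.le n)
    (.of_forall fun n i j => measurable_entry_noiseForm
      (fun m i j => (measurable_blockGram hmeas hA2 m i j).const_mul _)
      (measurable_jointGram hmeas hA2) τ n i j)
    ((eventually_pos_of_sqrt hsqrt).mono fun n hn x =>
      (trace_noiseForm_le (fun m => (posSemidef_blockGram x m).smul
        (inv_nonneg.2 (he₀pos n hn m).le)) (posSemidef_jointGram x) hτ0.le hτI n).trans
        (mul_le_mul_of_nonneg_left (trace_jointGram_le hA2 x) zero_le_two)) hδ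
  refine h.eventually_activeSet_eq (κ := κ) (τ := τ) (N := fun a =>
    1 / √(a.1 : ℝ) * (dotProduct (noise X Y fstar a)
      (Matrix.mulVec (G a.1 (covariates X a)) (noise X Y fstar a)) / 2 + 1)
        + (1 / 2) ^ a.1 * (2 * √(Fintype.card ι : ℝ) * L)) hκ hτ0 ?_ ?_ ?_
  · filter_upwards [hfst.eventually hκ'] with a ha
    obtain ⟨x, hx, hx'⟩ := exists_isRidge_irrepVec P.fst hmeas hA2 fstar (lam₁ := lam₁ a.1)
      (hlam₂_pos a.1)
    exact ⟨x, hx, fun m hm => by rw [hx']; exact ha m hm⟩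
  · have h1 := ((hform.div_const 2).add (hδ.comp hfst)).add
      (((tendsto_half_pow_div hsqrt).comp hfst).mul_const (2 * √(Fintype.card ι : ℝ) * L))
    simp only [zero_div, add_zero, zero_mul] at h1
    refine h1.congr fun a => ?_
    simp only [Function.comp_apply]
    ring
  · filter_upwards [hn0, h.pos₁, eventually_noise_le hlaw hmeas hL] with a hna ha hLa e f u he hu
    exact abs_inner_noiseVec_le hA2 hna hLa (he₀pos a.1 ha) hτ0.le hτ1 hτI he hu a.1

end Consistency

end MKL

theorem theorem4
    {𝒳 : Type*} [MeasurableSpace 𝒳] {ι : Type*} [Fintype ι]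
    {H : ι → Type*} [∀ m, NormedAddCommGroup (H m)] [∀ m, InnerProductSpace ℝ (H m)]
    [∀ m, CompleteSpace (H m)] [∀ m, RKHS ℝ (H m) 𝒳 ℝ]
    (hmeas : ∀ (m : ι) (f : H m), Measurable fun x : 𝒳 => f x)
    -- the law of `(X, Y)` and the i.i.d. sample
    (P : Measure (𝒳 × ℝ)) [IsProbabilityMeasure P]
    {Ω : Type*} [MeasurableSpace Ω] (μ : Measure Ω) [IsProbabilityMeasure μ]
    (X : ℕ → Ω → 𝒳) (Y : ℕ → Ω → ℝ)
    (hlaw : ∀ i, HasLaw (fun ω => (X i ω, Y i ω)) P μ)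
    (hindep : iIndepFun (fun i ω => (X i ω, Y i ω)) μ)
    -- assumptions (A1), (A2), (A3), (A10)
    (fstar : PiLp 2 H)
    (hA1 : MKL.RegressionModel P fstar)
    (hA2 : MKL.SeparableBoundedKernels (𝒳 := 𝒳) H)
    (hA3 : MKL.SourceCondition P.fst fstar)
    (hA10 : MKL.CorrelationCondition P.fst H)
    -- the regularization parameters
    (lam₁ lam₂ : ℕ → ℝ)
    (hlam₂_pos : ∀ n, 0 < lam₂ n)
    (hlam₁ : Tendsto lam₁ atTop (𝓝 0))
    (hlam₂ : Tendsto lam₂ atTop (𝓝 0))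
    (hlam₁_sqrt : Tendsto (fun n : ℕ => lam₁ n * √(n : ℝ)) atTop atTop)
    -- the elastic-net irrepresentable condition
    (hirrep : ∀ m, m ∉ MKL.activeSet fstar →
      limsup (fun n => ‖MKL.irrepVec P.fst fstar (lam₁ n) (lam₂ n) m‖ₑ) atTop < 1)
    -- the elastic-net estimator
    (fhat : ℕ → Ω → PiLp 2 H)
    (hfhat : ∀ n ω, IsMinOn
      (MKL.objective n (lam₁ n) (lam₂ n) (fun i => X i ω) (fun i => Y i ω)) Set.univ (fhat n ω)) :
    TendstoInMeasure μ fhat atTop (fun _ => fstar) ∧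
      Tendsto (fun n => μ {ω | MKL.activeSet (fhat n ω) ≠ MKL.activeSet fstar}) atTop (𝓝 0) := by
  have h := MKL.vanishingRegularization_sample hmeas hlaw hindep hA1 hA2 hA3 hA10 hlam₂_pos hlam₁
    hlam₂ hlam₁_sqrt hfhat
  refine ⟨fun δ hδ => ?_, MKL.eventually_probFilter.1
    (MKL.eventually_activeSet_sample hmeas hlaw hindep hA1 hA2 hlam₂_pos hlam₁_sqrt hirrep h)⟩
  have h1 := MKL.eventually_probFilter.1 (EMetric.tendsto_nhds.1 h.tendsto_minimizer δ hδ)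
  simpa only [not_lt] using h1
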